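/- Let $\mathbf T^X$ be the set of finite types generated from the ground types $0$ (natural numbers) and $X$ by $\rho,\tau\mapsto(\rho\to\tau)$. Let $\widehat{\mathrm{PA}}{}^\omega{\upharpoonright}[X,\langle\cdot,\cdot\rangle]$ be the following theory in classical many-sorted logic over $\mathbf T^X$, whose only prime formulas are equations of type $0$. Its constants are $0$, the successor $S$, the combinators $\Pi_{\rho,\tau}$, $\Sigma_{\delta,\rho,\tau}$, the recursors with values in the ground types $0$ and $X$ (but none with values in function types), and $0_X,+_X,-_X,\cdot_X,\|\cdot\|_X,\langle\cdot,\cdot\rangle_X$, where real numbers are represented by type-$(0\to0)$ functions coding Cauchy sequences of rationals with rate $2^{-n}$. Equality at $X$ is defined by $x=_Xy:\equiv\|x-_Xy\|_X=_{\mathbb R}0$ and equality at function types is defined pointwise. The axioms and rules are: the equality axioms for type $0$, the successor axioms, the defining equations of the combinators and recursors, quantifier-free induction, quantifier-free choice $\mathrm{QF\text{-}AC}^{\rho,\tau}$: $\forall x^\rho\exists y^\tau A_0(x,y)\to\exists Y^{\rho\to\tau}\forall x^\rho A_0(x,Yx)$ for all types $\rho,\tau$, the quantifier-free extensionality rule (from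 a theorem $A_0\to s=_\rho t$ infer $A_0\to r[s]=_\tau r[t]$; $A_0$ quantifier-free), and the axioms saying that $X$ is a real vector space with norm $\|\cdot\|_X$ and scalar product $\langle\cdot,\cdot\rangle_X$ satisfying $\langle x,x\rangle=\|x\|^2$ (completeness of $X$ is not needed and not assumed). Let $\Pi^0_1\text{-}\mathrm{CP}$ be the collection schema $\forall n\le k\,\exists m\,A(n,m)\to\exists M\,\forall n\le k\,\exists m\le M\,A(n,m)$ for formulas $A(n,m)\equiv\forall z^0A_0(n,m,z)$, $A_0$ quantifier-free (with parameters of arbitrary type). For a sequence $(x_i)$ in $X$ let $\mathrm{BW}_{\mathrm{weak}}((x_i))$ be the statement: if $(x_i)$ is bounded in norm, then there are a point $x\in X$ and a strictly increasing $h\colon\mathbb N\to\mathbb N$ such that $\lim_{i\to\infty}\langle y,x_{h(i)}\rangle=\langle y,x\rangle$ for all $y\in X$. For a term $t$ of type $0\to0\to0\to0$ let $\Pi^0_2\text{-}\mathrm{CA}(t)$ be the statement $\exists g\,\forall n\,\bigl(g(n)=0\leftrightarrow\forall x\,\exists y\;t\,x\,y\,n=0\bigr)$. **Theorem.** For every term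 $t$ of type $0\to0\to0\to0$ (possibly with free variables), \[ \widehat{\mathrm{PA}}{}^\omega{\upharpoonright}[X,\langle\cdot,\cdot\rangle]+\Pi^0_1\text{-}\mathrm{CP}\;\vdash\; \Bigl(\exists (e_i)_{i\in\mathbb N}\,\forall i,j\;\langle e_i,e_j\rangle=_{\mathbb R}\delta_{ij}\Bigr)\to \exists (x_i)_{i\in\mathbb N}\Bigl((x_i)\text{ is bounded}\wedge\bigl(\mathrm{BW}_{\mathrm{weak}}((x_i))\to\Pi^0_2\text{-}\mathrm{CA}(t)\bigr)\Bigr). \] Moreover, the sequence can be computed primitive recursively and uniformly from $t$ and $(e_i)$: there is a closed term $F$ of the theory such that, for all terms $t$ of type $0\to0\to0\to0$ and $e$ of type $0\to X$, the theory $\widehat{\mathrm{PA}}{}^\omega{\upharpoonright}[X,\langle\cdot,\cdot\rangle]+\Pi^0_1\text{-}\mathrm{CP}$ proves that if $\forall i,j\;\langle e_i,e_j\rangle=_{\mathbb R}\delta_{ij}$, then $(Fte)_i$ is a bounded sequence in $X$ and $\mathrm{BW}_{\mathrm{weak}}(Fte)\to\Pi^0_2\text{-}\mathrm{CA}(t)$.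 -/

import Mathlib

namespace FinTypeArith

/-! ## Syntax: finite types over `0` and `X`, combinatory terms, formulas -/

/-- The finite types over the two ground types `nat` (the type `0` of natural numbers) and `X`
(the abstract space). -/
inductive Ty : Type
  | nat : Ty
  | X : Ty
  | arr : Ty → Ty → Ty

infixr:60 " ⇒ " => Ty.arr

/-- The type `1` of number-theoretic functions; its elements also serve as names of reals. -/
abbrev Ty.fn : Ty := Ty.nat ⇒ Ty.nat

abbrev Ctx : Type := List Ty

/-- Typed de Bruijn variables. -/
inductive Var : Ctx → Ty → Type
  | vz {Γ : Ctx} {ρ : Ty} : Var (ρ :: Γ) ρ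
  | vs {Γ : Ctx} {ρ τ : Ty} : Var Γ ρ → Var (τ :: Γ) ρ

/-- The constants. `recN` and `recX` are the recursors with values in the two ground types; with
the combinators they define the predicative (Kleene-Feferman) recursors of every finite type.
There is no recursor with values in a function type. -/
inductive Cst : Ty → Type
  | zero : Cst .nat
  | succ : Cst (.nat ⇒ .nat)
  | K (ρ τ : Ty) : Cst (ρ ⇒ τ ⇒ ρ)
  | S (δ ρ τ : Ty) : Cst ((δ ⇒ ρ ⇒ τ) ⇒ (δ ⇒ ρ) ⇒ δ ⇒ τ)
  | recN : Cst (.nat ⇒ .nat ⇒ (.nat ⇒ .nat ⇒ .nat) ⇒ .nat)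
  | recX : Cst (.nat ⇒ .X ⇒ (.X ⇒ .nat ⇒ .X) ⇒ .X)
  | zeroX : Cst .X
  | addX : Cst (.X ⇒ .X ⇒ .X)
  | negX : Cst (.X ⇒ .X)
  | smulX : Cst (.fn ⇒ .X ⇒ .X)
  | normX : Cst (.X ⇒ .fn)
  | innerX : Cst (.X ⇒ .X ⇒ .fn)

inductive Tm (Γ : Ctx) : Ty → Type
  | var {ρ : Ty} : Var Γ ρ → Tm Γ ρ
  | con {ρ : Ty} : Cst ρ → Tm Γ ρ
  | app {ρ τ : Ty} : Tm Γ (ρ ⇒ τ) → Tm Γ ρ → Tm Γ τ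

infixl:80 " ⬝ " => Tm.app

/-- Formulas of classical many-sorted logic. The only prime formulas are equations of type `0`. -/
inductive Fm : Ctx → Type
  | eq {Γ : Ctx} : Tm Γ .nat → Tm Γ .nat → Fm Γ
  | bot {Γ : Ctx} : Fm Γ
  | imp {Γ : Ctx} : Fm Γ → Fm Γ → Fm Γ
  | all {Γ : Ctx} (ρ : Ty) : Fm (ρ :: Γ) → Fm Γ

infixr:35 " ⇛ " => Fm.imp

def Tm.subst {Γ Δ : Ctx} (σ : ∀ ρ, Var Γ ρ → Tm Δ ρ) : {τ : Ty} → Tm Γ τ → Tm Δ τ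
  | _, .var v => σ _ v
  | _, .con c => .con c
  | _, .app f a => .app (f.subst σ) (a.subst σ)

def Tm.wk {Γ : Ctx} {ρ τ : Ty} (t : Tm Γ τ) : Tm (ρ :: Γ) τ :=
  t.subst fun _ v => .var (.vs v)

def emptySubst {Γ : Ctx} : ∀ τ, Var [] τ → Tm Γ τ := nofun

/-- A closed term, read in an arbitrary context. -/
def Tm.cl {Γ : Ctx} {τ : Ty} (t : Tm [] τ) : Tm Γ τ :=
  t.subst emptySubst

def liftSubst {Γ Δ : Ctx} (ρ : Ty) (σ : ∀ τ, Var Γ τ → Tm Δ τ) :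
    ∀ τ, Var (ρ :: Γ) τ → Tm (ρ :: Δ) τ
  | _, .vz => .var .vz
  | _, .vs v => (σ _ v).wk

/-- The substitution `x₀ := s`, all other variables being lowered by one. -/
def instSubst {Γ : Ctx} {ρ : Ty} (s : Tm Γ ρ) : ∀ τ, Var (ρ :: Γ) τ → Tm Γ τ
  | _, .vz => s
  | _, .vs v => .var v

/-- The substitution `x₀ := s` where `s` may contain `x₀`, all other variables being kept. -/
def replSubst {Γ : Ctx} {ρ : Ty} (s : Tm (ρ :: Γ) ρ) : ∀ τ, Var (ρ :: Γ) τ → Tm (ρ :: Γ) τ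
  | _, .vz => s
  | _, .vs v => .var (.vs v)

def Tm.inst {Γ : Ctx} {ρ τ : Ty} (r : Tm (ρ :: Γ) τ) (s : Tm Γ ρ) : Tm Γ τ :=
  r.subst (instSubst s)

namespace Fm

def subst : {Γ Δ : Ctx} → (∀ ρ, Var Γ ρ → Tm Δ ρ) → Fm Γ → Fm Δ
  | _, _, σ, .eq s t => .eq (s.subst σ) (t.subst σ)
  | _, _, _, .bot => .bot
  | _, _, σ, .imp A B => .imp (A.subst σ) (B.subst σ)
  | _, _, σ, .all ρ A => .all ρ (A.subst (liftSubst ρ σ))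

def wk {Γ : Ctx} {ρ : Ty} (A : Fm Γ) : Fm (ρ :: Γ) := A.subst fun _ v => .var (.vs v)

def inst {Γ : Ctx} {ρ : Ty} (A : Fm (ρ :: Γ)) (s : Tm Γ ρ) : Fm Γ := A.subst (instSubst s)

def neg {Γ : Ctx} (A : Fm Γ) : Fm Γ := A ⇛ .bot
def and {Γ : Ctx} (A B : Fm Γ) : Fm Γ := neg (A ⇛ neg B)
def iff {Γ : Ctx} (A B : Fm Γ) : Fm Γ := and (A ⇛ B) (B ⇛ A)
def ex {Γ : Ctx} (ρ : Ty) (A : Fm (ρ :: Γ)) : Fm Γ := neg (.all ρ (neg A))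

/-- Quantifier-free formulas. -/
def QF : {Γ : Ctx} → Fm Γ → Prop
  | _, .eq _ _ => True
  | _, .bot => True
  | _, .imp A B => A.QF ∧ B.QF
  | _, .all _ _ => False

end Fm

/-- Combinatory abstraction `λ x₀. t`. -/
def lam {Γ : Ctx} {ρ : Ty} : {τ : Ty} → Tm (ρ :: Γ) τ → Tm Γ (ρ ⇒ τ)
  | _, .var .vz => .con (.S ρ (ρ ⇒ ρ) ρ) ⬝ .con (.K ρ (ρ ⇒ ρ)) ⬝ .con (.K ρ ρ)
  | _, .var (.vs v) => .con (.K _ ρ) ⬝ .var v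
  | _, .con c => .con (.K _ ρ) ⬝ .con c
  | _, .app f a => .con (.S ρ _ _) ⬝ lam f ⬝ lam a

section Variables

variable {Γ : Ctx} {ρ₀ ρ₁ ρ₂ ρ₃ : Ty}

def v0 : Tm (ρ₀ :: Γ) ρ₀ := .var .vz
def v1 : Tm (ρ₀ :: ρ₁ :: Γ) ρ₁ := .var (.vs .vz)
def v2 : Tm (ρ₀ :: ρ₁ :: ρ₂ :: Γ) ρ₂ := .var (.vs (.vs .vz))
def v3 : Tm (ρ₀ :: ρ₁ :: ρ₂ :: ρ₃ :: Γ) ρ₃ := .var (.vs (.vs (.vs .vz)))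

end Variables

/-! ## Primitive recursive arithmetic

Each operation is a closed term (name ending in `C`), followed by its application to arguments. -/

section Arithmetic

variable {Γ : Ctx}

def zero : Tm Γ .nat := .con .zero
def suc (s : Tm Γ .nat) : Tm Γ .nat := .con .succ ⬝ s

def num : ℕ → Tm Γ .nat
  | 0 => zero
  | n + 1 => suc (num n)

/-- Recursion on `n` with initial value `a`; in the step, `v0` is the index and `v1` the previous
value. -/
def prim (n a : Tm Γ .nat) (step : Tm (.nat :: .nat :: Γ) .nat) : Tm Γ .nat :=
  .con .recN ⬝ n ⬝ a ⬝ lam (lam step)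

def addC : Tm [] (.nat ⇒ .nat ⇒ .nat) := lam (lam (prim v0 v1 (suc v1)))
def add (s t : Tm Γ .nat) : Tm Γ .nat := addC.cl ⬝ s ⬝ t

def predC : Tm [] (.nat ⇒ .nat) := lam (prim v0 zero v0)
def pred (s : Tm Γ .nat) : Tm Γ .nat := predC.cl ⬝ s

/-- Truncated subtraction. -/
def monusC : Tm [] (.nat ⇒ .nat ⇒ .nat) := lam (lam (prim v0 v1 (pred v1)))
def monus (s t : Tm Γ .nat) : Tm Γ .nat := monusC.cl ⬝ s ⬝ t

def mulC : Tm [] (.nat ⇒ .nat ⇒ .nat) := lam (lam (prim v0 zero (add v1 v3)))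
def mul (s t : Tm Γ .nat) : Tm Γ .nat := mulC.cl ⬝ s ⬝ t

def pow2C : Tm [] (.nat ⇒ .nat) := lam (prim v0 (num 1) (add v1 v1))
def pow2 (s : Tm Γ .nat) : Tm Γ .nat := pow2C.cl ⬝ s

/-- `cond c a b` is `a` if `c = 0` and `b` otherwise. -/
def condC : Tm [] (.nat ⇒ .nat ⇒ .nat ⇒ .nat) := lam (lam (lam (prim v2 v1 v2)))
def cond (c a b : Tm Γ .nat) : Tm Γ .nat := condC.cl ⬝ c ⬝ a ⬝ b

def le (s t : Tm Γ .nat) : Fm Γ := .eq (monus s t) zero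

/-- Triangular numbers. -/
def triC : Tm [] (.nat ⇒ .nat) := lam (prim v0 zero (add v1 (suc v0)))
def tri (s : Tm Γ .nat) : Tm Γ .nat := triC.cl ⬝ s

/-- Cantor pairing `j(x, y) = ((x + y)² + 3x + y) / 2`. -/
def pairC : Tm [] (.nat ⇒ .nat ⇒ .nat) := lam (lam (add (tri (add v1 v0)) v1))
def pair (s t : Tm Γ .nat) : Tm Γ .nat := pairC.cl ⬝ s ⬝ t

/-- The largest `w` with `tri w ≤ z`. -/
def rootC : Tm [] (.nat ⇒ .nat) :=
  lam (prim v0 zero (cond (monus (tri (suc v1)) (suc v0)) (suc v1) v1))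
def root (s : Tm Γ .nat) : Tm Γ .nat := rootC.cl ⬝ s

def fstC : Tm [] (.nat ⇒ .nat) := lam (monus v0 (tri (root v0)))
def fst (s : Tm Γ .nat) : Tm Γ .nat := fstC.cl ⬝ s

def sndC : Tm [] (.nat ⇒ .nat) := lam (monus (root v0) (fst v0))
def snd (s : Tm Γ .nat) : Tm Γ .nat := sndC.cl ⬝ s

/-- Remainder modulo two. -/
def parC : Tm [] (.nat ⇒ .nat) := lam (prim v0 zero (monus (num 1) v1))
def par (s : Tm Γ .nat) : Tm Γ .nat := parC.cl ⬝ s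

/-- Quotient by two. -/
def halfC : Tm [] (.nat ⇒ .nat) := lam (prim v0 zero (add v1 (par v0)))
def half (s : Tm Γ .nat) : Tm Γ .nat := halfC.cl ⬝ s

end Arithmetic

/-! ## Rational numbers

The number `2k` codes the integer `k`, the number `2k - 1` codes `-k` (`k > 0`), and the number
`j(a, d)` codes the rational with numerator coded by `a` and denominator `d + 1`. -/

section Rationals

variable {Γ : Ctx}

/-- The code of the integer `p - q`. -/
def intC : Tm [] (.nat ⇒ .nat ⇒ .nat) :=
  lam (lam (cond (monus v0 v1) (mul (num 2) (monus v1 v0)) (pred (mul (num 2) (monus v0 v1)))))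
def int (p q : Tm Γ .nat) : Tm Γ .nat := intC.cl ⬝ p ⬝ q

/-- The positive part of the numerator of a coded rational. -/
def posC : Tm [] (.nat ⇒ .nat) := lam (mul (monus (num 1) (par (fst v0))) (half (fst v0)))
def pos (r : Tm Γ .nat) : Tm Γ .nat := posC.cl ⬝ r

/-- The negative part of the numerator of a coded rational. -/
def ngtC : Tm [] (.nat ⇒ .nat) := lam (mul (par (fst v0)) (half (suc (fst v0))))
def ngt (r : Tm Γ .nat) : Tm Γ .nat := ngtC.cl ⬝ r

def den (r : Tm Γ .nat) : Tm Γ .nat := suc (snd r)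

/-- The code of `(p - q) / d` for `d > 0`. -/
def mkQ (p q d : Tm Γ .nat) : Tm Γ .nat := pair (int p q) (pred d)

def addQC : Tm [] (.nat ⇒ .nat ⇒ .nat) :=
  lam (lam (mkQ (add (mul (pos v1) (den v0)) (mul (pos v0) (den v1)))
    (add (mul (ngt v1) (den v0)) (mul (ngt v0) (den v1))) (mul (den v1) (den v0))))
def addQ (r s : Tm Γ .nat) : Tm Γ .nat := addQC.cl ⬝ r ⬝ s

def mulQC : Tm [] (.nat ⇒ .nat ⇒ .nat) :=
  lam (lam (mkQ (add (mul (pos v1) (pos v0)) (mul (ngt v1) (ngt v0)))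
    (add (mul (pos v1) (ngt v0)) (mul (ngt v1) (pos v0))) (mul (den v1) (den v0))))
def mulQ (r s : Tm Γ .nat) : Tm Γ .nat := mulQC.cl ⬝ r ⬝ s

def negQC : Tm [] (.nat ⇒ .nat) := lam (mkQ (ngt v0) (pos v0) (den v0))
def negQ (r : Tm Γ .nat) : Tm Γ .nat := negQC.cl ⬝ r

def subQ (r s : Tm Γ .nat) : Tm Γ .nat := addQ r (negQ s)

def absQC : Tm [] (.nat ⇒ .nat) := lam (mkQ (add (pos v0) (ngt v0)) zero (den v0))
def absQ (r : Tm Γ .nat) : Tm Γ .nat := absQC.cl ⬝ r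

/-- The characteristic function of `<` on coded rationals: `0` if `r < s`, positive otherwise. -/
def ltQC : Tm [] (.nat ⇒ .nat ⇒ .nat) :=
  lam (lam (monus (suc (add (mul (pos v1) (den v0)) (mul (ngt v0) (den v1))))
    (add (mul (pos v0) (den v1)) (mul (ngt v1) (den v0)))))
def ltQ (r s : Tm Γ .nat) : Tm Γ .nat := ltQC.cl ⬝ r ⬝ s

/-- The rational `2⁻ⁿ`. -/
def invPow2C : Tm [] (.nat ⇒ .nat) := lam (mkQ (num 1) zero (pow2 v0))
def invPow2 (n : Tm Γ .nat) : Tm Γ .nat := invPow2C.cl ⬝ n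

end Rationals

/-! ## Real numbers

A function `f` of type `1` names a real: `hat f` agrees with `f` as long as
`|f k - f (k + 1)| < 2⁻⁽ᵏ⁺¹⁾`, and is constant from the first violation on. Hence every `f` of
type `1` names exactly one real. -/

section Reals

variable {Γ : Ctx}

/-- `hat f n = f n` if `|f k - f (k + 1)| < 2⁻⁽ᵏ⁺¹⁾` for all `k < n`, and `hat f n = f k` for the
least `k < n` violating this otherwise. -/
def hatC : Tm [] (.fn ⇒ .fn) :=
  lam (lam (v1 ⬝ prim v0 zero
    (cond (add (monus v0 v1)
        (ltQ (absQ (subQ (v3 ⬝ v0) (v3 ⬝ suc v0))) (invPow2 (suc v0))))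
      (suc v0) v1)))
def hat (f : Tm Γ .fn) (n : Tm Γ .nat) : Tm Γ .nat := hatC.cl ⬝ f ⬝ n

def eqR (f g : Tm Γ .fn) : Fm Γ :=
  .all .nat (.eq (ltQ (absQ (subQ (hat f.wk (suc v0)) (hat g.wk (suc v0)))) (invPow2 v0)) zero)

def leR (f g : Tm Γ .fn) : Fm Γ :=
  .all .nat (.eq (ltQ (subQ (hat f.wk (suc v0)) (hat g.wk (suc v0))) (invPow2 v0)) zero)

/-- The embedding of the rationals into the reals. -/
def constRC : Tm [] (.nat ⇒ .fn) := lam (lam v1)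
def constR (q : Tm Γ .nat) : Tm Γ .fn := constRC.cl ⬝ q

def zeroQ : Tm Γ .nat := mkQ zero zero (num 1)
def oneQ : Tm Γ .nat := mkQ (num 1) zero (num 1)

def zeroR : Tm Γ .fn := constR zeroQ
def oneR : Tm Γ .fn := constR oneQ

def addRC : Tm [] (.fn ⇒ .fn ⇒ .fn) :=
  lam (lam (lam (addQ (hat v2 (suc v0)) (hat v1 (suc v0)))))
def addR (f g : Tm Γ .fn) : Tm Γ .fn := addRC.cl ⬝ f ⬝ g

def negRC : Tm [] (.fn ⇒ .fn) := lam (lam (negQ (hat v1 v0)))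
def negR (f : Tm Γ .fn) : Tm Γ .fn := negRC.cl ⬝ f

def subR (f g : Tm Γ .fn) : Tm Γ .fn := addR f (negR g)

def absRC : Tm [] (.fn ⇒ .fn) := lam (lam (absQ (hat v1 v0)))
def absR (f : Tm Γ .fn) : Tm Γ .fn := absRC.cl ⬝ f

/-- A number `k` with `|f 0| + |g 0| + 2 ≤ k ≤ 2ᵏ`. -/
def mulBound (f g : Tm Γ .fn) : Tm Γ .nat :=
  add (add (add (pos (f ⬝ zero)) (ngt (f ⬝ zero))) (add (pos (g ⬝ zero)) (ngt (g ⬝ zero))))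
    (num 2)

def mulRC : Tm [] (.fn ⇒ .fn ⇒ .fn) :=
  lam (lam (lam (mulQ (hat v2 (add v0 (mulBound v2 v1))) (hat v1 (add v0 (mulBound v2 v1))))))
def mulR (f g : Tm Γ .fn) : Tm Γ .fn := mulRC.cl ⬝ f ⬝ g

end Reals

/-! ## The abstract space and equality of higher types -/

section Space

variable {Γ : Ctx}

def zeroX : Tm Γ .X := .con .zeroX
def addX (x y : Tm Γ .X) : Tm Γ .X := .con .addX ⬝ x ⬝ y
def negX (x : Tm Γ .X) : Tm Γ .X := .con .negX ⬝ x
def subX (x y : Tm Γ .X) : Tm Γ .X := addX x (negX y)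
def smulX (a : Tm Γ .fn) (x : Tm Γ .X) : Tm Γ .X := .con .smulX ⬝ a ⬝ x
def normX (x : Tm Γ .X) : Tm Γ .fn := .con .normX ⬝ x
def innerX (x y : Tm Γ .X) : Tm Γ .fn := .con .innerX ⬝ x ⬝ y

/-- Equality of objects of `X` is defined as `‖x - y‖ = 0`. -/
def eqX (x y : Tm Γ .X) : Fm Γ := eqR (normX (subX x y)) zeroR

end Space

/-- The defined (extensional) equality of arbitrary type. -/
def eqT : {Γ : Ctx} → (ρ : Ty) → Tm Γ ρ → Tm Γ ρ → Fm Γ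
  | _, .nat, s, t => .eq s t
  | _, .X, s, t => eqX s t
  | _, .arr ρ τ, s, t => .all ρ (eqT τ (s.wk ⬝ v0) (t.wk ⬝ v0))

/-! ## The formal systems -/

/-- From `A(x, y)` (with `v0 = y`, `v1 = x`) to `A(x, Y x)` (with `v0 = x`, `v1 = Y`). -/
def choiceSubst {Γ : Ctx} {ρ τ : Ty} :
    ∀ δ, Var (τ :: ρ :: Γ) δ → Tm (ρ :: (ρ ⇒ τ) :: Γ) δ
  | _, .vz => v1 ⬝ v0
  | _, .vs .vz => v0
  | _, .vs (.vs v) => .var (.vs (.vs v))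

/-- The renaming that inserts an unused variable (the bound `M`) below `z, m, n`. -/
def collSubst {Γ : Ctx} :
    ∀ δ, Var (.nat :: .nat :: .nat :: Γ) δ → Tm (.nat :: .nat :: .nat :: .nat :: Γ) δ :=
  liftSubst .nat (liftSubst .nat (liftSubst .nat fun _ v => .var (.vs v)))

/-- The non-logical axioms of the weakly extensional system of classical arithmetic in all finite
types with quantifier-free induction, ground-type recursion and quantifier-free choice, extended by
an abstract real inner product space `X`. (Completeness of `X` is not among the axioms.) -/
inductive PAwX (Γ : Ctx) : Fm Γ → Prop
  -- equality of type `0`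
  | eq_refl (s : Tm Γ .nat) : PAwX Γ (.eq s s)
  | eq_symm (s t : Tm Γ .nat) : PAwX Γ (.eq s t ⇛ .eq t s)
  | eq_trans (r s t : Tm Γ .nat) : PAwX Γ (.eq r s ⇛ .eq s t ⇛ .eq r t)
  -- successor
  | succ_ne_zero (s : Tm Γ .nat) : PAwX Γ (Fm.neg (.eq (suc s) zero))
  | succ_inj (s t : Tm Γ .nat) : PAwX Γ (.eq (suc s) (suc t) ⇛ .eq s t)
  -- combinators
  | K_ax {ρ τ : Ty} (s : Tm Γ ρ) (t : Tm Γ τ) : PAwX Γ (eqT ρ (.con (.K ρ τ) ⬝ s ⬝ t) s)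
  | S_ax {δ ρ τ : Ty} (f : Tm Γ (δ ⇒ ρ ⇒ τ)) (g : Tm Γ (δ ⇒ ρ)) (s : Tm Γ δ) :
      PAwX Γ (eqT τ (.con (.S δ ρ τ) ⬝ f ⬝ g ⬝ s) (f ⬝ s ⬝ (g ⬝ s)))
  -- recursors
  | recN_zero (a : Tm Γ .nat) (f : Tm Γ (.nat ⇒ .nat ⇒ .nat)) :
      PAwX Γ (.eq (.con .recN ⬝ zero ⬝ a ⬝ f) a)
  | recN_succ (n a : Tm Γ .nat) (f : Tm Γ (.nat ⇒ .nat ⇒ .nat)) :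
      PAwX Γ (.eq (.con .recN ⬝ suc n ⬝ a ⬝ f) (f ⬝ (.con .recN ⬝ n ⬝ a ⬝ f) ⬝ n))
  | recX_zero (a : Tm Γ .X) (f : Tm Γ (.X ⇒ .nat ⇒ .X)) :
      PAwX Γ (eqX (.con .recX ⬝ zero ⬝ a ⬝ f) a)
  | recX_succ (n : Tm Γ .nat) (a : Tm Γ .X) (f : Tm Γ (.X ⇒ .nat ⇒ .X)) :
      PAwX Γ (eqX (.con .recX ⬝ suc n ⬝ a ⬝ f) (f ⬝ (.con .recX ⬝ n ⬝ a ⬝ f) ⬝ n))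
  -- quantifier-free induction
  | qf_ind (A : Fm (.nat :: Γ)) (hA : A.QF) :
      PAwX Γ (A.inst zero ⇛ .all .nat (A ⇛ A.subst (replSubst (suc v0))) ⇛ .all .nat A)
  -- quantifier-free choice: `∀ x ∃ y A(x, y) → ∃ Y ∀ x A(x, Y x)`
  | qf_ac {ρ τ : Ty} (A : Fm (τ :: ρ :: Γ)) (hA : A.QF) :
      PAwX Γ (.all ρ (.ex τ A) ⇛
        .ex (ρ ⇒ τ) (.all ρ (A.subst choiceSubst)))
  -- real vector space
  | addX_assoc (x y z : Tm Γ .X) : PAwX Γ (eqX (addX (addX x y) z) (addX x (addX y z)))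
  | addX_comm (x y : Tm Γ .X) : PAwX Γ (eqX (addX x y) (addX y x))
  | addX_zero (x : Tm Γ .X) : PAwX Γ (eqX (addX x zeroX) x)
  | addX_neg (x : Tm Γ .X) : PAwX Γ (eqX (addX x (negX x)) zeroX)
  | one_smul (x : Tm Γ .X) : PAwX Γ (eqX (smulX oneR x) x)
  | mul_smul (a b : Tm Γ .fn) (x : Tm Γ .X) :
      PAwX Γ (eqX (smulX (mulR a b) x) (smulX a (smulX b x)))
  | smul_add (a : Tm Γ .fn) (x y : Tm Γ .X) :
      PAwX Γ (eqX (smulX a (addX x y)) (addX (smulX a x) (smulX a y)))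
  | add_smul (a b : Tm Γ .fn) (x : Tm Γ .X) :
      PAwX Γ (eqX (smulX (addR a b) x) (addX (smulX a x) (smulX b x)))
  -- norm
  | norm_self (x : Tm Γ .X) : PAwX Γ (eqR (normX (subX x x)) zeroR)
  | norm_symm (x y : Tm Γ .X) : PAwX Γ (eqR (normX (subX x y)) (normX (subX y x)))
  | norm_triangle (x y z : Tm Γ .X) :
      PAwX Γ (leR (normX (subX x z)) (addR (normX (subX x y)) (normX (subX y z))))
  | norm_smul (a : Tm Γ .fn) (x y : Tm Γ .X) :
      PAwX Γ (eqR (normX (subX (smulX a x) (smulX a y))) (mulR (absR a) (normX (subX x y))))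
  | norm_smul_sub (a b : Tm Γ .fn) (x : Tm Γ .X) :
      PAwX Γ (eqR (normX (subX (smulX a x) (smulX b x))) (mulR (absR (subR a b)) (normX x)))
  | norm_add_sub (x y u v : Tm Γ .X) :
      PAwX Γ (leR (normX (subX (addX x y) (addX u v)))
        (addR (normX (subX x u)) (normX (subX y v))))
  | norm_neg_sub (x y : Tm Γ .X) :
      PAwX Γ (eqR (normX (subX (negX x) (negX y))) (normX (subX x y)))
  | norm_sub_norm (x y : Tm Γ .X) :
      PAwX Γ (leR (absR (subR (normX x) (normX y))) (normX (subX x y)))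
  -- scalar product
  | norm_nonneg (x : Tm Γ .X) : PAwX Γ (leR zeroR (normX x))
  | inner_self (x : Tm Γ .X) : PAwX Γ (eqR (innerX x x) (mulR (normX x) (normX x)))
  | inner_symm (x y : Tm Γ .X) : PAwX Γ (eqR (innerX x y) (innerX y x))
  | inner_add (x y z : Tm Γ .X) :
      PAwX Γ (eqR (innerX (addX x y) z) (addR (innerX x z) (innerX y z)))
  | inner_smul (a : Tm Γ .fn) (x y : Tm Γ .X) :
      PAwX Γ (eqR (innerX (smulX a x) y) (mulR a (innerX x y)))

/-- The collection schema for `Π⁰₁`-formulas `∀ z A₀(n, m, z)` (`v0 = z`, `v1 = m`, `v2 = n`), with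
parameters of arbitrary types:
`∀ n ≤ k ∃ m ∀ z A₀(n, m, z) → ∃ M ∀ n ≤ k ∃ m ≤ M ∀ z A₀(n, m, z)`. -/
inductive Pi01CP (Γ : Ctx) : Fm Γ → Prop
  | cp (A : Fm (.nat :: .nat :: .nat :: Γ)) (hA : A.QF) (k : Tm Γ .nat) :
      Pi01CP Γ (.all .nat (le v0 k.wk ⇛ .ex .nat (.all .nat A)) ⇛
        .ex .nat (.all .nat (le v0 k.wk.wk ⇛
          .ex .nat (.and (le v0 v2) (.all .nat (A.subst collSubst))))))

/-- Derivability `H ⊢ A` in classical natural deduction from the axioms `T`, together with the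
quantifier-free rule of extensionality. The premise of that rule must be a theorem, that is,
derived without open assumptions. -/
inductive Der (T : ∀ Γ : Ctx, Fm Γ → Prop) : ∀ {Γ : Ctx}, List (Fm Γ) → Fm Γ → Prop
  | ax {Γ : Ctx} {H : List (Fm Γ)} {A : Fm Γ} : T Γ A → Der T H A
  | hyp {Γ : Ctx} {H : List (Fm Γ)} {A : Fm Γ} : A ∈ H → Der T H A
  | impI {Γ : Ctx} {H : List (Fm Γ)} {A B : Fm Γ} : Der T (A :: H) B → Der T H (A ⇛ B)
  | impE {Γ : Ctx} {H : List (Fm Γ)} {A B : Fm Γ} : Der T H (A ⇛ B) → Der T H A → Der T H B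
  | raa {Γ : Ctx} {H : List (Fm Γ)} {A : Fm Γ} : Der T (A.neg :: H) .bot → Der T H A
  | allI {Γ : Ctx} {H : List (Fm Γ)} {ρ : Ty} {A : Fm (ρ :: Γ)} :
      Der T (H.map Fm.wk) A → Der T H (.all ρ A)
  | allE {Γ : Ctx} {H : List (Fm Γ)} {ρ : Ty} {A : Fm (ρ :: Γ)} (s : Tm Γ ρ) :
      Der T H (.all ρ A) → Der T H (A.inst s)
  | qf_er {Γ : Ctx} {H : List (Fm Γ)} {ρ τ : Ty} {A : Fm Γ} (hA : A.QF) {s t : Tm Γ ρ}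
      (r : Tm (ρ :: Γ) τ) :
      Der T [] (A ⇛ eqT ρ s t) → Der T H (A ⇛ eqT τ (r.inst s) (r.inst t))

/-- Provability, without assumptions, in the system with the abstract space `X` plus `Π⁰₁`-CP.
Free variables of `A` are read universally. -/
def Provable {Γ : Ctx} (A : Fm Γ) : Prop :=
  Der (fun Γ A => PAwX Γ A ∨ Pi01CP Γ A) [] A

/-! ## The principles -/

section Principles

variable {Γ : Ctx}

/-- The Kronecker delta as a real. -/
def delta (i j : Tm Γ .nat) : Tm Γ .fn :=
  constR (cond (add (monus i j) (monus j i)) oneQ zeroQ)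

/-- `∀ i, j ⟨eᵢ, eⱼ⟩ = δᵢⱼ`. -/
def OrthonormalSeq (e : Tm Γ (.nat ⇒ .X)) : Fm Γ :=
  .all .nat (.all .nat (eqR (innerX (e.wk.wk ⬝ v1) (e.wk.wk ⬝ v0)) (delta v1 v0)))

/-- `∃ b ∀ i ‖xᵢ‖ ≤ b`, with `b` a real. -/
def BoundedSeq (x : Tm Γ (.nat ⇒ .X)) : Fm Γ :=
  .ex .fn (.all .nat (leR (normX (x.wk.wk ⬝ v0)) v1))

/-- `∀ y lim ⟨y, xᵢ⟩ = ⟨y, z⟩`, that is,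
`∀ y ∀ k ∃ m ∀ i ≥ m |⟨y, xᵢ⟩ - ⟨y, z⟩| ≤ 2⁻ᵏ`. -/
def WeakLim (x : Tm Γ (.nat ⇒ .X)) (z : Tm Γ .X) : Fm Γ :=
  .all .X (.all .nat (.ex .nat (.all .nat (le v1 v0 ⇛
    leR (absR (subR (innerX v3 (x.wk.wk.wk.wk ⬝ v0)) (innerX v3 z.wk.wk.wk.wk)))
      (constR (invPow2 v2))))))

/-- `∀ i h(i) < h(i + 1)`. -/
def StrictIncr (h : Tm Γ .fn) : Fm Γ :=
  .all .nat (le (suc (h.wk ⬝ v0)) (h.wk ⬝ suc v0))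

/-- Composition `i ↦ x (h i)`. -/
def subseqC : Tm [] ((.nat ⇒ .X) ⇒ .fn ⇒ .nat ⇒ .X) := lam (lam (lam (v2 ⬝ (v1 ⬝ v0))))
def subseq (x : Tm Γ (.nat ⇒ .X)) (h : Tm Γ .fn) : Tm Γ (.nat ⇒ .X) := subseqC.cl ⬝ x ⬝ h

/-- The Bolzano-Weierstrass principle for weak convergence for the sequence `x`: if `x` is bounded,
then some subsequence `x ∘ h` converges weakly to some point (`v1` is the point, `v0` is `h`). -/
def BWweak (x : Tm Γ (.nat ⇒ .X)) : Fm Γ :=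
  BoundedSeq x ⇛ .ex .X (.ex .fn (.and (StrictIncr v0) (WeakLim (subseq x.wk.wk v0) v1)))

/-- `∃ g ∀ n (g n = 0 ↔ ∀ x ∃ y t x y n = 0)`. -/
def Pi02CA (t : Tm Γ (.nat ⇒ .nat ⇒ .nat ⇒ .nat)) : Fm Γ :=
  .ex .fn (.all .nat (.iff (.eq (v1 ⬝ v0) zero)
    (.all .nat (.ex .nat (.eq (t.wk.wk.wk.wk ⬝ v1 ⬝ v0 ⬝ v2) zero)))))

end Principles

end FinTypeArith

open FinTypeArith

/-!
By the completeness theorem it is enough to argue in an arbitrary model of the theory. The real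
numbers of a model are handled as the standard parts of an ultrapower of its field of rationals:
a coded Cauchy sequence is a germ of rationals, and two codes are equal reals if and only if their
germs differ by an infinitesimal. Calculations with codes thus become calculations in an ordered
commutative ring.

Let `count t n p` be the number of arguments `x = 0, 1, …` for which witnesses `y` with
`t x y n = 0` have been found in succession before stage `p`; it is eventually constant in `p` if
and only if `∀ x ∃ y, t x y n = 0` fails. Put `x_p = ∑_{n ≤ p} 2⁻ⁿ e_{j(n, count t n p)}` with the
pairing function `j`. If `x` is a weak cluster point of `(x_p)`, the coefficient `⟨e_{j(n, k)}, x⟩`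
is `2⁻ⁿ` if `k` is the final value of the counter for `n`, and `0` otherwise. If moreover
`⟨x, x⟩ - ⟨x, x_p⟩ < 2⁻²ⁿ`, then the counter for `n`, if it has a final value, has already reached
it at stage `p`. Quantifier-free choice yields such a `p` as a function of `n`, and `g n` tests
whether the coefficient of `e_{j(n, count t n p)}` vanishes.
-/

namespace FinTypeArith

/-! ## Substitution -/

section Substitution

/-- A simultaneous substitution of terms over `Δ` for the variables of `Γ`. -/
abbrev Sub (Γ Δ : Ctx) : Type := ∀ ρ, Var Γ ρ → Tm Δ ρ

variable {Γ Δ Θ : Ctx} {ρ τ : Ty}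

@[simp] theorem Tm.subst_var (σ : Sub Γ Δ) (v : Var Γ ρ) : (Tm.var v).subst σ = σ _ v := rfl

@[simp] theorem Tm.subst_con (σ : Sub Γ Δ) (c : Cst ρ) : (Tm.con c).subst σ = .con c := rfl

@[simp] theorem Tm.subst_app (σ : Sub Γ Δ) (f : Tm Γ (ρ ⇒ τ)) (a : Tm Γ ρ) :
    (f ⬝ a).subst σ = f.subst σ ⬝ a.subst σ := rfl

theorem Tm.subst_subst (σ : Sub Γ Δ) (θ : Sub Δ Θ) (t : Tm Γ τ) :
    (t.subst σ).subst θ = t.subst fun _ v => (σ _ v).subst θ := by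
  induction t with
  | var v => rfl
  | con c => rfl
  | app f a ihf iha => simp [ihf, iha]

theorem Tm.subst_id (t : Tm Γ τ) : t.subst (fun _ v => .var v) = t := by
  induction t with
  | var v => rfl
  | con c => rfl
  | app f a ihf iha => simp [ihf, iha]

theorem Tm.wk_subst_lift (σ : Sub Γ Δ) (ρ : Ty) (t : Tm Γ τ) :
    t.wk.subst (liftSubst ρ σ) = (t.subst σ).wk := by
  simp only [Tm.wk, Tm.subst_subst]; rfl

theorem liftSubst_comp (σ : Sub Γ Δ) (θ : Sub Δ Θ) (ρ : Ty) :
    (fun τ v => (liftSubst ρ σ τ v).subst (liftSubst ρ θ)) =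
      liftSubst ρ (fun τ v => (σ τ v).subst θ) := by
  funext τ v
  cases v with
  | vz => rfl
  | vs v => exact Tm.wk_subst_lift θ ρ _

theorem liftSubst_id (ρ : Ty) :
    liftSubst ρ (fun τ (v : Var Γ τ) => Tm.var v) = fun _ v => .var v := by
  funext τ v
  cases v <;> rfl

theorem Fm.subst_subst (σ : Sub Γ Δ) (θ : Sub Δ Θ) (A : Fm Γ) :
    (A.subst σ).subst θ = A.subst fun _ v => (σ _ v).subst θ := by
  induction A generalizing Δ Θ with
  | eq s t => simp [Fm.subst, Tm.subst_subst]
  | bot => rfl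
  | imp A B ihA ihB => simp [Fm.subst, ihA, ihB]
  | all ρ A ih => simp only [Fm.subst, ih, liftSubst_comp]

theorem Fm.subst_id (A : Fm Γ) : A.subst (fun _ v => .var v) = A := by
  induction A with
  | eq s t => simp [Fm.subst, Tm.subst_id]
  | bot => rfl
  | imp A B ihA ihB => simp [Fm.subst, ihA, ihB]
  | all ρ A ih => simp [Fm.subst, liftSubst_id, ih]

theorem Fm.wk_subst_lift (σ : Sub Γ Δ) (ρ : Ty) (A : Fm Γ) :
    A.wk.subst (liftSubst ρ σ) = (A.subst σ).wk := by
  simp only [Fm.wk, Fm.subst_subst]; rfl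

theorem Tm.wk_inst (t : Tm Γ τ) (s : Tm Γ ρ) : t.wk.inst s = t := by
  simp only [Tm.wk, Tm.inst, Tm.subst_subst]
  exact t.subst_id

theorem Fm.wk_inst (A : Fm Γ) (s : Tm Γ ρ) : A.wk.inst s = A := by
  simp only [Fm.wk, Fm.inst, Fm.subst_subst]
  exact A.subst_id

/-- The substitution `x₀ := s`, followed by `σ` on the other variables. -/
def consSubst (s : Tm Δ ρ) (σ : Sub Γ Δ) : Sub (ρ :: Γ) Δ
  | _, .vz => s
  | _, .vs v => σ _ v

theorem liftSubst_inst (σ : Sub Γ Δ) (s : Tm Δ ρ) :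
    (fun τ v => (liftSubst ρ σ τ v).subst (instSubst s)) = consSubst s σ := by
  funext τ v
  cases v with
  | vz => rfl
  | vs v => exact Tm.wk_inst _ _

theorem instSubst_comp (σ : Sub Γ Δ) (s : Tm Γ ρ) :
    (fun τ v => (instSubst s τ v).subst σ) = consSubst (s.subst σ) σ := by
  funext τ v
  cases v <;> rfl

theorem Tm.subst_lift_inst (σ : Sub Γ Δ) (s : Tm Δ ρ) (t : Tm (ρ :: Γ) τ) :
    (t.subst (liftSubst ρ σ)).inst s = t.subst (consSubst s σ) := by
  rw [Tm.inst, Tm.subst_subst, liftSubst_inst]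

theorem Fm.subst_lift_inst (σ : Sub Γ Δ) (s : Tm Δ ρ) (A : Fm (ρ :: Γ)) :
    (A.subst (liftSubst ρ σ)).inst s = A.subst (consSubst s σ) := by
  rw [Fm.inst, Fm.subst_subst, liftSubst_inst]

theorem Tm.inst_subst (σ : Sub Γ Δ) (s : Tm Γ ρ) (t : Tm (ρ :: Γ) τ) :
    (t.inst s).subst σ = (t.subst (liftSubst ρ σ)).inst (s.subst σ) := by
  rw [Tm.subst_lift_inst, Tm.inst, Tm.subst_subst, instSubst_comp]

theorem Fm.inst_subst (σ : Sub Γ Δ) (s : Tm Γ ρ) (A : Fm (ρ :: Γ)) :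
    (A.inst s).subst σ = (A.subst (liftSubst ρ σ)).inst (s.subst σ) := by
  rw [Fm.subst_lift_inst, Fm.inst, Fm.subst_subst, instSubst_comp]

theorem Fm.QF.subst (σ : Sub Γ Δ) {A : Fm Γ} (hA : A.QF) : (A.subst σ).QF := by
  induction A generalizing Δ with
  | eq s t => trivial
  | bot => trivial
  | imp A B ihA ihB => exact ⟨ihA σ hA.1, ihB σ hA.2⟩
  | all => exact hA.elim

theorem Tm.cl_subst (σ : Sub Γ Δ) (t : Tm [] τ) : t.cl.subst σ = (t.cl : Tm Δ τ) := by
  rw [Tm.cl, Tm.subst_subst, Tm.cl]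
  congr 1
  funext τ v
  cases v

theorem choiceSubst_comp (σ : Sub Γ Δ) (A : Fm (τ :: ρ :: Γ)) :
    (A.subst choiceSubst).subst (liftSubst ρ (liftSubst (ρ ⇒ τ) σ)) =
      (A.subst (liftSubst τ (liftSubst ρ σ))).subst choiceSubst := by
  simp only [Fm.subst_subst]
  congr 1
  funext δ v
  rcases v with _ | _ | v
  · rfl
  · rfl
  · simp only [choiceSubst, liftSubst, Tm.subst_var, Tm.wk, Tm.subst_subst]

theorem replSubst_suc_comp (σ : Sub Γ Δ) (A : Fm (.nat :: Γ)) :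
    (A.subst (replSubst (suc v0))).subst (liftSubst .nat σ) =
      (A.subst (liftSubst .nat σ)).subst (replSubst (suc v0)) := by
  simp only [Fm.subst_subst]
  congr 1
  funext δ v
  rcases v with _ | v
  · rfl
  · simp only [replSubst, liftSubst, Tm.subst_var, Tm.wk, Tm.subst_subst]

end Substitution

section SubstitutionOfDefinedNotions

variable {Γ Δ : Ctx} (σ : Sub Γ Δ)

theorem zero_subst : (zero : Tm Γ .nat).subst σ = zero := rfl

theorem suc_subst (s : Tm Γ .nat) : (suc s).subst σ = suc (s.subst σ) := rfl

theorem addR_subst (f g : Tm Γ .fn) : (addR f g).subst σ = addR (f.subst σ) (g.subst σ) := by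
  simp [addR, Tm.cl_subst]

theorem mulR_subst (f g : Tm Γ .fn) : (mulR f g).subst σ = mulR (f.subst σ) (g.subst σ) := by
  simp [mulR, Tm.cl_subst]

theorem negR_subst (f : Tm Γ .fn) : (negR f).subst σ = negR (f.subst σ) := by
  simp [negR, Tm.cl_subst]

theorem subR_subst (f g : Tm Γ .fn) : (subR f g).subst σ = subR (f.subst σ) (g.subst σ) := by
  simp [subR, addR_subst, negR_subst]

theorem absR_subst (f : Tm Γ .fn) : (absR f).subst σ = absR (f.subst σ) := by
  simp [absR, Tm.cl_subst]

theorem zeroR_subst : (zeroR : Tm Γ .fn).subst σ = zeroR := by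
  simp [zeroR, constR, zeroQ, mkQ, pair, int, pred, num, suc, zero, Tm.cl_subst]

theorem oneR_subst : (oneR : Tm Γ .fn).subst σ = oneR := by
  simp [oneR, constR, oneQ, mkQ, pair, int, pred, num, suc, zero, Tm.cl_subst]

theorem eqR_subst (f g : Tm Γ .fn) : (eqR f g).subst σ = eqR (f.subst σ) (g.subst σ) := by
  simp [eqR, Fm.subst, ltQ, absQ, subQ, hat, addQ, negQ, invPow2, Tm.cl_subst, Tm.wk_subst_lift,
    v0, suc, zero, liftSubst]

theorem leR_subst (f g : Tm Γ .fn) : (leR f g).subst σ = leR (f.subst σ) (g.subst σ) := by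
  simp [leR, Fm.subst, ltQ, subQ, hat, addQ, negQ, invPow2, Tm.cl_subst, Tm.wk_subst_lift,
    v0, suc, zero, liftSubst]

theorem zeroX_subst : (zeroX : Tm Γ .X).subst σ = zeroX := rfl

theorem addX_subst (x y : Tm Γ .X) : (addX x y).subst σ = addX (x.subst σ) (y.subst σ) := rfl

theorem negX_subst (x : Tm Γ .X) : (negX x).subst σ = negX (x.subst σ) := rfl

theorem subX_subst (x y : Tm Γ .X) : (subX x y).subst σ = subX (x.subst σ) (y.subst σ) := rfl

theorem smulX_subst (a : Tm Γ .fn) (x : Tm Γ .X) :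
    (smulX a x).subst σ = smulX (a.subst σ) (x.subst σ) := rfl

theorem normX_subst (x : Tm Γ .X) : (normX x).subst σ = normX (x.subst σ) := rfl

theorem innerX_subst (x y : Tm Γ .X) :
    (innerX x y).subst σ = innerX (x.subst σ) (y.subst σ) := rfl

theorem eqX_subst (x y : Tm Γ .X) : (eqX x y).subst σ = eqX (x.subst σ) (y.subst σ) := by
  simp only [eqX, eqR_subst, normX_subst, subX_subst, zeroR_subst]

theorem eqT_subst (ρ : Ty) (s t : Tm Γ ρ) :
    (eqT ρ s t).subst σ = eqT ρ (s.subst σ) (t.subst σ) := by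
  induction ρ generalizing Γ Δ with
  | nat => rfl
  | X => exact eqX_subst σ s t
  | arr ρ τ _ ih =>
    simp only [eqT, Fm.subst, ih, Tm.subst_app, Tm.wk_subst_lift]
    rfl

end SubstitutionOfDefinedNotions

theorem PAwX.subst {Γ Δ : Ctx} (σ : Sub Γ Δ) {A : Fm Γ} (h : PAwX Γ A) : PAwX Δ (A.subst σ) := by
  cases h with
  | qf_ind A hA =>
    have := PAwX.qf_ind (A.subst (liftSubst .nat σ)) (hA.subst _)
    simpa only [Fm.subst, Fm.inst_subst, replSubst_suc_comp, zero_subst] using this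
  | qf_ac A hA =>
    have := PAwX.qf_ac (A.subst (liftSubst _ (liftSubst _ σ))) (hA.subst _)
    simpa only [Fm.subst, Fm.ex, Fm.neg, choiceSubst_comp] using this
  | succ_ne_zero s => exact .succ_ne_zero (s.subst σ)
  | _ =>
    simp only [Fm.subst, eqT_subst, eqX_subst, eqR_subst, leR_subst, zeroX_subst,
      addX_subst, negX_subst, subX_subst, smulX_subst, normX_subst, innerX_subst, addR_subst,
      subR_subst, absR_subst, mulR_subst, zeroR_subst, oneR_subst, Tm.subst_app,
      Tm.subst_con, suc_subst, zero_subst]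
    with_reducible constructor

/-! ## Derivations -/

/-- An axiom scheme closed under substitution that contains the equality axioms of type `0`. -/
structure IsEqTheory (T : ∀ Γ : Ctx, Fm Γ → Prop) : Prop where
  subst {Γ Δ : Ctx} (σ : Sub Γ Δ) {A : Fm Γ} : T Γ A → T Δ (A.subst σ)
  eq_refl {Γ : Ctx} (s : Tm Γ .nat) : T Γ (.eq s s)
  eq_symm {Γ : Ctx} (s t : Tm Γ .nat) : T Γ (.eq s t ⇛ .eq t s)
  eq_trans {Γ : Ctx} (r s t : Tm Γ .nat) : T Γ (.eq r s ⇛ .eq s t ⇛ .eq r t)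

theorem PAwX.isEqTheory : IsEqTheory PAwX where
  subst := PAwX.subst
  eq_refl := PAwX.eq_refl
  eq_symm := PAwX.eq_symm
  eq_trans := PAwX.eq_trans

section Derivations

variable {T T' : ∀ Γ : Ctx, Fm Γ → Prop} {Γ Δ : Ctx} {H H' : List (Fm Γ)} {A : Fm Γ}

theorem Der.mono (hT : ∀ Γ A, T Γ A → T' Γ A) (h : Der T H A) : Der T' H A := by
  induction h with
  | ax h => exact .ax (hT _ _ h)
  | hyp h => exact .hyp h
  | impI _ ih => exact .impI ih
  | impE _ _ ih₁ ih₂ => exact .impE ih₁ ih₂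
  | raa _ ih => exact .raa ih
  | allI _ ih => exact .allI ih
  | allE s _ ih => exact .allE s ih
  | qf_er hA r _ ih => exact .qf_er hA r ih

theorem Der.weaken (h : Der T H A) (hH : H ⊆ H') : Der T H' A := by
  induction h with
  | ax h => exact .ax h
  | hyp h => exact .hyp (hH h)
  | impI _ ih => exact .impI (ih (List.cons_subset_cons _ hH))
  | impE _ _ ih₁ ih₂ => exact .impE (ih₁ hH) (ih₂ hH)
  | raa _ ih => exact .raa (ih (List.cons_subset_cons _ hH))
  | allI _ ih => exact .allI (ih (List.map_subset _ hH))
  | allE s _ ih => exact .allE s (ih hH)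
  | qf_er hA r h _ => exact .qf_er hA r h

theorem Der.subst (hT : IsEqTheory T) (h : Der T H A) (σ : Sub Γ Δ) :
    Der T (H.map (Fm.subst σ)) (A.subst σ) := by
  induction h generalizing Δ with
  | ax h => exact .ax (hT.subst σ h)
  | hyp h => exact .hyp (List.mem_map_of_mem h)
  | impI _ ih => exact .impI (ih σ)
  | impE _ _ ih₁ ih₂ => exact .impE (ih₁ σ) (ih₂ σ)
  | raa _ ih => exact .raa (ih σ)
  | @allI Γ H ρ A _ ih =>
    refine .allI ?_
    have := ih (liftSubst ρ σ)
    rw [List.map_map] at this ⊢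
    convert this using 2
    funext B
    exact (Fm.wk_subst_lift σ ρ B).symm
  | allE s _ ih =>
    rw [Fm.inst_subst]
    exact .allE _ (ih σ)
  | qf_er hA r _ ih =>
    have h := ih σ
    simp only [Fm.subst, eqT_subst, Tm.inst_subst] at h ⊢
    exact .qf_er (hA.subst σ) _ h

end Derivations

/-! ## Countability of the syntax -/

section Countability

open Set

theorem countable_of_countable_sizeOf_lt {α : Type} [SizeOf α]
    (h : ∀ n, {a : α | sizeOf a < n}.Countable) : Countable α := by
  refine countable_univ_iff.1 ((countable_iUnion h).mono fun a _ => ?_)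
  exact mem_iUnion.2 ⟨sizeOf a + 1, Nat.lt_succ_self _⟩

instance : Countable Ty := by
  refine countable_of_countable_sizeOf_lt fun n => ?_
  induction n with
  | zero => simp
  | succ n ih =>
    refine ((ih.image2 ih Ty.arr).union (toFinite {.nat, .X}).countable).mono ?_
    rintro (_ | _ | ⟨ρ, τ⟩) h
    · simp
    · simp
    · rw [mem_ofPred_eq, Ty.arr.sizeOf_spec] at h
      exact .inl (mem_image2_of_mem (show _ < n by omega) (show _ < n by omega))

/-- The position of a variable in its context, counted from the most recent one. -/
def Var.idx {Γ : Ctx} {ρ : Ty} : Var Γ ρ → ℕ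
  | .vz => 0
  | .vs v => v.idx + 1

theorem Var.idx_injective {Γ : Ctx} {ρ : Ty} : Function.Injective (Var.idx (Γ := Γ) (ρ := ρ)) := by
  intro v w h
  induction v with
  | vz => cases w with
    | vz => rfl
    | vs w => simp [Var.idx] at h
  | vs v ih => cases w with
    | vz => simp [Var.idx] at h
    | vs w => rw [ih (Nat.succ_injective h)]

instance (Γ : Ctx) (ρ : Ty) : Countable (Var Γ ρ) := Var.idx_injective.countable

instance (ρ : Ty) : Countable (Cst ρ) := by
  refine Function.Injective.countable (f := Cst.ctorIdx) fun c d h => ?_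
  cases c <;> cases d <;> first | rfl | cases h

instance (Γ : Ctx) (ρ : Ty) : Countable (Tm Γ ρ) := by
  refine countable_of_countable_sizeOf_lt fun n => ?_
  induction n generalizing ρ with
  | zero => simp
  | succ n ih =>
    refine ((countable_iUnion fun σ => (ih (σ ⇒ ρ)).image2 (ih σ) Tm.app).union
      ((countable_range Tm.var).union (countable_range Tm.con))).mono ?_
    rintro (v | c | ⟨f, a⟩) h
    · exact .inr (.inl ⟨v, rfl⟩)
    · exact .inr (.inr ⟨c, rfl⟩)
    · rw [mem_ofPred_eq, Tm.app.sizeOf_spec] at h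
      exact .inl (mem_iUnion.2
        ⟨_, mem_image2_of_mem (show _ < n by omega) (show _ < n by omega)⟩)

instance (Γ : Ctx) : Countable (Fm Γ) := by
  refine countable_of_countable_sizeOf_lt fun n => ?_
  induction n generalizing Γ with
  | zero => simp
  | succ n ih =>
    refine (((countable_range fun p : Tm Γ .nat × Tm Γ .nat => Fm.eq p.1 p.2).union
      (countable_singleton .bot)).union (((ih Γ).image2 (ih Γ) Fm.imp).union
      (countable_iUnion fun ρ => (ih (ρ :: Γ)).image (Fm.all ρ)))).mono ?_
    rintro (⟨s, t⟩ | _ | ⟨A, B⟩ | ⟨ρ, A⟩) h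
    · exact .inl (.inl ⟨(s, t), rfl⟩)
    · exact .inl (.inr rfl)
    · rw [mem_ofPred_eq, Fm.imp.sizeOf_spec] at h
      exact .inr (.inl (mem_image2_of_mem (show _ < n by omega) (show _ < n by omega)))
    · rw [mem_ofPred_eq, Fm.all.sizeOf_spec] at h
      exact .inr (.inr (mem_iUnion.2 ⟨ρ, mem_image_of_mem _ (show _ < n by omega)⟩))

end Countability

/-! ## Interpretations -/

/-- An applicative structure interpreting the constants. -/
structure Interp where
  D : Ty → Type
  app : ∀ {ρ τ : Ty}, D (ρ ⇒ τ) → D ρ → D τ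
  con : ∀ {ρ : Ty}, Cst ρ → D ρ

namespace Interp

/-- An assignment of values to the variables of a context. -/
abbrev Env (M : Interp) (Γ : Ctx) : Type := ∀ τ, Var Γ τ → M.D τ

variable {M : Interp} {Γ Δ : Ctx} {ρ τ : Ty}

/-- The empty assignment. -/
def nil : M.Env [] := nofun

/-- The assignment of `d` to the variable `0`, and of the values under `e` to the others. -/
def cons (d : M.D ρ) (e : M.Env Γ) : M.Env (ρ :: Γ)
  | _, .vz => d
  | _, .vs v => e _ v

/-- The value of a term. -/
def eval (e : M.Env Γ) : {ρ : Ty} → Tm Γ ρ → M.D ρ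
  | _, .var v => e _ v
  | _, .con c => M.con c
  | _, .app f a => M.app (eval e f) (eval e a)

/-- Satisfaction; prime formulas are interpreted by genuine equality. -/
def Sat : {Γ : Ctx} → M.Env Γ → Fm Γ → Prop
  | _, e, .eq s t => eval e s = eval e t
  | _, _, .bot => False
  | _, e, .imp A B => Sat e A → Sat e B
  | _, e, .all ρ A => ∀ d : M.D ρ, Sat (cons d e) A

theorem eval_subst (e : M.Env Δ) (σ : Sub Γ Δ) (t : Tm Γ ρ) :
    eval e (t.subst σ) = eval (fun _ v => eval e (σ _ v)) t := by
  induction t with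
  | var v => rfl
  | con c => rfl
  | app f a ihf iha => simp only [Tm.subst, eval, ihf, iha]

@[simp] theorem eval_wk (d : M.D ρ) (e : M.Env Γ) (t : Tm Γ τ) :
    eval (cons d e) t.wk = eval e t := eval_subst _ _ _

theorem eval_cl (e : M.Env Γ) (t : Tm [] τ) : eval e t.cl = eval nil t := by
  rw [Tm.cl, eval_subst]
  congr 1
  funext τ v
  cases v

theorem cons_eval_lift (d : M.D ρ) (e : M.Env Δ) (σ : Sub Γ Δ) :
    (fun τ v => eval (cons d e) (liftSubst ρ σ τ v)) = cons d fun τ v => eval e (σ τ v) := by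
  funext τ v
  cases v with
  | vz => rfl
  | vs v => exact eval_wk d e _

theorem sat_subst (e : M.Env Δ) (σ : Sub Γ Δ) (A : Fm Γ) :
    Sat e (A.subst σ) ↔ Sat (fun _ v => eval e (σ _ v)) A := by
  induction A generalizing Δ with
  | eq s t => simp only [Fm.subst, Sat, eval_subst]
  | bot => rfl
  | imp A B ihA ihB => simp only [Fm.subst, Sat, ihA, ihB]
  | all ρ A ih => simp only [Fm.subst, Sat, ih, cons_eval_lift]

@[simp] theorem sat_neg (e : M.Env Γ) (A : Fm Γ) : Sat e A.neg ↔ ¬ Sat e A := Iff.rfl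

@[simp] theorem sat_and (e : M.Env Γ) (A B : Fm Γ) : Sat e (A.and B) ↔ Sat e A ∧ Sat e B := by
  simp only [Fm.and, Fm.neg, Sat]
  tauto

@[simp] theorem sat_iff (e : M.Env Γ) (A B : Fm Γ) :
    Sat e (A.iff B) ↔ (Sat e A ↔ Sat e B) := by
  simp only [Fm.iff, sat_and, Sat]
  tauto

@[simp] theorem sat_ex (e : M.Env Γ) (A : Fm (ρ :: Γ)) :
    Sat e (.ex ρ A) ↔ ∃ d, Sat (cons d e) A := by
  simp only [Fm.ex, Fm.neg, Sat]
  exact not_forall_not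

end Interp

/-- A model of all theorems of `T` in which two terms have the same value as soon as their
extensional equality follows provably from a true quantifier-free formula. -/
structure Model (T : ∀ Γ : Ctx, Fm Γ → Prop) extends Interp where
  sound : ∀ {Γ : Ctx} {A : Fm Γ}, Der T [] A → ∀ e, Interp.Sat (M := toInterp) e A
  ext : ∀ {Γ : Ctx} {ρ : Ty} {A : Fm Γ} {s t : Tm Γ ρ}, A.QF → Der T [] (A ⇛ eqT ρ s t) →
    ∀ e, Interp.Sat (M := toInterp) e A → Interp.eval e s = Interp.eval e t

/-! ## Completeness -/

section HenkinVariables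

open Interp

/-- The type of the `n`-th Henkin variable; every type occurs infinitely often. -/
noncomputable def henkinTy (n : ℕ) : Ty :=
  haveI : Nonempty Ty := ⟨.nat⟩
  (exists_surjective_nat Ty).choose n.unpair.1

/-- The context of the first `n` Henkin variables. -/
@[reducible] noncomputable def henkinCtx : ℕ → Ctx
  | 0 => []
  | n + 1 => henkinTy n :: henkinCtx n

/-- Terms over all Henkin variables. -/
inductive HTm : Ty → Type
  | var (i : ℕ) : HTm (henkinTy i)
  | con {ρ : Ty} : Cst ρ → HTm ρ
  | app {ρ τ : Ty} : HTm (ρ ⇒ τ) → HTm ρ → HTm τ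

/-- The free interpretation over the Henkin variables. -/
abbrev HTm.interp : Interp := ⟨HTm, HTm.app, HTm.con⟩

/-- The assignments of terms over the Henkin variables. -/
abbrev HEnv (Γ : Ctx) : Type := HTm.interp.Env Γ

/-- A closed term of each type. -/
def dfltTm {Γ : Ctx} : (ρ : Ty) → Tm Γ ρ
  | .nat => zero
  | .X => zeroX
  | .arr ρ τ => .con (.K τ ρ) ⬝ dfltTm τ

/-- The `i`-th Henkin variable as a term over the first `n` ones (a closed term if `n ≤ i`). -/
noncomputable def henkinVar : (n i : ℕ) → Tm (henkinCtx n) (henkinTy i)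
  | 0, _ => dfltTm _
  | n + 1, i => if h : i = n then h ▸ v0 else (henkinVar n i).wk

theorem henkinVar_self (n : ℕ) : henkinVar (n + 1) n = v0 := by simp [henkinVar]

theorem henkinVar_succ {n i : ℕ} (h : i < n) : henkinVar (n + 1) i = (henkinVar n i).wk := by
  simp [henkinVar, h.ne]

/-- The Henkin variables of the context `henkinCtx n` as terms over all of them. -/
noncomputable def henkinEmb : (n : ℕ) → HEnv (henkinCtx n)
  | 0 => Interp.nil
  | n + 1 => Interp.cons (HTm.var n) (henkinEmb n)

/-- The truncation of a term to the first `n` Henkin variables. -/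
noncomputable def HTm.trunc (n : ℕ) : {ρ : Ty} → HTm ρ → Tm (henkinCtx n) ρ
  | _, .var i => henkinVar n i
  | _, .con c => .con c
  | _, .app f a => .app (f.trunc n) (a.trunc n)

/-- The number of initial Henkin variables in which a term is contained. -/
def HTm.bound : {ρ : Ty} → HTm ρ → ℕ
  | _, .var i => i + 1
  | _, .con _ => 0
  | _, .app f a => max f.bound a.bound

/-- The truncation of an assignment to the first `n` Henkin variables, as a substitution. -/
noncomputable def HEnv.trunc {Γ : Ctx} (e : HEnv Γ) (n : ℕ) : Sub Γ (henkinCtx n) :=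
  fun τ v => (e τ v).trunc n

theorem HTm.trunc_succ {n : ℕ} {ρ : Ty} (s : HTm ρ) (h : s.bound ≤ n) :
    s.trunc (n + 1) = (s.trunc n).wk := by
  induction s with
  | var i => exact henkinVar_succ h
  | con c => rfl
  | app f a ihf iha =>
    simp only [bound, max_le_iff] at h
    simp only [trunc, ihf h.1, iha h.2]
    rfl

theorem henkinVar_subst_henkinEmb {i k : ℕ} (h : i < k) (n : ℕ) :
    (henkinVar k i).subst (HEnv.trunc (henkinEmb k) n) = henkinVar n i := by
  induction k with
  | zero => omega
  | succ k ih =>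
    rcases Nat.lt_succ_iff_lt_or_eq.1 h with hi | rfl
    · rw [henkinVar_succ hi, Tm.wk, Tm.subst_subst]
      exact ih hi
    · rw [henkinVar_self]
      rfl

theorem HTm.trunc_subst_henkinEmb {k : ℕ} (n : ℕ) {ρ : Ty} (s : HTm ρ) (h : s.bound ≤ k) :
    (s.trunc k).subst (HEnv.trunc (henkinEmb k) n) = s.trunc n := by
  induction s with
  | var i => exact henkinVar_subst_henkinEmb h n
  | con c => rfl
  | app f a ihf iha =>
    simp only [bound, max_le_iff] at h
    simp only [trunc, Tm.subst_app, ihf h.1, iha h.2]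

theorem HTm.trunc_eval {Γ : Ctx} (e : HEnv Γ) (n : ℕ) {ρ : Ty} (t : Tm Γ ρ) :
    (eval e t : HTm ρ).trunc n = t.subst (HEnv.trunc e n) := by
  induction t with
  | var v => rfl
  | con c => rfl
  | app f a ihf iha => simp only [eval, HTm.trunc, Tm.subst, ihf, iha]

theorem HEnv.exists_bound {Γ : Ctx} (e : HEnv Γ) : ∃ n, ∀ τ v, (e τ v).bound ≤ n := by
  induction Γ with
  | nil => exact ⟨0, fun τ v => nomatch v⟩
  | cons ρ Γ ih =>
    obtain ⟨n, hn⟩ := ih fun τ v => e τ (.vs v)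
    refine ⟨max n (e ρ .vz).bound, fun τ v => ?_⟩
    cases v with
    | vz => exact le_max_right _ _
    | vs v => exact (hn τ v).trans (le_max_left _ _)

theorem HEnv.trunc_cons {Γ : Ctx} {ρ : Ty} (d : HTm ρ) (e : HEnv Γ) (n : ℕ) :
    HEnv.trunc (cons d e) n = consSubst (d.trunc n) (HEnv.trunc e n) := by
  funext τ v
  cases v <;> rfl

theorem HEnv.trunc_succ {Γ : Ctx} {e : HEnv Γ} {n : ℕ} (h : ∀ τ v, (e τ v).bound ≤ n) :
    HEnv.trunc e (n + 1) = fun τ v => (HEnv.trunc e n τ v).wk :=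
  funext fun τ => funext fun v => (e τ v).trunc_succ (h τ v)

theorem Fm.subst_trunc_succ {Γ : Ctx} {e : HEnv Γ} {n : ℕ} (h : ∀ τ v, (e τ v).bound ≤ n)
    (B : Fm Γ) : B.subst (HEnv.trunc e (n + 1)) = (B.subst (HEnv.trunc e n)).wk := by
  rw [HEnv.trunc_succ h, Fm.wk, Fm.subst_subst]
  rfl

theorem HEnv.trunc_subst_henkinEmb {Γ : Ctx} {e : HEnv Γ} {k : ℕ}
    (h : ∀ τ v, (e τ v).bound ≤ k) (n : ℕ) :
    (fun τ v => (HEnv.trunc e k τ v).subst (HEnv.trunc (henkinEmb k) n)) = HEnv.trunc e n :=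
  funext fun τ => funext fun v => (e τ v).trunc_subst_henkinEmb n (h τ v)

instance (ρ : Ty) : Nonempty (Σ k, Fm (ρ :: henkinCtx k)) := ⟨⟨0, .bot⟩⟩

/-- An enumeration of the formulas with a distinguished variable of type `ρ` over Henkin
variables. -/
noncomputable def henkinEnum (ρ : Ty) : ℕ → Σ k, Fm (ρ :: henkinCtx k) :=
  (exists_surjective_nat _).choose

/-- The formula treated at stage `n` of the Henkin construction; its distinguished variable has the
type of the `n`-th Henkin variable. -/
noncomputable def henkinItem (n : ℕ) : Fm (henkinTy n :: henkinCtx n) :=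
  let p := henkinEnum (henkinTy n) n.unpair.2.unpair.1
  p.2.subst (liftSubst _ (HEnv.trunc (henkinEmb p.1) n))

theorem exists_henkinItem_eq {Γ : Ctx} {ρ : Ty} (e : HEnv Γ) (B : Fm (ρ :: Γ)) :
    ∃ n, (∀ τ v, (e τ v).bound ≤ n) ∧
      (⟨henkinTy n, henkinItem n⟩ : Σ τ, Fm (τ :: henkinCtx n)) =
        ⟨ρ, B.subst (liftSubst ρ (HEnv.trunc e n))⟩ := by
  obtain ⟨k, hk⟩ := e.exists_bound
  have : Nonempty Ty := ⟨.nat⟩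
  obtain ⟨a, ha⟩ := (exists_surjective_nat Ty).choose_spec ρ
  obtain ⟨b, hb⟩ := (exists_surjective_nat (Σ k, Fm (ρ :: henkinCtx k))).choose_spec
    ⟨k, B.subst (liftSubst ρ (HEnv.trunc e k))⟩
  change henkinEnum ρ b = _ at hb
  let n := Nat.pair a (Nat.pair b k)
  have hkn : k ≤ n := (Nat.right_le_pair b k).trans (Nat.right_le_pair a _)
  have hρ : henkinTy n = ρ := by simp [n, henkinTy, ha]
  have hn : n.unpair.2.unpair.1 = b := by simp [n]
  refine ⟨n, fun τ v => (hk τ v).trans hkn, ?_⟩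
  rw [henkinItem, hn]
  generalize henkinTy n = δ at hρ ⊢
  subst hρ
  rw [hb, Fm.subst_subst, liftSubst_comp, HEnv.trunc_subst_henkinEmb hk]

end HenkinVariables

section HenkinConstruction

open Interp

variable {T : ∀ Γ : Ctx, Fm Γ → Prop} {A : Fm []} {Γ : Ctx} {ρ τ : Ty}

open Classical in
/-- The assumptions of the Henkin construction for the consistency of `¬ A`: at stage `n`, either
the generalization of the treated formula is added, or the new variable becomes a
counterexample. -/
noncomputable def henkinHyp (T : ∀ Γ : Ctx, Fm Γ → Prop) (A : Fm []) :
    (n : ℕ) → List (Fm (henkinCtx n))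
  | 0 => [A.neg]
  | n + 1 =>
    (if Der T (.all _ (henkinItem n) :: henkinHyp T A n) .bot then (henkinItem n).neg
      else (Fm.all _ (henkinItem n)).wk) :: (henkinHyp T A n).map Fm.wk

theorem IsEqTheory.of_wk_bot (hT : IsEqTheory T) {H : List (Fm Γ)}
    (h : Der T (H.map (Fm.wk (ρ := ρ))) .bot) : Der T H .bot := by
  have := h.subst hT (instSubst (dfltTm ρ))
  have hid : Fm.subst (instSubst (dfltTm ρ)) ∘ Fm.wk = @id (Fm Γ) :=
    funext fun B => Fm.wk_inst B _
  rwa [List.map_map, hid, List.map_id] at this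

theorem henkinHyp_consistent (hT : IsEqTheory T) (hA : ¬ Der T [] A) (n : ℕ) :
    ¬ Der T (henkinHyp T A n) .bot := by
  induction n with
  | zero => exact fun h => hA (.raa h)
  | succ n ih =>
    intro h
    rw [henkinHyp] at h
    split_ifs at h with hc
    · exact ih (.impE (.impI hc) (.allI (.raa h)))
    · exact hc (hT.of_wk_bot (ρ := henkinTy n) h)

/-- Derivability in the limit of the Henkin construction. -/
def Forces (T : ∀ Γ : Ctx, Fm Γ → Prop) (A : Fm []) (e : HEnv Γ) (B : Fm Γ) : Prop :=
  ∀ᶠ n in Filter.atTop, Der T (henkinHyp T A n) (B.subst (HEnv.trunc e n))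

theorem Forces.of_stage (hT : IsEqTheory T) {e : HEnv Γ} {B : Fm Γ} {n : ℕ}
    (hn : ∀ τ v, (e τ v).bound ≤ n) (h : Der T (henkinHyp T A n) (B.subst (HEnv.trunc e n))) :
    Forces T A e B := by
  refine Filter.eventually_atTop.2 ⟨n, fun m hm => ?_⟩
  induction m, hm using Nat.le_induction with
  | base => exact h
  | succ m hm ih =>
    rw [Fm.subst_trunc_succ fun τ v => (hn τ v).trans hm]
    exact (ih.subst hT _).weaken (List.subset_cons_self _ _)

theorem Forces.of_der (hT : IsEqTheory T) {B : Fm Γ} (h : Der T [] B) (e : HEnv Γ) :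
    Forces T A e B :=
  Filter.Eventually.of_forall fun n => (h.subst hT (HEnv.trunc e n)).weaken (List.nil_subset _)

theorem Forces.mp {e : HEnv Γ} {B C : Fm Γ} (h : Forces T A e (B ⇛ C)) (h' : Forces T A e B) :
    Forces T A e C := by
  filter_upwards [h, h'] with n h h'
  exact .impE h h'

theorem not_forces_bot (hT : IsEqTheory T) (hA : ¬ Der T [] A) (e : HEnv Γ) :
    ¬ Forces T A e .bot := fun h =>
  let ⟨n, hn⟩ := h.exists
  henkinHyp_consistent hT hA n hn

theorem forces_neg_nil (hT : IsEqTheory T) : Forces T A Interp.nil A.neg := by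
  refine Forces.of_stage hT (n := 0) (fun _ v => nomatch v) (.hyp (List.mem_singleton.2 ?_))
  conv_rhs => rw [← Fm.subst_id A.neg]
  congr 1
  funext τ v
  cases v

theorem forces_all_or_exists_forces_neg (hT : IsEqTheory T) (e : HEnv Γ) (B : Fm (ρ :: Γ)) :
    Forces T A e (.all ρ B) ∨ ∃ d : HTm ρ, Forces T A (cons d e) B.neg := by
  obtain ⟨n, hn, h⟩ := exists_henkinItem_eq e B
  obtain ⟨rfl, h⟩ := Sigma.mk.inj_iff.1 h
  have hB : henkinItem n = B.subst (liftSubst _ (HEnv.trunc e n)) := eq_of_heq h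
  have hn' : ∀ τ v, (e τ v).bound ≤ n + 1 := fun τ v => (hn τ v).trans n.le_succ
  by_cases hc : Der T (.all _ (henkinItem n) :: henkinHyp T A n) .bot
  · refine .inr ⟨.var n, Forces.of_stage hT (n := n + 1) ?_ (.hyp ?_)⟩
    · rintro τ (_ | v)
      exacts [le_rfl, hn' _ v]
    · have he : HEnv.trunc (cons (HTm.var n) e) (n + 1) = liftSubst _ (HEnv.trunc e n) := by
        rw [HEnv.trunc_cons, HEnv.trunc_succ hn, HTm.trunc, henkinVar_self]
        funext τ v
        cases v <;> rfl
      rw [henkinHyp, if_pos hc, hB, he]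
      exact List.mem_cons_self
  · refine .inl (Forces.of_stage hT hn' (.hyp ?_))
    rw [henkinHyp, if_neg hc, hB, Fm.subst_trunc_succ hn]
    exact List.mem_cons_self

theorem forces_or_forces_neg (hT : IsEqTheory T) (e : HEnv Γ) (B : Fm Γ) :
    Forces T A e B ∨ Forces T A e B.neg := by
  rcases forces_all_or_exists_forces_neg (A := A) (ρ := .nat) hT e B.wk with h | ⟨d, h⟩
  · left
    filter_upwards [h] with n hn
    have := Der.allE zero hn
    rwa [Fm.wk_subst_lift, Fm.wk_inst] at this
  · right
    filter_upwards [h] with n hn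
    rw [HEnv.trunc_cons] at hn
    simp only [Fm.neg, Fm.subst, Fm.wk, Fm.subst_subst] at hn ⊢
    exact hn

theorem forces_imp_iff (hT : IsEqTheory T) (e : HEnv Γ) (B C : Fm Γ) :
    Forces T A e (B ⇛ C) ↔ (Forces T A e B → Forces T A e C) := by
  refine ⟨Forces.mp, fun h => ?_⟩
  rcases forces_or_forces_neg (A := A) hT e B with hB | hB
  · filter_upwards [h hB] with n hn
    exact .impI (hn.weaken (List.subset_cons_self _ _))
  · filter_upwards [hB] with n hn
    exact .impI (.raa (.impE (hn.weaken (by simp)) (.hyp (by simp))))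

theorem forces_all_iff (hT : IsEqTheory T) (hA : ¬ Der T [] A) (e : HEnv Γ) (B : Fm (ρ :: Γ)) :
    Forces T A e (.all ρ B) ↔ ∀ d : HTm ρ, Forces T A (cons d e) B := by
  refine ⟨fun h d => ?_, fun h => ?_⟩
  · filter_upwards [h] with n hn
    have := Der.allE (d.trunc n) hn
    rwa [Fm.subst_lift_inst, ← HEnv.trunc_cons] at this
  · refine (forces_all_or_exists_forces_neg hT e B).resolve_right ?_
    rintro ⟨d, hd⟩
    exact not_forces_bot hT hA (cons d e) (hd.mp (h d))

end HenkinConstruction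

section TermModel

open Interp

variable {T : ∀ Γ : Ctx, Fm Γ → Prop} {A : Fm []} {Γ : Ctx} {ρ τ : Ty}

/-- Equality of numerical terms in the limit of the Henkin construction. -/
def ForcesEq (T : ∀ Γ : Ctx, Fm Γ → Prop) (A : Fm []) (s t : HTm .nat) : Prop :=
  ∀ᶠ n in Filter.atTop, Der T (henkinHyp T A n) (.eq (s.trunc n) (t.trunc n))

theorem ForcesEq.trans (hT : IsEqTheory T) {r s t : HTm .nat} (h : ForcesEq T A r s)
    (h' : ForcesEq T A s t) : ForcesEq T A r t := by
  filter_upwards [h, h'] with n h h'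
  exact .impE (.impE (.ax (hT.eq_trans _ _ _)) h) h'

/-- Indiscernibility in numerical contexts. -/
def Indisc (T : ∀ Γ : Ctx, Fm Γ → Prop) (A : Fm []) (s t : HTm ρ) : Prop :=
  ∀ (Δ : Ctx) (r : Tm (ρ :: Δ) .nat) (e : HEnv Δ),
    ForcesEq T A (eval (cons s e) r) (eval (cons t e) r)

/-- Indiscernibility as an equivalence relation on the terms of a type. -/
def indiscSetoid (hT : IsEqTheory T) (A : Fm []) (ρ : Ty) : Setoid (HTm ρ) where
  r := Indisc T A
  iseqv :=
    { refl := fun _ _ _ _ => Filter.Eventually.of_forall fun _ => .ax (hT.eq_refl _)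
      symm := fun h Δ r e => (h Δ r e).mono fun _ h => .impE (.ax (hT.eq_symm _ _)) h
      trans := fun h h' Δ r e => (h Δ r e).trans hT (h' Δ r e) }

/-- Replacing first `f` and then `a` in `f a`, each inside a context in which the other one is a
parameter. -/
theorem Indisc.app (hT : IsEqTheory T) {f f' : HTm (ρ ⇒ τ)} {a a' : HTm ρ}
    (hf : Indisc T A f f') (ha : Indisc T A a a') : Indisc T A (f.app a) (f'.app a') := by
  intro Δ r e
  have h₁ := hf (ρ :: Δ) (r.subst (consSubst (v0 ⬝ v1) fun _ v => .var (.vs (.vs v)))) (cons a e)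
  have h₂ := ha ((ρ ⇒ τ) :: Δ) (r.subst (consSubst (v1 ⬝ v0) fun _ v => .var (.vs (.vs v))))
    (cons f' e)
  have key₁ (g : HTm (ρ ⇒ τ)) (b : HTm ρ) : (fun δ v => eval (cons g (cons b e))
      (consSubst (v0 ⬝ v1) (fun _ v => .var (.vs (.vs v))) δ v)) = cons (g.app b) e := by
    funext δ v
    cases v <;> rfl
  have key₂ (g : HTm (ρ ⇒ τ)) (b : HTm ρ) : (fun δ v => eval (cons b (cons g e))
      (consSubst (v1 ⬝ v0) (fun _ v => .var (.vs (.vs v))) δ v)) = cons (g.app b) e := by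
    funext δ v
    cases v <;> rfl
  simp only [eval_subst, key₁] at h₁
  simp only [eval_subst, key₂] at h₂
  exact h₁.trans hT h₂

/-- The interpretation by classes of indiscernible terms. -/
def termInterp (hT : IsEqTheory T) (A : Fm []) : Interp where
  D ρ := Quotient (indiscSetoid hT A ρ)
  app f a := Quotient.map₂ HTm.app (fun _ _ hf _ _ ha => Indisc.app hT hf ha) f a
  con c := Quotient.mk _ (.con c)

/-- The environment of classes. -/
def HEnv.cls (hT : IsEqTheory T) (A : Fm []) (e : HEnv Γ) : (termInterp hT A).Env Γ :=
  fun τ v => Quotient.mk _ (e τ v)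

theorem HEnv.cls_surjective (hT : IsEqTheory T) :
    Function.Surjective (HEnv.cls (Γ := Γ) hT A) := by
  intro e
  choose f hf using fun τ v => Quotient.exists_rep (e τ v)
  exact ⟨f, funext fun τ => funext fun v => hf τ v⟩

theorem HEnv.cls_cons (hT : IsEqTheory T) (d : HTm ρ) (e : HEnv Γ) :
    HEnv.cls hT A (cons d e) =
      cons (M := termInterp hT A) (Quotient.mk _ d) (HEnv.cls hT A e) := by
  funext τ v
  cases v <;> rfl

theorem eval_cls (hT : IsEqTheory T) (e : HEnv Γ) (t : Tm Γ ρ) :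
    eval (HEnv.cls hT A e) t = Quotient.mk (indiscSetoid hT A ρ) (eval e t) := by
  induction t with
  | var v => rfl
  | con c => rfl
  | app f a ihf iha => rw [eval, ihf, iha]; rfl

theorem indisc_eval_of_forces (hT : IsEqTheory T) {B : Fm Γ} {s t : Tm Γ ρ} (hB : B.QF)
    (h : Der T [] (B ⇛ eqT ρ s t)) (e : HEnv Γ) (he : Forces T A e B) :
    Indisc T A (eval e s : HTm ρ) (eval e t) := by
  intro Δ r e'
  filter_upwards [he] with n hn
  have hst := h.subst hT (HEnv.trunc e n)
  simp only [Fm.subst, eqT_subst] at hst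
  have hr := Der.impE (Der.qf_er (H := henkinHyp T A n) (hB.subst _)
    (r.subst (liftSubst ρ (HEnv.trunc e' n))) hst) hn
  simpa only [HTm.trunc_eval, HEnv.trunc_cons, Tm.subst_lift_inst, eqT] using hr

theorem mk_eq_mk_iff_forcesEq (hT : IsEqTheory T) (s t : HTm .nat) :
    Quotient.mk (indiscSetoid hT A .nat) s = Quotient.mk (indiscSetoid hT A .nat) t ↔
      ForcesEq T A s t := by
  refine ⟨fun h => (Quotient.exact h : Indisc T A s t) [] v0 Interp.nil,
    fun h => Quotient.sound ?_⟩
  let e : HEnv [.nat, .nat] := cons s (cons (M := HTm.interp) t Interp.nil)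
  exact indisc_eval_of_forces hT (B := .eq v0 v1) (s := v0) (t := v1) (by simp [Fm.QF])
    (.impI (.hyp (by simp [eqT]))) e h

theorem sat_cls_iff_forces (hT : IsEqTheory T) (hA : ¬ Der T [] A) (e : HEnv Γ) (B : Fm Γ) :
    Sat (HEnv.cls hT A e) B ↔ Forces T A e B := by
  induction B with
  | eq s t =>
    rw [Sat, eval_cls, eval_cls]
    refine (mk_eq_mk_iff_forcesEq hT _ _).trans ?_
    simp only [ForcesEq, HTm.trunc_eval]
    rfl
  | bot => exact ⟨False.elim, not_forces_bot hT hA e⟩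
  | imp B C ihB ihC => rw [Sat, ihB, ihC, forces_imp_iff hT]
  | all ρ B ih =>
    rw [Sat, forces_all_iff hT hA]
    refine Quotient.forall.trans (forall_congr' fun d => ?_)
    rw [← HEnv.cls_cons]
    exact ih _

/-- The term model of a Henkin construction refuting the unprovable sentence `A`. -/
def termModel (hT : IsEqTheory T) (hA : ¬ Der T [] A) : Model T where
  toInterp := termInterp hT A
  sound h e := by
    obtain ⟨e, rfl⟩ := HEnv.cls_surjective hT e
    exact (sat_cls_iff_forces hT hA e _).2 (Forces.of_der hT h e)
  ext hB h e he := by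
    obtain ⟨e, rfl⟩ := HEnv.cls_surjective hT e
    rw [eval_cls, eval_cls]
    exact Quotient.sound
      (indisc_eval_of_forces hT hB h e ((sat_cls_iff_forces hT hA e _).1 he))

theorem der_sentence_of_forall_model (hT : IsEqTheory T)
    (h : ∀ (M : Model T) (e : M.Env []), Sat e A) : Der T [] A := by
  by_contra hA
  have hsat := (sat_cls_iff_forces hT hA Interp.nil A).1
    (h (termModel hT hA) (HEnv.cls hT A Interp.nil))
  exact not_forces_bot hT hA _ ((forces_neg_nil hT).mp hsat)

theorem der_of_forall_model (hT : IsEqTheory T) {B : Fm Γ}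
    (h : ∀ (M : Model T) (e : M.Env Γ), Sat e B) : Der T [] B := by
  induction Γ with
  | nil => exact der_sentence_of_forall_model hT h
  | cons ρ Γ ih =>
    have hall : Der T [] (Fm.all ρ B) := ih fun M e d => h M (cons d e)
    have hB := Der.allE (H := []) v0 (hall.subst hT (fun _ v => .var (.vs v)))
    rw [Fm.subst_lift_inst] at hB
    convert hB using 1
    conv_lhs => rw [← Fm.subst_id B]
    congr 1
    funext τ v
    cases v <;> rfl

end TermModel

/-! ## Arithmetic in a model -/

notation:80 f:80 " ⋆ " a:81 => Interp.app _ f a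

namespace Model

open Interp

variable {M : Model PAwX}

theorem eq_of_ax {Γ : Ctx} {ρ : Ty} {s t : Tm Γ ρ} (h : PAwX Γ (eqT ρ s t)) (e : M.Env Γ) :
    eval e s = eval e t :=
  M.ext (A := .bot ⇛ .bot) (by simp [Fm.QF]) (.impI (.ax h)) e id

@[simp] theorem K_app {ρ τ : Ty} (a : M.D ρ) (b : M.D τ) : M.con (.K ρ τ) ⋆ a ⋆ b = a :=
  eq_of_ax (PAwX.K_ax v0 v1) (cons a (cons b nil))

@[simp] theorem S_app {δ ρ τ : Ty} (f : M.D (δ ⇒ ρ ⇒ τ)) (g : M.D (δ ⇒ ρ)) (a : M.D δ) :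
    M.con (.S δ ρ τ) ⋆ f ⋆ g ⋆ a = f ⋆ a ⋆ (g ⋆ a) :=
  eq_of_ax (PAwX.S_ax v0 v1 v2) (cons f (cons g (cons a nil)))

@[simp] theorem eval_app {Γ : Ctx} {ρ τ : Ty} (e : M.Env Γ) (f : Tm Γ (ρ ⇒ τ)) (a : Tm Γ ρ) :
    eval e (f ⬝ a) = eval e f ⋆ eval e a := rfl

@[simp] theorem eval_con {Γ : Ctx} {ρ : Ty} (e : M.Env Γ) (c : Cst ρ) :
    eval e (.con c) = M.con c := rfl

@[simp] theorem eval_lam {Γ : Ctx} {ρ τ : Ty} (e : M.Env Γ) (t : Tm (ρ :: Γ) τ) (d : M.D ρ) :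
    eval e (lam t) ⋆ d = eval (cons d e) t := by
  induction t with
  | var v => cases v <;> simp [lam, Interp.eval, cons]
  | con c => simp [lam]
  | app f a ihf iha => simp only [lam, eval_app, eval_con, S_app, ihf, iha]

section
variable {Γ : Ctx} {ρ₀ ρ₁ ρ₂ ρ₃ : Ty} (e : M.Env Γ) (a : M.D ρ₀) (b : M.D ρ₁) (c : M.D ρ₂)
  (d : M.D ρ₃)
@[simp] theorem eval_v0 : eval (cons a e) v0 = a := rfl
@[simp] theorem eval_v1 : eval (cons a (cons b e)) v1 = b := rfl
@[simp] theorem eval_v2 : eval (cons a (cons b (cons c e))) v2 = c := rfl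
@[simp] theorem eval_v3 : eval (cons a (cons b (cons c (cons d e)))) v3 = d := rfl
end

variable (M) in
/-- The numbers of the model. -/
abbrev N : Type := M.D .nat

instance : Zero M.N := ⟨M.con .zero⟩

/-- The successor. -/
def succ (n : M.N) : M.N := M.con .succ ⋆ n

@[simp] theorem eval_zero {Γ : Ctx} (e : M.Env Γ) : eval e zero = 0 := rfl
@[simp] theorem eval_suc {Γ : Ctx} (e : M.Env Γ) (s : Tm Γ .nat) :
    eval e (suc s) = succ (eval e s) := rfl

protected theorem succ_ne_zero (n : M.N) : succ n ≠ 0 :=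
  M.sound (.ax (PAwX.succ_ne_zero v0)) (cons n nil)

theorem succ_inj {m n : M.N} (h : succ m = succ n) : m = n :=
  M.sound (.ax (PAwX.succ_inj v0 v1)) (cons m (cons n nil)) h

theorem induction {Γ : Ctx} {P : M.N → Prop} (e : M.Env Γ) (A : Fm (.nat :: Γ)) (h0 : P 0)
    (hs : ∀ n, P n → P (succ n)) (n : M.N) (hA : A.QF := by simp [Fm.QF, Fm.neg])
    (hP : ∀ n, Sat (cons n e) A ↔ P n := by intro n; simp [Sat]) : P n := by
  have h := M.sound (.ax (PAwX.qf_ind A hA)) e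
  have e0 : (fun τ v => eval e (instSubst zero τ v)) = cons (0 : M.N) e := by
    funext τ v
    cases v <;> rfl
  have es : ∀ n : M.N, (fun τ v => eval (cons n e) (replSubst (suc v0) τ v)) = cons (succ n) e := by
    intro n
    funext τ v
    cases v <;> rfl
  simp only [Sat, Fm.inst, sat_subst, e0, es, hP] at h
  exact h h0 hs n

/-- Iteration of `f`, given by the recursor with numerical values. -/
def recNat (n a : M.N) (f : M.D (.nat ⇒ .nat ⇒ .nat)) : M.N := M.con .recN ⋆ n ⋆ a ⋆ f

@[simp] theorem recNat_zero (a : M.N) (f : M.D (.nat ⇒ .nat ⇒ .nat)) : recNat 0 a f = a :=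
  M.sound (.ax (PAwX.recN_zero v0 v1)) (cons a (cons f nil))

@[simp] theorem recNat_succ (n a : M.N) (f : M.D (.nat ⇒ .nat ⇒ .nat)) :
    recNat (succ n) a f = f ⋆ recNat n a f ⋆ n :=
  M.sound (.ax (PAwX.recN_succ v0 v1 v2)) (cons n (cons a (cons f nil)))

theorem recNat_congr {f g : M.D (.nat ⇒ .nat ⇒ .nat)} (h : ∀ x y, f ⋆ x ⋆ y = g ⋆ x ⋆ y)
    (n a : M.N) : recNat n a f = recNat n a g := by
  refine M.induction (P := fun n => recNat n a f = recNat n a g) (cons a (cons f (cons g nil)))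
    (.eq (.con .recN ⬝ v0 ⬝ v1 ⬝ v2) (.con .recN ⬝ v0 ⬝ v1 ⬝ v3)) (by simp) (fun n ih => ?_) n
    (hP := fun _ => Iff.rfl)
  rw [recNat_succ, recNat_succ, ih, h]

@[simp] theorem eval_prim {Γ : Ctx} (e : M.Env Γ) (n a : Tm Γ .nat)
    (s : Tm (.nat :: .nat :: Γ) .nat) :
    eval e (prim n a s) = recNat (eval e n) (eval e a) (eval e (lam (lam s))) := rfl

instance : Add M.N := ⟨fun a b => eval nil addC ⋆ a ⋆ b⟩
instance : Mul M.N := ⟨fun a b => eval nil mulC ⋆ a ⋆ b⟩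
instance : One M.N := ⟨succ 0⟩

/-- The predecessor, with `pred 0 = 0`. -/
def pred (a : M.N) : M.N := eval nil predC ⋆ a

/-- Truncated subtraction. -/
def monus (a b : M.N) : M.N := eval nil monusC ⋆ a ⋆ b

section
variable {Γ : Ctx} (e : M.Env Γ) (s t : Tm Γ .nat)
@[simp] theorem eval_add : eval e (add s t) = eval e s + eval e t := by
  simp only [add, eval_app, eval_cl]; rfl
@[simp] theorem eval_mul : eval e (mul s t) = eval e s * eval e t := by
  simp only [mul, eval_app, eval_cl]; rfl
@[simp] theorem eval_pred : eval e (FinTypeArith.pred s) = pred (eval e s) := by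
  simp only [FinTypeArith.pred, eval_app, eval_cl]; rfl
@[simp] theorem eval_monus : eval e (FinTypeArith.monus s t) = monus (eval e s) (eval e t) := by
  simp only [FinTypeArith.monus, eval_app, eval_cl]; rfl
@[simp] theorem eval_one : eval e (num 1) = 1 := rfl
end

theorem add_def (a b : M.N) :
    a + b = recNat b a (eval (cons b (cons a nil)) (lam (lam (suc v1)))) := by
  change eval nil addC ⋆ a ⋆ b = _
  simp [addC]

protected theorem add_zero (a : M.N) : a + 0 = a := by simp [add_def]

theorem add_succ (a b : M.N) : a + succ b = succ (a + b) := by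
  simp only [add_def, recNat_succ, eval_lam, eval_suc, eval_v1]
  exact congrArg succ (recNat_congr (by simp) _ _)

theorem mul_def (a b : M.N) :
    a * b = recNat b 0 (eval (cons b (cons a nil)) (lam (lam (add v1 v3)))) := by
  change eval nil mulC ⋆ a ⋆ b = _
  simp [mulC]

protected theorem mul_zero (a : M.N) : a * 0 = 0 := by simp [mul_def]

theorem mul_succ (a b : M.N) : a * succ b = a * b + a := by
  simp only [mul_def, recNat_succ, eval_lam, eval_add, eval_v1, eval_v3]
  exact congrArg (· + a) (recNat_congr (by simp) _ _)

@[simp] theorem pred_zero : pred (0 : M.N) = 0 := by simp [pred, predC]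
@[simp] theorem pred_succ (a : M.N) : pred (succ a) = a := by simp [pred, predC]

theorem monus_def (a b : M.N) :
    monus a b = recNat b a (eval (cons b (cons a nil)) (lam (lam (FinTypeArith.pred v1)))) := by
  simp [monus, monusC]

@[simp] theorem monus_zero (a : M.N) : monus a 0 = a := by simp [monus_def]

theorem monus_succ (a b : M.N) : monus a (succ b) = pred (monus a b) := by
  simp only [monus_def, recNat_succ, eval_lam, eval_pred, eval_v1]
  exact congrArg pred (recNat_congr (by simp) _ _)

theorem succ_pred {n : M.N} (hn : n ≠ 0) : succ (pred n) = n :=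
  (M.induction (P := fun n => n ≠ 0 → succ (pred n) = n) nil
    (Fm.neg (.eq v0 zero) ⇛ .eq (suc (FinTypeArith.pred v0)) v0) (fun h => (h rfl).elim)
    (fun n _ _ => by simp) n) hn

protected theorem zero_add (n : M.N) : 0 + n = n :=
  M.induction (P := fun n => 0 + n = n) nil (.eq (add zero v0) v0) (Model.add_zero 0)
    (fun n ih => by rw [add_succ, ih]) n

theorem succ_add (a b : M.N) : succ a + b = succ (a + b) :=
  M.induction (P := fun b => succ a + b = succ (a + b)) (cons a nil)
    (.eq (add (suc v1) v0) (suc (add v1 v0))) (by simp [Model.add_zero])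
    (fun n ih => by rw [add_succ, add_succ, ih]) b

protected theorem add_comm (a b : M.N) : a + b = b + a :=
  M.induction (P := fun b => a + b = b + a) (cons a nil) (.eq (add v1 v0) (add v0 v1))
    (by rw [Model.add_zero, Model.zero_add])
    (fun n ih => by rw [add_succ, succ_add, ih]) b

protected theorem add_assoc (a b c : M.N) : a + b + c = a + (b + c) :=
  M.induction (P := fun c => a + b + c = a + (b + c)) (cons a (cons b nil))
    (.eq (add (add v1 v2) v0) (add v1 (add v2 v0))) (by simp only [Model.add_zero])
    (fun n ih => by rw [add_succ, add_succ, add_succ, ih]) c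

instance : AddCommMonoid M.N where
  add_assoc := Model.add_assoc
  zero_add := Model.zero_add
  add_zero := Model.add_zero
  add_comm := Model.add_comm
  nsmul := nsmulRec

@[simp] theorem succ_eq_add_one (a : M.N) : succ a = a + 1 := by
  change succ a = a + succ 0
  rw [add_succ, add_zero]

protected theorem zero_mul (n : M.N) : 0 * n = 0 :=
  M.induction (P := fun n => 0 * n = 0) nil (.eq (mul zero v0) zero) (Model.mul_zero 0)
    (fun n ih => by rw [mul_succ, ih, add_zero]) n

theorem succ_mul (a b : M.N) : succ a * b = a * b + b :=
  M.induction (P := fun b => succ a * b = a * b + b) (cons a nil)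
    (.eq (mul (suc v1) v0) (add (mul v1 v0) v0)) (by simp only [Model.mul_zero, add_zero])
    (fun n ih => by simp only [mul_succ, add_succ, ih]; rw [add_right_comm]) b

protected theorem mul_comm (a b : M.N) : a * b = b * a :=
  M.induction (P := fun b => a * b = b * a) (cons a nil) (.eq (mul v1 v0) (mul v0 v1))
    (by rw [Model.mul_zero, Model.zero_mul])
    (fun n ih => by rw [mul_succ, succ_mul, ih]) b

protected theorem mul_add (a b c : M.N) : a * (b + c) = a * b + a * c :=
  M.induction (P := fun c => a * (b + c) = a * b + a * c) (cons a (cons b nil))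
    (.eq (mul v1 (add v2 v0)) (add (mul v1 v2) (mul v1 v0)))
    (by simp only [Model.mul_zero, add_zero])
    (fun n ih => by rw [add_succ, mul_succ, mul_succ, ih, add_assoc]) c

protected theorem mul_assoc (a b c : M.N) : a * b * c = a * (b * c) :=
  M.induction (P := fun c => a * b * c = a * (b * c)) (cons a (cons b nil))
    (.eq (mul (mul v1 v2) v0) (mul v1 (mul v2 v0))) (by simp only [Model.mul_zero])
    (fun n ih => by rw [mul_succ, mul_succ, ih, Model.mul_add]) c

protected theorem mul_one (a : M.N) : a * 1 = a := by
  change a * succ 0 = a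
  rw [mul_succ, Model.mul_zero, zero_add]

instance : CommSemiring M.N where
  left_distrib := Model.mul_add
  right_distrib a b c := by rw [Model.mul_comm, Model.mul_add, Model.mul_comm c, Model.mul_comm c]
  zero_mul := Model.zero_mul
  mul_zero := Model.mul_zero
  mul_assoc := Model.mul_assoc
  one_mul a := by rw [Model.mul_comm, Model.mul_one]
  mul_one := Model.mul_one
  mul_comm := Model.mul_comm

instance : IsCancelAdd M.N :=
  have h : ∀ a b c : M.N, a + c = b + c → a = b := fun a b c =>
    M.induction (P := fun c => a + c = b + c → a = b) (cons a (cons b nil))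
      (.eq (add v1 v0) (add v2 v0) ⇛ .eq v1 v2) (by simp)
      (fun n ih h => ih (succ_inj (by simpa only [add_succ] using h))) c
  have : IsRightCancelAdd M.N := ⟨fun c a b => h a b c⟩
  { AddCommMagma.IsRightCancelAdd.toIsLeftCancelAdd M.N with }

theorem succ_monus_succ (a b : M.N) : monus (succ a) (succ b) = monus a b :=
  M.induction (P := fun b => monus (succ a) (succ b) = monus a b) (cons a nil)
    (.eq (FinTypeArith.monus (suc v1) (suc v0)) (FinTypeArith.monus v1 v0))
    (by rw [monus_succ, monus_zero, monus_zero, pred_succ])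
    (fun n ih => by rw [monus_succ, ih, ← monus_succ]) b

theorem add_monus (a b : M.N) : monus (a + b) b = a :=
  M.induction (P := fun b => monus (a + b) b = a) (cons a nil)
    (.eq (FinTypeArith.monus (add v1 v0) v0) v1) (by simp)
    (fun n ih => by rw [add_succ, succ_monus_succ, ih]) b

theorem monus_add (a b : M.N) : monus a (a + b) = 0 :=
  M.induction (P := fun b => monus a (a + b) = 0) (cons a nil)
    (.eq (FinTypeArith.monus v1 (add v1 v0)) zero) (by simpa using add_monus 0 a)
    (fun n ih => by rw [add_succ, monus_succ, ih, pred_zero]) b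

theorem eq_add_monus_of_ne_zero {a b : M.N} (h : monus a b ≠ 0) : a = b + monus a b :=
  (M.induction (P := fun b => monus a b ≠ 0 → a = b + monus a b) (cons a nil)
    (Fm.neg (.eq (FinTypeArith.monus v1 v0) zero) ⇛ .eq v1 (add v0 (FinTypeArith.monus v1 v0)))
    (by simp)
    (fun n ih h => by
      rw [monus_succ] at h ⊢
      have h' : monus a n ≠ 0 := fun h' => h (by rw [h', pred_zero])
      rw [succ_add, ← add_succ, succ_pred h']
      exact ih h') b) h

theorem eq_add_of_monus_eq_zero {a b : M.N} (h : monus a b = 0) : b = a + monus b a :=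
  (M.induction (P := fun b => monus a b = 0 → b = a + monus b a) (cons a nil)
    (.eq (FinTypeArith.monus v1 v0) zero ⇛ .eq v0 (add v1 (FinTypeArith.monus v0 v1)))
    (fun h => by simp_all)
    (fun n ih h => by
      by_cases h' : monus a n = 0
      · have := ih h'
        have h₂ : succ n = succ (monus n a) + a := by rw [succ_add, add_comm, ← this]
        rw [h₂, add_monus, add_comm]
      · have h₁ := eq_add_monus_of_ne_zero h'
        rw [monus_succ] at h
        rw [← succ_pred h', h, add_succ, add_zero] at h₁
        have h₂ := monus_add a 0
        rw [add_zero] at h₂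
        rw [← h₁, h₂, add_zero]) b) h

instance : LE M.N := ⟨fun a b => ∃ c, b = a + c⟩

theorem le_iff_monus {a b : M.N} : a ≤ b ↔ monus a b = 0 :=
  ⟨fun ⟨c, h⟩ => by rw [h, monus_add], fun h => ⟨_, eq_add_of_monus_eq_zero h⟩⟩

theorem eq_zero_of_add_eq_zero {a b : M.N} (h : a + b = 0) : a = 0 := by
  by_contra ha
  rw [← succ_pred ha, succ_add] at h
  exact Model.succ_ne_zero _ h

noncomputable instance : LinearOrder M.N where
  le_refl a := ⟨0, (add_zero a).symm⟩
  le_trans := by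
    rintro a _ _ ⟨c, rfl⟩ ⟨d, rfl⟩
    exact ⟨c + d, add_assoc _ _ _⟩
  le_antisymm := by
    rintro a _ ⟨c, rfl⟩ ⟨d, h⟩
    rw [add_assoc, left_eq_add] at h
    rw [eq_zero_of_add_eq_zero h, add_zero]
  le_total a b := by
    by_cases h : monus a b = 0
    · exact .inl (le_iff_monus.2 h)
    · exact .inr ⟨_, eq_add_monus_of_ne_zero h⟩
  toDecidableLE := Classical.decRel _

instance : CanonicallyOrderedAdd M.N where
  exists_add_of_le h := h
  le_self_add _ b := ⟨b, rfl⟩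
  le_add_self _ b := ⟨b, add_comm _ _⟩

instance : Nontrivial M.N := ⟨⟨1, 0, Model.succ_ne_zero 0⟩⟩

theorem lt_iff_exists_eq_add_succ {a b : M.N} : a < b ↔ ∃ c, b = a + succ c := by
  constructor
  · intro h
    obtain ⟨c, rfl⟩ := h.le
    have hc : c ≠ 0 := by
      rintro rfl
      exact h.ne (add_zero a).symm
    exact ⟨pred c, by rw [succ_pred hc]⟩
  · rintro ⟨c, rfl⟩
    exact lt_of_le_of_ne ⟨_, rfl⟩ fun h => Model.succ_ne_zero c (left_eq_add.1 h)

instance : IsStrictOrderedRing M.N where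
  add_le_add_left := by
    rintro a _ ⟨c, rfl⟩ d
    exact ⟨c, add_right_comm _ _ _⟩
  le_of_add_le_add_left := by
    rintro a b c ⟨d, h⟩
    exact ⟨d, add_left_cancel (a := a) (by rw [h, add_assoc])⟩
  zero_le_one := ⟨1, (zero_add 1).symm⟩
  mul_lt_mul_of_pos_left := by
    intro a ha b c h
    rw [lt_iff_exists_eq_add_succ] at ha h ⊢
    obtain ⟨x, rfl⟩ := ha
    obtain ⟨y, rfl⟩ := h
    exact ⟨x * succ y + y, by simp only [succ_eq_add_one]; ring⟩
  mul_lt_mul_of_pos_right := by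
    intro a ha b c h
    rw [lt_iff_exists_eq_add_succ] at ha h ⊢
    obtain ⟨x, rfl⟩ := ha
    obtain ⟨y, rfl⟩ := h
    exact ⟨succ y * x + y, by simp only [succ_eq_add_one]; ring⟩

theorem add_one_le_iff {a b : M.N} : a + 1 ≤ b ↔ a < b := by
  rw [lt_iff_exists_eq_add_succ]
  constructor
  · rintro ⟨c, rfl⟩
    exact ⟨c, by rw [succ_eq_add_one]; ring⟩
  · rintro ⟨c, rfl⟩
    exact ⟨c, by rw [succ_eq_add_one]; ring⟩

theorem lt_add_one_iff {a b : M.N} : a < b + 1 ↔ a ≤ b := by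
  rw [← add_one_le_iff]
  simp

end Model

/-! ## Pairing and integers in a model -/

namespace Model

open Interp

variable {M : Model PAwX}

theorem induction_add_one {Γ : Ctx} {P : M.N → Prop} (e : M.Env Γ) (A : Fm (.nat :: Γ)) (h0 : P 0)
    (hs : ∀ n, P n → P (n + 1)) (n : M.N)
    (hA : A.QF := by simp [Fm.QF, Fm.neg, Fm.and])
    (hP : ∀ n, Sat (cons n e) A ↔ P n := by intro n; simp [Sat]) : P n :=
  M.induction e A h0 (fun n h => by rw [succ_eq_add_one]; exact hs n h) n hA hP

@[simp] theorem recNat_add_one (n a : M.N) (f : M.D (.nat ⇒ .nat ⇒ .nat)) :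
    recNat (n + 1) a f = f ⋆ recNat n a f ⋆ n := by rw [← succ_eq_add_one, recNat_succ]

@[simp] theorem eval_two {Γ : Ctx} (e : M.Env Γ) : eval e (num 2) = 2 := by
  change succ (succ 0) = 2
  rw [succ_eq_add_one, succ_eq_add_one, zero_add, one_add_one_eq_two]

@[simp] theorem pred_add_one (a : M.N) : pred (a + 1) = a := by rw [← succ_eq_add_one, pred_succ]

theorem pred_add_cancel {a : M.N} (h : a ≠ 0) : pred a + 1 = a := by
  rw [← succ_eq_add_one, succ_pred h]

@[simp] theorem monus_self (a : M.N) : monus a a = 0 := by simpa using monus_add a 0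

theorem monus_eq_iff {a b c : M.N} (h : b ≤ a) : monus a b = c ↔ a = b + c := by
  obtain ⟨d, rfl⟩ := h
  rw [add_comm b d, add_monus, add_comm b c, add_left_inj]

/-- `2 ^ a`. -/
def pow2 (a : M.N) : M.N := eval nil pow2C ⋆ a

/-- `b` if `a = 0`, and `c` otherwise. -/
def cond (a b c : M.N) : M.N := eval nil condC ⋆ a ⋆ b ⋆ c

/-- The triangular number `0 + 1 + ⋯ + a`. -/
def tri (a : M.N) : M.N := eval nil triC ⋆ a

/-- Cantor's pairing function. -/
def pair (a b : M.N) : M.N := eval nil pairC ⋆ a ⋆ b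

/-- The largest `w` with `tri w ≤ a`. -/
def root (a : M.N) : M.N := eval nil rootC ⋆ a

/-- The first component of a pair. -/
def fst (a : M.N) : M.N := eval nil fstC ⋆ a

/-- The second component of a pair. -/
def snd (a : M.N) : M.N := eval nil sndC ⋆ a

/-- The parity. -/
def par (a : M.N) : M.N := eval nil parC ⋆ a

/-- Division by two. -/
def half (a : M.N) : M.N := eval nil halfC ⋆ a

/-- The code of the integer `a - b`: `2 * n` codes `n`, and `2 * n + 1` codes `-(n + 1)`. -/
def int (a b : M.N) : M.N := eval nil intC ⋆ a ⋆ b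

/-- The positive part of the numerator of a rational. -/
def pos (a : M.N) : M.N := eval nil posC ⋆ a

/-- The negative part of the numerator of a rational. -/
def ngt (a : M.N) : M.N := eval nil ngtC ⋆ a

section
variable {Γ : Ctx} (e : M.Env Γ) (r s t : Tm Γ .nat)
@[simp] theorem eval_pow2 : eval e (FinTypeArith.pow2 r) = pow2 (eval e r) := by
  simp only [FinTypeArith.pow2, eval_app, eval_cl]; rfl
@[simp] theorem eval_cond :
    eval e (FinTypeArith.cond r s t) = cond (eval e r) (eval e s) (eval e t) := by
  simp only [FinTypeArith.cond, eval_app, eval_cl]; rfl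
@[simp] theorem eval_tri : eval e (FinTypeArith.tri r) = tri (eval e r) := by
  simp only [FinTypeArith.tri, eval_app, eval_cl]; rfl
@[simp] theorem eval_pair : eval e (FinTypeArith.pair r s) = pair (eval e r) (eval e s) := by
  simp only [FinTypeArith.pair, eval_app, eval_cl]; rfl
@[simp] theorem eval_root : eval e (FinTypeArith.root r) = root (eval e r) := by
  simp only [FinTypeArith.root, eval_app, eval_cl]; rfl
@[simp] theorem eval_fst : eval e (FinTypeArith.fst r) = fst (eval e r) := by
  simp only [FinTypeArith.fst, eval_app, eval_cl]; rfl
@[simp] theorem eval_snd : eval e (FinTypeArith.snd r) = snd (eval e r) := by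
  simp only [FinTypeArith.snd, eval_app, eval_cl]; rfl
@[simp] theorem eval_par : eval e (FinTypeArith.par r) = par (eval e r) := by
  simp only [FinTypeArith.par, eval_app, eval_cl]; rfl
@[simp] theorem eval_half : eval e (FinTypeArith.half r) = half (eval e r) := by
  simp only [FinTypeArith.half, eval_app, eval_cl]; rfl
@[simp] theorem eval_int : eval e (FinTypeArith.int r s) = int (eval e r) (eval e s) := by
  simp only [FinTypeArith.int, eval_app, eval_cl]; rfl
@[simp] theorem eval_pos : eval e (FinTypeArith.pos r) = pos (eval e r) := by
  simp only [FinTypeArith.pos, eval_app, eval_cl]; rfl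
@[simp] theorem eval_ngt : eval e (FinTypeArith.ngt r) = ngt (eval e r) := by
  simp only [FinTypeArith.ngt, eval_app, eval_cl]; rfl
end

theorem rec_lam {Γ : Ctx} (e : M.Env Γ) {z : Tm (.nat :: Γ) .nat}
    {s : Tm (.nat :: .nat :: .nat :: Γ) .nat} (a : M.N) (F : M.N → M.N → M.N)
    (hz : ∀ n, eval (cons n e) z = a)
    (hs : ∀ n x y, eval (cons y (cons x (cons n e))) s = F x y) :
    eval e (lam (prim v0 z s)) ⋆ 0 = a ∧ ∀ n,
      eval e (lam (prim v0 z s)) ⋆ (n + 1) = F (eval e (lam (prim v0 z s)) ⋆ n) n := by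
  simp only [eval_lam, eval_prim, eval_v0, hz, recNat_zero, recNat_add_one, hs, true_and]
  intro n
  rw [recNat_congr fun x y => ?_]
  simp [hs]

@[simp] theorem pow2_zero : pow2 (0 : M.N) = 1 := by simp [pow2, pow2C]

theorem pow2_add_one (a : M.N) : pow2 (a + 1) = pow2 a + pow2 a :=
  (rec_lam nil 1 (fun x _ => x + x) (by simp) (by simp)).2 a

@[simp] theorem cond_zero (a b : M.N) : cond 0 a b = a := by simp [cond, condC]

theorem cond_of_ne_zero {c : M.N} (hc : c ≠ 0) (a b : M.N) : cond c a b = b := by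
  rw [← pred_add_cancel hc]
  simp [cond, condC]

@[simp] theorem tri_zero : tri (0 : M.N) = 0 := by simp [tri, triC]

theorem tri_add_one (a : M.N) : tri (a + 1) = tri a + (a + 1) :=
  (rec_lam nil 0 (fun x y => x + (y + 1)) (by simp) (by simp [succ_eq_add_one])).2 a

theorem pair_eq (a b : M.N) : pair a b = tri (a + b) + a := by simp [pair, pairC]

@[simp] theorem root_zero : root (0 : M.N) = 0 := by simp [root, rootC]

theorem root_add_one (a : M.N) :
    root (a + 1) = cond (monus (tri (root a + 1)) (a + 1)) (root a + 1) (root a) :=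
  (rec_lam nil 0 (fun x y => cond (monus (tri (x + 1)) (y + 1)) (x + 1) x) (by simp)
    (by simp [succ_eq_add_one])).2 a

theorem fst_eq (a : M.N) : fst a = monus a (tri (root a)) := by simp [fst, fstC]
theorem snd_eq (a : M.N) : snd a = monus (root a) (fst a) := by simp [snd, sndC]

@[simp] theorem par_zero : par (0 : M.N) = 0 := by simp [par, parC]

theorem par_add_one (a : M.N) : par (a + 1) = monus 1 (par a) :=
  (rec_lam nil 0 (fun x _ => monus 1 x) (by simp) (by simp)).2 a

@[simp] theorem half_zero : half (0 : M.N) = 0 := by simp [half, halfC]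

theorem half_add_one (a : M.N) : half (a + 1) = half a + par a :=
  (rec_lam nil 0 (fun x y => x + par y) (by simp) (by simp)).2 a

theorem tri_mono {a b : M.N} (h : a ≤ b) : tri a ≤ tri b := by
  have h₂ : ∀ n : M.N, tri n + tri n = n * (n + 1) := fun n =>
    M.induction_add_one (P := fun n => tri n + tri n = n * (n + 1)) nil
      (.eq (add (FinTypeArith.tri v0) (FinTypeArith.tri v0)) (mul v0 (suc v0))) (by simp)
      (fun n ih => by
        calc tri (n + 1) + tri (n + 1) = (tri n + tri n) + (n + 1) + (n + 1) := by
              rw [tri_add_one]; ring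
          _ = (n + 1) * (n + 1 + 1) := by rw [ih]; ring) n
  by_contra! hlt
  have h₃ := add_lt_add hlt hlt
  rw [h₂, h₂] at h₃
  exact absurd (mul_le_mul' h (add_le_add_left h 1)) h₃.not_ge

theorem root_spec (a : M.N) : tri (root a) ≤ a ∧ a < tri (root a + 1) := by
  rw [← add_one_le_iff, le_iff_monus, le_iff_monus]
  refine M.induction_add_one
    (P := fun a => monus (tri (root a)) a = 0 ∧ monus (a + 1) (tri (root a + 1)) = 0) nil
    (Fm.and (.eq (FinTypeArith.monus (FinTypeArith.tri (FinTypeArith.root v0)) v0) zero)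
      (.eq (FinTypeArith.monus (suc v0) (FinTypeArith.tri (suc (FinTypeArith.root v0)))) zero))
    ?_ ?_ a
  · simp only [root_zero, tri_add_one, ← le_iff_monus]
    simp
  · intro n
    simp only [← le_iff_monus, root_add_one]
    rintro ⟨h₁, h₂⟩
    by_cases h : tri (root n + 1) ≤ n + 1
    · rw [le_iff_monus.1 h, cond_zero]
      refine ⟨h, ?_⟩
      rw [tri_add_one (root n + 1)]
      have := add_le_add h₂ (show (1 : M.N) ≤ root n + 1 + 1 from le_add_self)
      exact this
    · rw [cond_of_ne_zero (fun h' => h (le_iff_monus.2 h'))]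
      rw [not_le] at h
      exact ⟨h₁.trans le_self_add, add_one_le_iff.2 h⟩

theorem root_eq {a w : M.N} (h₁ : tri w ≤ a) (h₂ : a < tri (w + 1)) : root a = w := by
  obtain ⟨h₃, h₄⟩ := root_spec a
  refine le_antisymm ?_ ?_
  · by_contra! h
    exact absurd ((tri_mono (add_one_le_iff.2 h)).trans h₃) h₂.not_ge
  · by_contra! h
    exact absurd ((tri_mono (add_one_le_iff.2 h)).trans h₁) h₄.not_ge

theorem root_pair (a b : M.N) : root (pair a b) = a + b := by
  refine root_eq ?_ ?_
  · rw [pair_eq]; exact le_self_add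
  · rw [pair_eq, tri_add_one, add_lt_add_iff_left, lt_add_one_iff]; exact le_self_add

@[simp] theorem fst_pair (a b : M.N) : fst (pair a b) = a := by
  rw [fst_eq, root_pair, pair_eq, add_comm, add_monus]

@[simp] theorem snd_pair (a b : M.N) : snd (pair a b) = b := by
  rw [snd_eq, fst_pair, root_pair, add_comm, add_monus]

theorem le_pair (a b : M.N) : a ≤ pair a b := by
  rw [pair_eq]; exact le_add_self

theorem par_half_double (a : M.N) : par (a + a) = 0 ∧ half (a + a) = a := by
  refine M.induction_add_one (P := fun a => par (a + a) = 0 ∧ half (a + a) = a) nil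
    (Fm.and (.eq (FinTypeArith.par (add v0 v0)) zero) (.eq (FinTypeArith.half (add v0 v0)) v0))
    (by simp) (fun n ih => ?_) a
  rw [show n + 1 + (n + 1) = n + n + 1 + 1 by ring, par_add_one, half_add_one, par_add_one,
    half_add_one, ih.1, ih.2]
  simp

theorem int_eq (a b : M.N) :
    (b ≤ a ∧ int a b = monus a b + monus a b) ∨
      (a < b ∧ int a b = pred (monus b a + monus b a)) := by
  have h : int a b = cond (monus b a) (monus a b + monus a b) (pred (monus b a + monus b a)) := by
    simp [int, intC, two_mul]
  rcases le_or_gt b a with hab | hab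
  · exact .inl ⟨hab, by rw [h, le_iff_monus.1 hab, cond_zero]⟩
  · refine .inr ⟨hab, ?_⟩
    rw [h, cond_of_ne_zero fun h' => hab.not_ge (le_iff_monus.2 h')]

theorem pos_eq (r : M.N) : pos r = monus 1 (par (fst r)) * half (fst r) := by simp [pos, posC]
theorem ngt_eq (r : M.N) : ngt r = par (fst r) * half (fst r + 1) := by simp [ngt, ngtC]

theorem pos_pair_int (a b d : M.N) : pos (pair (int a b) d) = monus a b := by
  rw [pos_eq, fst_pair]
  rcases int_eq a b with ⟨-, h'⟩ | ⟨h, h'⟩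
  · rw [h', (par_half_double _).1, (par_half_double _).2]
    simp
  · have h₀ : monus b a ≠ 0 := fun h' => h.not_ge (le_iff_monus.2 h')
    obtain ⟨k, hk⟩ : ∃ k, monus b a = k + 1 := ⟨_, (pred_add_cancel h₀).symm⟩
    rw [h', hk, show k + 1 + (k + 1) = k + k + 1 + 1 by ring, pred_add_one, par_add_one,
      (par_half_double _).1, le_iff_monus.1 h.le, monus_zero, monus_self, zero_mul]

theorem ngt_pair_int (a b d : M.N) : ngt (pair (int a b) d) = monus b a := by
  rw [ngt_eq, fst_pair]
  rcases int_eq a b with ⟨h, h'⟩ | ⟨h, h'⟩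
  · rw [h', (par_half_double _).1, le_iff_monus.1 h, zero_mul]
  · have h₀ : monus b a ≠ 0 := fun h' => h.not_ge (le_iff_monus.2 h')
    obtain ⟨k, hk⟩ : ∃ k, monus b a = k + 1 := ⟨_, (pred_add_cancel h₀).symm⟩
    rw [h', hk, show k + 1 + (k + 1) = k + k + 1 + 1 by ring, pred_add_one, par_add_one,
      (par_half_double _).1, monus_zero, one_mul, show k + k + 1 + 1 = k + 1 + (k + 1) by ring,
      (par_half_double _).2]

end Model

/-! ## Ordered fields of fractions and differences -/

section Cone

variable {K : Type*} [CommRing K] [IsDomain K]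

theorem isStrictOrderedRing_mkOfCone (C : RingCone K) [HasMemOrNegMem C]
    [DecidablePred (· ∈ C)] :
    letI : LinearOrder K := .mkOfAddGroupCone C
    IsStrictOrderedRing K :=
  letI : LinearOrder K := .mkOfAddGroupCone C
  haveI : IsOrderedRing K := .mkOfCone C
  IsOrderedRing.toIsStrictOrderedRing K

end Cone

section Differences

open TensorProduct

variable (N : Type*) [CommSemiring N]

/-- The ring of formal differences of a commutative semiring. -/
def Differences : Type _ := ℤ ⊗[ℕ] N

namespace Differences

noncomputable instance : CommRing (Differences N) := inferInstanceAs (CommRing (ℤ ⊗[ℕ] N))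

/-- The map from a semiring to its ring of differences. -/
noncomputable def of : N →+* Differences N :=
  (Algebra.TensorProduct.includeRight : N →ₐ[ℕ] ℤ ⊗[ℕ] N).toRingHom

variable {N}

theorem of_injective [IsCancelAdd N] : Function.Injective (of N) := by
  let G := Algebra.GrothendieckAddGroup N
  let smulOf : ℤ →ₗ[ℕ] N →ₗ[ℕ] G := LinearMap.mk₂ ℕ
    (fun z a => z • Algebra.GrothendieckAddGroup.of a)
    (fun _ _ _ => add_smul _ _ _) (fun _ _ _ => smul_assoc _ _ _)
    (fun _ _ _ => by rw [map_add, smul_add])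
    (fun n z a => by rw [map_nsmul, smul_comm])
  have lift_of (a : N) : lift smulOf (of N a) = Algebra.GrothendieckAddGroup.of a := by
    change lift smulOf (1 ⊗ₜ a) = _
    rw [lift.tmul]
    exact one_smul ℤ _
  intro a b h
  exact Algebra.GrothendieckAddGroup.of_injective (by rw [← lift_of, h, lift_of])

theorem exists_eq_of_sub_of (z : Differences N) : ∃ a b, z = of N a - of N b := by
  induction z using TensorProduct.induction_on with
  | zero => exact ⟨0, 0, by rw [sub_self]; rfl⟩
  | add x y hx hy =>
    obtain ⟨a, b, rfl⟩ := hx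
    obtain ⟨c, d, rfl⟩ := hy
    refine ⟨a + c, b + d, ?_⟩
    rw [map_add, map_add]
    exact sub_add_sub_comm (of N a) (of N b) (of N c) (of N d)
  | tmul z a =>
    have natCast_tmul (n : ℕ) : (n : ℤ) ⊗ₜ[ℕ] a = of N (n • a) := by
      change _ = (1 : ℤ) ⊗ₜ[ℕ] (n • a)
      rw [← smul_tmul, nsmul_one]
    obtain ⟨m, n, rfl⟩ : ∃ m n : ℕ, z = m - n := ⟨_, _, (Int.toNat_sub_toNat_neg z).symm⟩
    exact ⟨m • a, n • a, by rw [sub_tmul, natCast_tmul, natCast_tmul]; rfl⟩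

variable [LinearOrder N] [CanonicallyOrderedAdd N]

theorem eq_of_or_eq_neg_of (z : Differences N) : ∃ a, z = of N a ∨ z = -of N a := by
  obtain ⟨a, b, rfl⟩ := exists_eq_of_sub_of z
  rcases le_total a b with h | h <;> obtain ⟨c, rfl⟩ := exists_add_of_le h
  · exact ⟨c, .inr (by rw [map_add]; ring)⟩
  · exact ⟨c, .inl (by rw [map_add]; ring)⟩

instance [IsCancelAdd N] [IsStrictOrderedRing N] : IsDomain (Differences N) := by
  have : Nontrivial (Differences N) := of_injective.nontrivial
  have eq_zero_or (a b : N) (h : of N a * of N b = 0) : of N a = 0 ∨ of N b = 0 := by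
    rw [← map_mul, map_eq_zero_iff _ of_injective] at h
    exact (mul_eq_zero.1 h).imp (by simp +contextual) (by simp +contextual)
  have : NoZeroDivisors (Differences N) :=
    { eq_zero_or_eq_zero_of_mul_eq_zero := fun {x y} h => by
        obtain ⟨a, rfl | rfl⟩ := eq_of_or_eq_neg_of x <;>
          obtain ⟨b, rfl | rfl⟩ := eq_of_or_eq_neg_of y <;>
          simpa using eq_zero_or a b (by simpa using h) }
  exact NoZeroDivisors.to_isDomain _

end Differences

end Differences

section Fractions

variable (N : Type*) [CommSemiring N] [LinearOrder N] [IsStrictOrderedRing N]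
  [CanonicallyOrderedAdd N] [IsCancelAdd N]

/-- The field generated by a semiring `N` of natural numbers: the fractions of differences. -/
def FractionField : Type _ := FractionRing (Differences N)

namespace FractionField

noncomputable instance : Field (FractionField N) :=
  inferInstanceAs (Field (FractionRing (Differences N)))

/-- The embedding of a semiring of natural numbers into its field of fractions. -/
noncomputable def of : N →+* FractionField N :=
  (algebraMap (Differences N) (FractionRing (Differences N))).comp (Differences.of N)

variable {N}

theorem of_injective : Function.Injective (of N) :=
  (IsFractionRing.injective (Differences N) (FractionRing (Differences N))).comp
    Differences.of_injective

theorem of_ne_zero {a : N} : of N a ≠ 0 ↔ a ≠ 0 := map_ne_zero_iff _ of_injective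

theorem eq_div_or_eq_neg_div (x : FractionField N) :
    ∃ a b, b ≠ 0 ∧ (x = of N a / of N b ∨ x = -(of N a / of N b)) := by
  obtain ⟨y, z, hz, rfl⟩ := IsFractionRing.div_surjective (A := Differences N)
    (K := FractionRing (Differences N)) x
  obtain ⟨a, ha⟩ := Differences.eq_of_or_eq_neg_of y
  obtain ⟨b, hb⟩ := Differences.eq_of_or_eq_neg_of z
  have hb0 : b ≠ 0 := by
    rintro rfl
    simp only [map_zero, neg_zero, or_self] at hb
    exact nonZeroDivisors.ne_zero hz hb
  refine ⟨a, b, hb0, ?_⟩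
  let i := algebraMap (Differences N) (FractionRing (Differences N))
  change i y / i z = i (.of N a) / i (.of N b) ∨ i y / i z = -(i (.of N a) / i (.of N b))
  rcases ha with rfl | rfl <;> rcases hb with rfl | rfl <;> simp [div_neg, neg_div]

variable (N) in
/-- The nonnegative fractions: the quotients of natural numbers. -/
noncomputable def nonneg : RingCone (FractionField N) where
  carrier := {x | ∃ a b, b ≠ 0 ∧ x = of N a / of N b}
  zero_mem' := ⟨0, 1, one_ne_zero, by simp⟩
  one_mem' := ⟨1, 1, one_ne_zero, by simp⟩
  add_mem' := by
    rintro _ _ ⟨a, b, hb, rfl⟩ ⟨c, d, hd, rfl⟩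
    refine ⟨a * d + b * c, b * d, mul_ne_zero hb hd, ?_⟩
    rw [div_add_div _ _ (of_ne_zero.2 hb) (of_ne_zero.2 hd)]
    simp only [map_add, map_mul]
  mul_mem' := by
    rintro _ _ ⟨a, b, hb, rfl⟩ ⟨c, d, hd, rfl⟩
    exact ⟨a * c, b * d, mul_ne_zero hb hd, by simp only [map_mul, div_mul_div_comm]⟩
  eq_zero_of_mem_of_neg_mem' := by
    rintro _ ⟨a, b, hb, rfl⟩ ⟨c, d, hd, h⟩
    rw [← neg_div, div_eq_div_iff (of_ne_zero.2 hb) (of_ne_zero.2 hd), neg_mul,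
      neg_eq_iff_add_eq_zero, ← map_mul, ← map_mul, ← map_add,
      map_eq_zero_iff _ of_injective, add_eq_zero] at h
    rw [(mul_eq_zero.1 h.1).resolve_right hd, map_zero, zero_div]

instance : HasMemOrNegMem (nonneg N) where
  mem_or_neg_mem x := by
    obtain ⟨a, b, hb, rfl | rfl⟩ := eq_div_or_eq_neg_div x
    · exact .inl ⟨a, b, hb, rfl⟩
    · exact .inr ⟨a, b, hb, neg_neg _⟩

open Classical in
noncomputable instance : LinearOrder (FractionField N) := .mkOfAddGroupCone (nonneg N)

open Classical in
instance : IsStrictOrderedRing (FractionField N) := isStrictOrderedRing_mkOfCone (nonneg N)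

theorem nonneg_iff {x : FractionField N} :
    0 ≤ x ↔ ∃ a b, b ≠ 0 ∧ x = of N a / of N b := by
  change x - 0 ∈ nonneg N ↔ _
  rw [sub_zero]
  rfl

theorem of_nonneg (a : N) : 0 ≤ of N a := nonneg_iff.2 ⟨a, 1, one_ne_zero, by simp⟩

theorem of_strictMono : StrictMono (of N) := by
  refine Monotone.strictMono_of_injective (fun a b h => ?_) of_injective
  obtain ⟨c, rfl⟩ := exists_add_of_le h
  rw [map_add]
  exact le_add_of_nonneg_right (of_nonneg c)

theorem exists_lt_of (one_le : ∀ a : N, 0 < a → 1 ≤ a) (x : FractionField N) :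
    ∃ a, x < of N a := by
  rcases lt_or_ge x 0 with h | h
  · exact ⟨0, by rwa [map_zero]⟩
  · obtain ⟨a, b, hb, rfl⟩ := nonneg_iff.1 h
    have one_le_of : 1 ≤ of N b := by
      rw [← map_one (of N)]
      exact of_strictMono.monotone (one_le b (pos_iff_ne_zero.2 hb))
    refine ⟨a + 1, ?_⟩
    calc of N a / of N b ≤ of N a := div_le_self (of_nonneg a) one_le_of
      _ < of N (a + 1) := by rw [map_add, map_one]; exact lt_add_one _

end FractionField

end Fractions

/-! ## Bounded elements modulo infinitesimals -/

section StandardPart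

theorem strictMono_orderRingHom {k K : Type*} [DivisionRing k] [LinearOrder k]
    [NonAssocSemiring K] [Nontrivial K] [PartialOrder K] (i : k →+*o K) : StrictMono i :=
  i.monotone'.strictMono_of_injective i.toRingHom.injective

variable {k K : Type*} [Field k] [LinearOrder k] [IsStrictOrderedRing k]
  [Field K] [LinearOrder K] [IsStrictOrderedRing K] (i : k →+*o K)

/-- The elements of an ordered extension field that are bounded by elements of the base field. -/
def boundedSubring : Subring K where
  carrier := {x | ∃ b, |x| ≤ i b}
  zero_mem' := ⟨0, by simp⟩
  one_mem' := ⟨1, by simp⟩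
  add_mem' := by
    rintro x y ⟨b, hb⟩ ⟨c, hc⟩
    exact ⟨b + c, (abs_add_le x y).trans (by rw [map_add]; exact add_le_add hb hc)⟩
  neg_mem' := by
    rintro x ⟨b, hb⟩
    exact ⟨b, by rwa [abs_neg]⟩
  mul_mem' := by
    rintro x y ⟨b, hb⟩ ⟨c, hc⟩
    refine ⟨b * c, ?_⟩
    rw [abs_mul, map_mul]
    exact mul_le_mul hb hc (abs_nonneg y) ((abs_nonneg x).trans hb)

/-- The elements of an ordered extension field that are smaller than all positive elements of the
base field, as an ideal of the bounded elements. -/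
def infinitesimals : Ideal (boundedSubring i) where
  carrier := {x | ∀ δ > 0, |x.1| ≤ i δ}
  zero_mem' δ hδ := by simpa using i.monotone' hδ.le
  add_mem' {x y} hx hy δ hδ := by
    have halves := add_le_add (hx (δ / 2) (half_pos hδ)) (hy (δ / 2) (half_pos hδ))
    rw [← map_add, add_halves] at halves
    exact (abs_add_le x.1 y.1).trans halves
  smul_mem' := by
    rintro ⟨x, b, hb⟩ y hy δ hδ
    have hb' : |x| ≤ i (|b| + 1) := hb.trans (i.monotone' (by linarith [le_abs_self b]))
    have hpos : 0 < |b| + 1 := by positivity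
    calc |x * y.1| = |x| * |y.1| := abs_mul _ _
      _ ≤ i (|b| + 1) * i (δ / (|b| + 1)) :=
        mul_le_mul hb' (hy _ (div_pos hδ hpos)) (abs_nonneg _) ((abs_nonneg _).trans hb')
      _ = i δ := by rw [← map_mul, mul_div_cancel₀ _ hpos.ne']

/-- The ring of standard parts: the bounded elements modulo the infinitesimal ones. -/
def StandardPart : Type _ := boundedSubring i ⧸ infinitesimals i

namespace StandardPart

noncomputable instance : CommRing (StandardPart i) :=
  inferInstanceAs (CommRing (boundedSubring i ⧸ infinitesimals i))

variable {i}

instance ordConnected_preimage_mk (x) : Set.OrdConnected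
    (Quotient.mk (Submodule.quotientRel (infinitesimals i)) ⁻¹' {x}) := by
  refine ⟨?_⟩
  rintro a rfl b hb c ⟨hac, hcb⟩
  rw [Set.mem_preimage, Set.mem_singleton_iff, Quotient.eq, Submodule.quotientRel_def] at hb ⊢
  intro δ hδ
  have hac' : 0 ≤ (c - a).1 := sub_nonneg.2 hac
  rw [abs_of_nonneg hac']
  exact (sub_le_sub_right (α := K) hcb a.1).trans ((le_abs_self _).trans (hb δ hδ))

open Classical in
noncomputable instance : LinearOrder (StandardPart i) :=
  inferInstanceAs (LinearOrder (Quotient (Submodule.quotientRel (infinitesimals i))))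

variable (i) in
/-- The standard part map. -/
noncomputable def mk : boundedSubring i →+* StandardPart i := Ideal.Quotient.mk (infinitesimals i)

theorem mk_surjective : Function.Surjective (mk i) := Ideal.Quotient.mk_surjective

theorem mk_eq_zero {x : boundedSubring i} : mk i x = 0 ↔ ∀ δ > 0, |x.1| ≤ i δ :=
  Ideal.Quotient.eq_zero_iff_mem

theorem mk_le_mk {x y : boundedSubring i} : mk i x ≤ mk i y ↔ x.1 ≤ y.1 ∨ mk i x = mk i y :=
  Quotient.mk_le_mk.trans (or_congr_right Quotient.eq.symm)

theorem mk_monotone : Monotone (mk i) := fun _ _ h => mk_le_mk.2 (.inl h)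

theorem mk_le_mk_iff_forall {x y : boundedSubring i} :
    mk i x ≤ mk i y ↔ ∀ δ > 0, x.1 ≤ y.1 + i δ := by
  rw [mk_le_mk, ← sub_eq_zero, ← map_sub, mk_eq_zero]
  constructor
  · rintro (h | h) δ hδ
    · exact h.trans (le_add_of_nonneg_right (by simpa using i.monotone' hδ.le))
    · exact sub_le_iff_le_add'.1 ((le_abs_self _).trans (h δ hδ))
  · intro h
    refine or_iff_not_imp_left.2 fun hxy δ hδ => ?_
    change |x.1 - y.1| ≤ i δ
    rw [abs_of_pos (sub_pos.2 (not_le.1 hxy))]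
    exact sub_le_iff_le_add'.2 (h δ hδ)

theorem exists_nonneg_mk_eq {x : StandardPart i} (hx : 0 ≤ x) :
    ∃ a : boundedSubring i, 0 ≤ a.1 ∧ mk i a = x := by
  obtain ⟨a, rfl⟩ := mk_surjective x
  rw [← map_zero (mk i), mk_le_mk] at hx
  rcases hx with ha | ha
  · exact ⟨a, ha, rfl⟩
  · exact ⟨0, le_rfl, ha⟩

instance : Nontrivial (StandardPart i) := by
  refine ⟨0, 1, fun h => ?_⟩
  rw [← map_zero (mk i), ← map_one (mk i)] at h
  have h' : (1 : K) ≤ 0 + i 2⁻¹ := mk_le_mk_iff_forall.1 h.ge 2⁻¹ (by norm_num)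
  rw [zero_add, ← map_one i] at h'
  have := (strictMono_orderRingHom i).le_iff_le.1 h'
  norm_num at this

instance : NoZeroDivisors (StandardPart i) where
  eq_zero_or_eq_zero_of_mul_eq_zero {x y} h := by
    obtain ⟨x, rfl⟩ := mk_surjective x
    obtain ⟨y, rfl⟩ := mk_surjective y
    rw [← map_mul, mk_eq_zero] at h
    rw [or_iff_not_imp_left, mk_eq_zero, mk_eq_zero]
    push Not
    rintro ⟨δ, hδ, hx⟩ η hη
    have hiδ : 0 < i δ := by simpa using strictMono_orderRingHom i hδ
    refine le_of_mul_le_mul_left ?_ hiδ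
    calc i δ * |y.1| ≤ |x.1| * |y.1| := mul_le_mul_of_nonneg_right hx.le (abs_nonneg _)
      _ = |(x * y).1| := (abs_mul _ _).symm
      _ ≤ i (δ * η) := h _ (mul_pos hδ hη)
      _ = i δ * i η := map_mul i δ η

instance : IsStrictOrderedRing (StandardPart i) := by
  have : IsDomain (StandardPart i) := NoZeroDivisors.to_isDomain _
  have : IsOrderedAddMonoid (StandardPart i) :=
    { add_le_add_left := fun x y hxy z => by
        obtain ⟨x, rfl⟩ := mk_surjective x
        obtain ⟨y, rfl⟩ := mk_surjective y
        obtain ⟨z, rfl⟩ := mk_surjective z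
        rw [← map_add, ← map_add, mk_le_mk_iff_forall]
        rw [mk_le_mk_iff_forall] at hxy
        intro δ hδ
        change x.1 + z.1 ≤ y.1 + z.1 + i δ
        linarith [hxy δ hδ] }
  have : ZeroLEOneClass (StandardPart i) := ⟨by
    rw [← map_zero (mk i), ← map_one (mk i)]
    exact mk_monotone zero_le_one⟩
  have : IsOrderedRing (StandardPart i) := .of_mul_nonneg fun x y hx hy => by
    obtain ⟨a, ha, rfl⟩ := exists_nonneg_mk_eq hx
    obtain ⟨b, hb, rfl⟩ := exists_nonneg_mk_eq hy
    rw [← map_mul, ← map_zero (mk i)]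
    exact mk_monotone (mul_nonneg ha hb)
  exact IsOrderedRing.toIsStrictOrderedRing _

variable (i) in
/-- The embedding of the base field into the standard parts. -/
noncomputable def of : k →+* StandardPart i :=
  (mk i).comp (i.toRingHom.codRestrict (boundedSubring i) fun b =>
    ⟨|b|, abs_le.2 ⟨by
      rw [← map_neg]
      exact i.monotone' (neg_abs_le b), i.monotone' (le_abs_self b)⟩⟩)

theorem of_strictMono : StrictMono (of i) := by
  have : Monotone (of i) := fun a b hab => mk_monotone (i.monotone' hab)
  exact this.strictMono_of_injective (of i).injective

theorem le_of_forall_le_add_of {x y : StandardPart i} (h : ∀ δ > 0, x ≤ y + of i δ) : x ≤ y := by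
  obtain ⟨x, rfl⟩ := mk_surjective x
  obtain ⟨y, rfl⟩ := mk_surjective y
  refine mk_le_mk_iff_forall.2 fun δ hδ => ?_
  have h' := mk_le_mk_iff_forall.1 (h (δ / 2) (half_pos hδ)) (δ / 2) (half_pos hδ)
  rw [← add_halves δ, map_add, ← add_assoc]
  exact h'

theorem abs_mk_sub_of_le {x : boundedSubring i} {a δ : k} (h : |x.1 - i a| ≤ i δ) :
    |mk i x - of i a| ≤ of i δ := by
  have h' := abs_le.1 h
  rw [abs_le, ← map_neg]
  rw [← map_neg] at h'
  exact ⟨mk_monotone h'.1, mk_monotone h'.2⟩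

end StandardPart

end StandardPart

section Ultrapower

open Filter

variable (ι Q : Type*) [LinearOrder ι] [Nonempty ι]
  [Field Q] [LinearOrder Q] [IsStrictOrderedRing Q]

/-- The ultrapower of an ordered field along an ultrafilter that contains all final segments. -/
abbrev Ultrapower : Type _ := (Ultrafilter.of (atTop : Filter ι) : Filter ι).Germ Q

/-- The diagonal embedding of an ordered field into its ultrapower. -/
noncomputable def Ultrapower.const : Q →+*o Ultrapower ι Q where
  toFun q := (↑q : Ultrapower ι Q)
  map_zero' := rfl
  map_one' := rfl
  map_add' _ _ := rfl
  map_mul' _ _ := rfl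
  monotone' _ _ h := Germ.const_le h

/-- Limits of bounded `ι`-sequences in `Q`, namely the standard parts of their germs. -/
abbrev LimitRing : Type _ := StandardPart (Ultrapower.const ι Q)

variable {ι Q}

open Classical in
/-- The limit of a sequence along the ultrafilter; the junk value for unbounded sequences is `0`. -/
noncomputable def ultralimit (s : ι → Q) : LimitRing ι Q :=
  if h : (↑s : Ultrapower ι Q) ∈ boundedSubring (Ultrapower.const ι Q) then
    StandardPart.mk _ ⟨s, h⟩
  else 0

theorem abs_ultralimit_sub_of_le {s : ι → Q} {a δ : Q} (h : ∀ᶠ n in atTop, |s n - a| ≤ δ) :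
    |ultralimit s - .of _ a| ≤ .of _ δ := by
  let i := Ultrapower.const ι Q
  have abs_sub_le : |(↑s : Ultrapower ι Q) - i a| ≤ i δ := by
    rw [Germ.abs_def]
    exact Germ.coe_le.2 (h.filter_mono (Ultrafilter.of_le atTop))
  have bounded : (↑s : Ultrapower ι Q) ∈ boundedSubring i := by
    refine ⟨δ + |a|, ?_⟩
    have abs_const : i |a| = |i a| := Germ.const_abs a
    rw [map_add, abs_const]
    linarith [abs_sub_abs_le_abs_sub (↑s : Ultrapower ι Q) (i a)]
  rw [ultralimit, dif_pos bounded]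
  exact StandardPart.abs_mk_sub_of_le abs_sub_le

end Ultrapower

/-! ## Rational and real numbers in a model -/

namespace Model

open Interp

variable {M : Model PAwX}

/-- The sum of two rationals. -/
def addQ (a b : M.N) : M.N := eval nil addQC ⋆ a ⋆ b

/-- The product of two rationals. -/
def mulQ (a b : M.N) : M.N := eval nil mulQC ⋆ a ⋆ b

/-- The negative of a rational. -/
def negQ (a : M.N) : M.N := eval nil negQC ⋆ a

/-- The absolute value of a rational. -/
def absQ (a : M.N) : M.N := eval nil absQC ⋆ a

/-- The order of the rationals; the value is `0` exactly if `a` is less than `b`. -/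
def ltQ (a b : M.N) : M.N := eval nil ltQC ⋆ a ⋆ b

/-- The code of the rational `2⁻ᵃ`. -/
def invPow2 (a : M.N) : M.N := eval nil invPow2C ⋆ a

section
variable {Γ : Ctx} (e : M.Env Γ) (r s t : Tm Γ .nat)
@[simp] theorem eval_addQ : eval e (FinTypeArith.addQ r s) = addQ (eval e r) (eval e s) := by
  simp only [FinTypeArith.addQ, eval_app, eval_cl]; rfl
@[simp] theorem eval_mulQ : eval e (FinTypeArith.mulQ r s) = mulQ (eval e r) (eval e s) := by
  simp only [FinTypeArith.mulQ, eval_app, eval_cl]; rfl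
@[simp] theorem eval_negQ : eval e (FinTypeArith.negQ r) = negQ (eval e r) := by
  simp only [FinTypeArith.negQ, eval_app, eval_cl]; rfl
@[simp] theorem eval_absQ : eval e (FinTypeArith.absQ r) = absQ (eval e r) := by
  simp only [FinTypeArith.absQ, eval_app, eval_cl]; rfl
@[simp] theorem eval_ltQ : eval e (FinTypeArith.ltQ r s) = ltQ (eval e r) (eval e s) := by
  simp only [FinTypeArith.ltQ, eval_app, eval_cl]; rfl
@[simp] theorem eval_invPow2 : eval e (FinTypeArith.invPow2 r) = invPow2 (eval e r) := by
  simp only [FinTypeArith.invPow2, eval_app, eval_cl]; rfl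
@[simp] theorem eval_subQ : eval e (subQ r s) = addQ (eval e r) (negQ (eval e s)) := by
  simp only [subQ, eval_addQ, eval_negQ]
@[simp] theorem eval_den : eval e (den s) = snd (eval e s) + 1 := by
  simp only [den, eval_suc, eval_snd, succ_eq_add_one]
@[simp] theorem eval_mkQ : eval e (mkQ r s t) =
    pair (int (eval e r) (eval e s)) (pred (eval e t)) := by
  simp only [mkQ, eval_pair, eval_int, eval_pred]
end

variable (M) in
/-- The rationals of the model. -/
abbrev Q : Type := FractionField M.N

/-- The embedding of the numbers of the model into its rationals. -/
noncomputable abbrev toQ : M.N →+* M.Q := FractionField.of M.N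

theorem toQ_pos {a : M.N} (h : 0 < a) : 0 < toQ a := by
  rw [← map_zero toQ]
  exact FractionField.of_strictMono h

/-- The rational with a given code. -/
noncomputable def qv (r : M.N) : M.Q := (toQ (pos r) - toQ (ngt r)) / toQ (snd r + 1)

theorem den_pos (r : M.N) : 0 < toQ (snd r + 1) := toQ_pos (lt_add_one_iff.2 zero_le)

theorem toQ_monus_sub (a b : M.N) :
    toQ (monus a b) - toQ (monus b a) = toQ a - toQ b := by
  rcases le_total a b with h | h
  · have e := congrArg toQ ((monus_eq_iff h).1 rfl)
    rw [map_add] at e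
    rw [le_iff_monus.1 h, e, map_zero]
    ring
  · have e := congrArg toQ ((monus_eq_iff h).1 rfl)
    rw [map_add] at e
    rw [le_iff_monus.1 h, e, map_zero]
    ring

theorem qv_mkQ (a b d : M.N) (hd : d ≠ 0) :
    qv (pair (int a b) (pred d)) = (toQ a - toQ b) / toQ d := by
  rw [qv, pos_pair_int, ngt_pair_int, snd_pair, pred_add_cancel hd, toQ_monus_sub]

theorem mul_den_pos (r s : M.N) : 0 < (snd r + 1) * (snd s + 1) :=
  mul_pos (lt_add_one_iff.2 zero_le) (lt_add_one_iff.2 zero_le)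

@[simp] theorem qv_addQ (r s : M.N) : qv (addQ r s) = qv r + qv s := by
  have hr := (den_pos r).ne'
  have hs := (den_pos s).ne'
  simp only [addQ, addQC, eval_lam, eval_mkQ, eval_add, eval_mul, eval_pos, eval_ngt, eval_den,
    eval_v0, eval_v1]
  rw [qv_mkQ _ _ _ (mul_den_pos r s).ne', qv, qv, div_add_div _ _ hr hs]
  simp only [map_add, map_mul, map_one]
  congr 1
  ring

@[simp] theorem qv_mulQ (r s : M.N) : qv (mulQ r s) = qv r * qv s := by
  simp only [mulQ, mulQC, eval_lam, eval_mkQ, eval_add, eval_mul, eval_pos, eval_ngt, eval_den,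
    eval_v0, eval_v1]
  rw [qv_mkQ _ _ _ (mul_den_pos r s).ne', qv, qv, div_mul_div_comm]
  simp only [map_add, map_mul, map_one]
  congr 1
  ring

@[simp] theorem qv_negQ (r : M.N) : qv (negQ r) = -qv r := by
  simp only [negQ, negQC, eval_lam, eval_mkQ, eval_pos, eval_ngt, eval_den, eval_v0]
  rw [qv_mkQ _ _ _ (lt_add_one_iff.2 zero_le).ne', qv, ← neg_div, neg_sub]

theorem pos_eq_zero_or_ngt_eq_zero (r : M.N) : pos r = 0 ∨ ngt r = 0 := by
  rw [pos_eq, ngt_eq]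
  have h : monus 1 (par (fst r)) * par (fst r) = 0 := by
    refine M.induction_add_one (P := fun a => monus 1 (par a) * par a = 0) nil
      (.eq (mul (FinTypeArith.monus (num 1) (FinTypeArith.par v0)) (FinTypeArith.par v0)) zero)
      (by simp) (fun n ih => ?_) _
    rw [par_add_one]
    rcases mul_eq_zero.1 ih with h | h
    · rw [h, mul_zero]
    · rw [h, monus_zero, monus_self, zero_mul]
  rcases mul_eq_zero.1 h with h | h
  · exact .inl (by rw [h, zero_mul])
  · exact .inr (by rw [h, zero_mul])

theorem abs_num (r : M.N) :
    |toQ (pos r) - toQ (ngt r)| = toQ (pos r) + toQ (ngt r) := by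
  rcases pos_eq_zero_or_ngt_eq_zero r with h | h
  · rw [h, map_zero, zero_sub, zero_add, abs_neg, abs_of_nonneg (FractionField.of_nonneg _)]
  · rw [h, map_zero, sub_zero, add_zero, abs_of_nonneg (FractionField.of_nonneg _)]

@[simp] theorem qv_absQ (r : M.N) : qv (absQ r) = |qv r| := by
  simp only [absQ, absQC, eval_lam, eval_mkQ, eval_pos, eval_ngt, eval_den, eval_v0, eval_add,
    eval_zero]
  rw [qv_mkQ _ _ _ (lt_add_one_iff.2 zero_le).ne', qv, abs_div, abs_num, abs_of_pos (den_pos r)]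
  simp

theorem abs_qv_le (r : M.N) : |qv r| ≤ toQ (pos r + ngt r) := by
  rw [qv, abs_div, abs_num, abs_of_pos (den_pos r), map_add toQ (pos r)]
  have h : 0 ≤ toQ (pos r) + toQ (ngt r) :=
    add_nonneg (FractionField.of_nonneg _) (FractionField.of_nonneg _)
  refine div_le_self h ?_
  rw [map_add, map_one]
  linarith [FractionField.of_nonneg (snd r)]

@[simp] theorem ltQ_eq_zero {r s : M.N} : ltQ r s = 0 ↔ qv r < qv s := by
  simp only [ltQ, ltQC, eval_lam, eval_monus, eval_suc, eval_add, eval_mul, eval_pos, eval_ngt,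
    eval_den, eval_v0, eval_v1, succ_eq_add_one]
  rw [← le_iff_monus, add_one_le_iff, ← FractionField.of_strictMono.lt_iff_lt, qv, qv,
    div_lt_div_iff₀ (den_pos r) (den_pos s)]
  rw [map_add, map_add, map_mul, map_mul, map_mul, map_mul]
  constructor <;> intro h <;> linarith

theorem pow2_add (m n : M.N) : pow2 (m + n) = pow2 m * pow2 n :=
  M.induction_add_one (P := fun n => pow2 (m + n) = pow2 m * pow2 n) (cons m nil)
    (.eq (FinTypeArith.pow2 (add v1 v0)) (mul (FinTypeArith.pow2 v1) (FinTypeArith.pow2 v0)))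
    (by simp) (fun n ih => by rw [← add_assoc, pow2_add_one, pow2_add_one, ih]; ring) n

theorem lt_pow2 (n : M.N) : n < pow2 n := by
  rw [← add_one_le_iff, le_iff_monus]
  refine M.induction_add_one (P := fun n => monus (n + 1) (pow2 n) = 0) nil
    (.eq (FinTypeArith.monus (suc v0) (FinTypeArith.pow2 v0)) zero) (by simp) (fun n ih => ?_) n
  rw [← le_iff_monus] at ih ⊢
  rw [pow2_add_one]
  exact add_le_add ih (le_add_self.trans ih)

theorem pow2_pos (n : M.N) : 0 < pow2 n := zero_le.trans_lt (lt_pow2 n)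

/-- The rational `2⁻ⁿ`. -/
noncomputable def ε (n : M.N) : M.Q := (toQ (pow2 n))⁻¹

theorem ε_pos (n : M.N) : 0 < ε n := inv_pos.2 (toQ_pos (pow2_pos n))

@[simp] theorem ε_zero : ε (0 : M.N) = 1 := by simp [ε]

theorem ε_add (m n : M.N) : ε (m + n) = ε m * ε n := by
  rw [ε, pow2_add, map_mul, mul_inv, ε, ε]

theorem ε_add_one (n : M.N) : ε (n + 1) = ε n / 2 := by
  rw [ε, pow2_add_one, map_add, ← mul_two, mul_inv, ε, div_eq_mul_inv]

theorem toQ_mul_ε_add_lt (k n : M.N) : toQ k * ε (n + k) < ε n := by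
  have h : toQ k * ε k < 1 := by
    rw [ε, ← div_eq_mul_inv, div_lt_one (toQ_pos (pow2_pos k))]
    exact FractionField.of_strictMono (lt_pow2 k)
  rw [ε_add, mul_left_comm]
  exact mul_lt_of_lt_one_right (ε_pos n) h

theorem exists_ε_lt {q : M.Q} (hq : 0 < q) : ∃ n : M.N, ε n < q := by
  obtain ⟨n, hn⟩ := FractionField.exists_lt_of (N := M.N)
    (fun a h => by simpa using add_one_le_iff.2 h) q⁻¹
  exact ⟨n, inv_lt_of_inv_lt₀ hq (hn.trans (FractionField.of_strictMono (lt_pow2 n)))⟩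

@[simp] theorem qv_invPow2 (n : M.N) : qv (invPow2 n) = ε n := by
  simp only [invPow2, invPow2C, eval_lam, eval_mkQ, eval_one, eval_zero, eval_pow2, eval_v0]
  rw [qv_mkQ _ _ _ (pow2_pos n).ne', map_one, map_zero, sub_zero, one_div, ε]

@[simp] theorem qv_zeroQ {Γ : Ctx} (e : M.Env Γ) : qv (eval e zeroQ) = 0 := by
  rw [zeroQ, eval_mkQ, eval_one, qv_mkQ _ _ _ one_ne_zero]
  simp

@[simp] theorem qv_oneQ {Γ : Ctx} (e : M.Env Γ) : qv (eval e oneQ) = 1 := by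
  rw [oneQ, eval_mkQ, eval_one, qv_mkQ _ _ _ one_ne_zero]
  simp

/-- The sequence `f`, made constant from its first step that is not fast on. -/
def hat (f : M.D .fn) (n : M.N) : M.N := eval nil hatC ⋆ f ⋆ n

@[simp] theorem eval_hat {Γ : Ctx} (e : M.Env Γ) (f : Tm Γ .fn) (s : Tm Γ .nat) :
    eval e (FinTypeArith.hat f s) = hat (eval e f) (eval e s) := by
  simp only [FinTypeArith.hat, eval_app, eval_cl]; rfl

/-- The `n`-th step of the sequence `f` of rationals is smaller than `2 ^ (-(n + 1))`. -/
def Fast (f : M.D .fn) (n : M.N) : Prop := |qv (f ⋆ n) - qv (f ⋆ (n + 1))| < ε (n + 1)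

theorem exists_hat (f : M.D .fn) : ∃ j : M.D .fn, (∀ n, hat f n = f ⋆ (j ⋆ n)) ∧ j ⋆ 0 = 0 ∧
    ∀ n, (n ≤ j ⋆ n ∧ Fast f n ∧ j ⋆ (n + 1) = n + 1) ∨
      (¬ (n ≤ j ⋆ n ∧ Fast f n) ∧ j ⋆ (n + 1) = j ⋆ n) := by
  let s : Tm [.nat, .nat, .nat, .fn] .nat :=
    FinTypeArith.cond (add (FinTypeArith.monus v0 v1)
      (FinTypeArith.ltQ (FinTypeArith.absQ (subQ (v3 ⬝ v0) (v3 ⬝ suc v0)))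
        (FinTypeArith.invPow2 (suc v0)))) (suc v0) v1
  have h := rec_lam (M := M) (cons f nil) (z := zero) (s := s) 0 (fun x y => cond (monus y x +
    ltQ (absQ (addQ (f ⋆ y) (negQ (f ⋆ (y + 1))))) (invPow2 (y + 1))) (y + 1) x)
    (by simp) (by simp [s])
  refine ⟨eval (cons f nil) (lam (prim v0 zero s)), fun n => ?_, h.1, fun n => ?_⟩
  · simp only [hat, hatC, eval_lam, eval_app, eval_v1]
    congr 1
  · rw [h.2]
    generalize eval (cons f nil) (lam (prim v0 zero s)) ⋆ n = x
    by_cases hc : monus n x + ltQ (absQ (addQ (f ⋆ n) (negQ (f ⋆ (n + 1))))) (invPow2 (n + 1)) = 0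
    · left
      rw [hc, cond_zero]
      rw [add_eq_zero, ← le_iff_monus, ltQ_eq_zero] at hc
      refine ⟨hc.1, ?_, rfl⟩
      simpa [Fast, sub_eq_add_neg] using hc.2
    · right
      rw [cond_of_ne_zero hc]
      refine ⟨fun h => hc ?_, rfl⟩
      rw [add_eq_zero, ← le_iff_monus, ltQ_eq_zero]
      refine ⟨h.1, ?_⟩
      simpa [Fast, sub_eq_add_neg] using h.2

/-- The rational approximations of the real named by `f`. -/
noncomputable def ap (f : M.D .fn) (n : M.N) : M.Q := qv (hat f n)

theorem hat_eq_of_fast {f : M.D .fn} (hf : ∀ n, Fast f n) (n : M.N) : hat f n = f ⋆ n := by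
  obtain ⟨j, hj, h0, hs⟩ := exists_hat f
  rw [hj]
  congr 1
  refine M.induction_add_one (P := fun n => j ⋆ n = n) (cons j nil) (.eq (v1 ⬝ v0) v0)
    h0 (fun n ih => ?_) n
  rcases hs n with h | h
  · exact h.2.2
  · exact (h.1 ⟨ih.ge, hf n⟩).elim

theorem hat_zero (f : M.D .fn) : hat f 0 = f ⋆ 0 := by
  obtain ⟨j, hj, h0, -⟩ := exists_hat f
  rw [hj, h0]

theorem abs_ap_sub_lt (f : M.D .fn) (n : M.N) : |ap f n - ap f (n + 1)| < ε (n + 1) := by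
  obtain ⟨j, hj, h0, hs⟩ := exists_hat f
  have hle : j ⋆ n ≤ n := by
    rw [le_iff_monus]
    refine M.induction_add_one (P := fun n => monus (j ⋆ n) n = 0) (cons j nil)
      (.eq (FinTypeArith.monus (v1 ⬝ v0) v0) zero) (by simp [h0]) (fun n ih => ?_) n
    rw [← le_iff_monus] at ih ⊢
    rcases hs n with h | h
    · exact h.2.2.le
    · rw [h.2]
      exact ih.trans le_self_add
  rw [ap, ap, hj, hj]
  rcases hs n with h | h
  · rw [h.2.2, le_antisymm hle h.1]
    exact h.2.1
  · rw [h.2, sub_self, abs_zero]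
    exact ε_pos _

theorem abs_ap_sub_le {f : M.D .fn} {m n : M.N} (h : n ≤ m) : |ap f m - ap f n| ≤ ε n := by
  obtain ⟨i, rfl⟩ := h
  have key : |ap f n - ap f (n + i)| + ε (n + i) ≤ ε n := by
    rw [← not_lt]
    refine M.induction_add_one (P := fun i => ¬ ε n < |ap f n - ap f (n + i)| + ε (n + i))
      (cons n (cons f nil))
      (Fm.neg (.eq (FinTypeArith.ltQ (FinTypeArith.invPow2 v1) (FinTypeArith.addQ
        (FinTypeArith.absQ (subQ (FinTypeArith.hat v2 v1) (FinTypeArith.hat v2 (add v1 v0))))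
        (FinTypeArith.invPow2 (add v1 v0)))) zero)) (by simp) (fun i ih => ?_) i
      (hP := fun i => by simp [Sat, ap, sub_eq_add_neg])
    rw [not_lt] at ih ⊢
    have h₁ := abs_ap_sub_lt f (n + i)
    have h₂ := abs_sub_le (ap f n) (ap f (n + i)) (ap f (n + i + 1))
    have h₃ := ε_add_one (n + i)
    rw [← add_assoc]
    linarith
  rw [abs_sub_comm]
  linarith [ε_pos (n + i)]

variable (M) in
/-- The reals of the model. -/
abbrev R : Type := LimitRing M.N M.Q

/-- The embedding of the rationals of the model into its reals. -/
noncomputable abbrev ofQ : M.Q →+* M.R := StandardPart.of (Ultrapower.const M.N M.Q)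

theorem ofQ_strictMono : StrictMono (ofQ (M := M)) := StandardPart.of_strictMono

/-- The real named by `f`. -/
noncomputable def val (f : M.D .fn) : M.R := ultralimit (ap f)

theorem abs_val_sub_le (f : M.D .fn) (n : M.N) : |val f - ofQ (ap f n)| ≤ ofQ (ε n) :=
  abs_ultralimit_sub_of_le
    ((Filter.eventually_ge_atTop n).mono fun _ hm => abs_ap_sub_le hm)

theorem ofQ_ε_add_one_add_self (n : M.N) : ofQ (ε (n + 1)) + ofQ (ε (n + 1)) = ofQ (ε n) := by
  rw [← map_add, ε_add_one, add_halves]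

theorem ofQ_ε_pos (n : M.N) : 0 < ofQ (ε n) := by
  simpa using ofQ_strictMono (ε_pos n)

theorem ofQ_abs (q : M.Q) : ofQ |q| = |ofQ q| := by
  rcases le_total 0 q with h | h
  · rw [abs_of_nonneg h, abs_of_nonneg]
    rw [← map_zero ofQ]
    exact ofQ_strictMono.monotone h
  · rw [abs_of_nonpos h, abs_of_nonpos, map_neg]
    rw [← map_zero ofQ]
    exact ofQ_strictMono.monotone h

theorem abs_val_sub_lt (f : M.D .fn) (n : M.N) : |val f - ofQ (ap f n)| < ofQ (ε n) := by
  have h₁ := abs_val_sub_le f (n + 1)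
  have h₂ : |ofQ (ap f n) - ofQ (ap f (n + 1))| < ofQ (ε (n + 1)) := by
    rw [← map_sub, ← ofQ_abs]
    exact ofQ_strictMono (abs_ap_sub_lt f n)
  have h₃ := ofQ_ε_add_one_add_self n
  have h₄ := abs_sub_le (val f) (ofQ (ap f (n + 1))) (ofQ (ap f n))
  rw [abs_sub_comm] at h₂
  linarith

theorem le_of_forall_ε {x y : M.R} (C : M.Q) (h : ∀ n, x ≤ y + ofQ (C * ε n)) : x ≤ y := by
  refine StandardPart.le_of_forall_le_add_of fun δ hδ => ?_
  obtain ⟨n, hn⟩ := exists_ε_lt (q := δ / (|C| + 1)) (by positivity)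
  refine (h n).trans (add_le_add_right (ofQ_strictMono.monotone ?_) y)
  calc C * ε n ≤ (|C| + 1) * ε n := by
        gcongr
        · exact (ε_pos n).le
        · linarith [le_abs_self C]
    _ ≤ (|C| + 1) * (δ / (|C| + 1)) := by gcongr
    _ = δ := by field_simp

theorem eq_of_forall_ε {x y : M.R} (C : M.Q) (h : ∀ n, |x - y| ≤ ofQ (C * ε n)) : x = y :=
  le_antisymm (le_of_forall_ε C fun n => by linarith [le_abs_self (x - y), h n])
    (le_of_forall_ε C fun n => by linarith [neg_abs_le (x - y), h n])

theorem val_eq_of_approx {f : M.D .fn} {x : M.R} (C : M.Q)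
    (h : ∀ n, |x - ofQ (ap f n)| ≤ ofQ (C * ε n)) : val f = x := by
  refine eq_of_forall_ε (C + 1) fun n => ?_
  have h₁ := abs_val_sub_le f n
  have h₂ := abs_sub_le (val f) (ofQ (ap f n)) x
  have h₃ := h n
  rw [abs_sub_comm] at h₃
  rw [add_mul, one_mul, map_add]
  linarith

/-- The sum of two reals. -/
def addR (f g : M.D .fn) : M.D .fn := eval nil addRC ⋆ f ⋆ g

/-- The product of two reals. -/
def mulR (f g : M.D .fn) : M.D .fn := eval nil mulRC ⋆ f ⋆ g

/-- The negative of a real. -/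
def negR (f : M.D .fn) : M.D .fn := eval nil negRC ⋆ f

/-- The absolute value of a real. -/
def absR (f : M.D .fn) : M.D .fn := eval nil absRC ⋆ f

/-- The constant sequence with value `q`. -/
def constR (q : M.N) : M.D .fn := eval nil constRC ⋆ q

section
variable {Γ : Ctx} (e : M.Env Γ) (f g : Tm Γ .fn)
@[simp] theorem eval_addR : eval e (FinTypeArith.addR f g) = addR (eval e f) (eval e g) := by
  simp only [FinTypeArith.addR, eval_app, eval_cl]; rfl
@[simp] theorem eval_mulR : eval e (FinTypeArith.mulR f g) = mulR (eval e f) (eval e g) := by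
  simp only [FinTypeArith.mulR, eval_app, eval_cl]; rfl
@[simp] theorem eval_negR : eval e (FinTypeArith.negR f) = negR (eval e f) := by
  simp only [FinTypeArith.negR, eval_app, eval_cl]; rfl
@[simp] theorem eval_absR : eval e (FinTypeArith.absR f) = absR (eval e f) := by
  simp only [FinTypeArith.absR, eval_app, eval_cl]; rfl
@[simp] theorem eval_subR : eval e (subR f g) = addR (eval e f) (negR (eval e g)) := by
  simp only [subR, eval_addR, eval_negR]
@[simp] theorem eval_constR (q : Tm Γ .nat) :
    eval e (FinTypeArith.constR q) = constR (eval e q) := by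
  simp only [FinTypeArith.constR, eval_app, eval_cl]; rfl
end

@[simp] theorem constR_app (q n : M.N) : constR q ⋆ n = q := by simp [constR, constRC]

@[simp] theorem val_constR (q : M.N) : val (constR q) = ofQ (qv q) := by
  refine val_eq_of_approx 0 fun n => ?_
  have : ap (constR q) n = qv q := by
    rw [ap, hat_eq_of_fast, constR_app]
    intro n
    simpa [Fast] using ε_pos _
  simp [this]

theorem ap_of_fast {f : M.D .fn} {s : M.N → M.Q} (hs : ∀ n, qv (f ⋆ n) = s n)
    (h : ∀ n, |s n - s (n + 1)| < ε (n + 1)) (n : M.N) : ap f n = s n := by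
  rw [ap, hat_eq_of_fast (fun n => ?_), hs]
  rw [Fast, hs, hs]
  exact h n

@[simp] theorem val_addR (f g : M.D .fn) : val (addR f g) = val f + val g := by
  have h : ∀ n, ap (addR f g) n = ap f (n + 1) + ap g (n + 1) := by
    refine ap_of_fast (fun n => by simp [addR, addRC, ap]) fun n => ?_
    have h₁ := abs_ap_sub_lt f (n + 1)
    have h₂ := abs_ap_sub_lt g (n + 1)
    have h₃ := ε_add_one (n + 1)
    rw [add_sub_add_comm]
    linarith [abs_add_le (ap f (n + 1) - ap f (n + 1 + 1)) (ap g (n + 1) - ap g (n + 1 + 1))]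
  refine val_eq_of_approx 1 fun n => ?_
  have h₁ := abs_val_sub_le f (n + 1)
  have h₂ := abs_val_sub_le g (n + 1)
  rw [h, map_add, add_sub_add_comm, one_mul, ← ofQ_ε_add_one_add_self]
  linarith [abs_add_le (val f - ofQ (ap f (n + 1))) (val g - ofQ (ap g (n + 1)))]

@[simp] theorem val_negR (f : M.D .fn) : val (negR f) = -val f := by
  have h : ∀ n, ap (negR f) n = -ap f n := by
    refine ap_of_fast (fun n => by simp [negR, negRC, ap]) fun n => ?_
    rw [neg_sub_neg, abs_sub_comm]
    exact abs_ap_sub_lt f n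
  refine val_eq_of_approx 1 fun n => ?_
  rw [h, map_neg, neg_sub_neg, abs_sub_comm, one_mul]
  exact abs_val_sub_le f n

@[simp] theorem val_absR (f : M.D .fn) : val (absR f) = |val f| := by
  have h : ∀ n, ap (absR f) n = |ap f n| := by
    refine ap_of_fast (fun n => by simp [absR, absRC, ap]) fun n => ?_
    exact (abs_abs_sub_abs_le _ _).trans_lt (abs_ap_sub_lt f n)
  refine val_eq_of_approx 1 fun n => ?_
  rw [h, ofQ_abs, one_mul]
  exact (abs_abs_sub_abs_le _ _).trans (abs_val_sub_le f n)

theorem abs_mul_sub_mul_le {α : Type*} [CommRing α] [LinearOrder α] [IsStrictOrderedRing α]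
    {a a' b b' A B δ : α} (ha : |a| ≤ A) (hb' : |b'| ≤ B) (haa' : |a - a'| ≤ δ)
    (hbb' : |b - b'| ≤ δ) : |a * b - a' * b'| ≤ (A + B) * δ :=
  have hA : 0 ≤ A := (abs_nonneg a).trans ha
  have hδ : 0 ≤ δ := (abs_nonneg (a - a')).trans haa'
  calc |a * b - a' * b'| = |a * (b - b') + (a - a') * b'| := by ring_nf
    _ ≤ |a| * |b - b'| + |a - a'| * |b'| := by
      rw [← abs_mul, ← abs_mul]
      exact abs_add_le _ _
    _ ≤ A * δ + δ * B := by gcongr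
    _ = (A + B) * δ := by ring

theorem abs_ap_le (f : M.D .fn) (n : M.N) : |ap f n| ≤ |ap f 0| + 1 := by
  have h := abs_ap_sub_le (f := f) (zero_le (a := n))
  rw [ε_zero] at h
  linarith [abs_sub_abs_le_abs_sub (ap f n) (ap f 0)]

theorem abs_val_le (f : M.D .fn) : |val f| ≤ ofQ (|ap f 0| + 1) := by
  have h := abs_val_sub_le f 0
  rw [ε_zero] at h
  rw [map_add, ofQ_abs]
  linarith [abs_sub_abs_le_abs_sub (val f) (ofQ (ap f 0))]

theorem exists_qv_mulR_app (f g : M.D .fn) : ∃ k : M.N,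
    (|ap f 0| + 1) + (|ap g 0| + 1) ≤ toQ k ∧
      ∀ n, qv (mulR f g ⋆ n) = ap f (n + k) * ap g (n + k) := by
  refine ⟨pos (f ⋆ 0) + ngt (f ⋆ 0) + (pos (g ⋆ 0) + ngt (g ⋆ 0)) + 2, ?_, fun n => ?_⟩
  · rw [map_add, map_add, map_ofNat, ap, ap, hat_zero, hat_zero]
    linarith [abs_qv_le (f ⋆ 0), abs_qv_le (g ⋆ 0)]
  · simp [mulR, mulRC, mulBound, ap]

theorem exists_ap_mulR (f g : M.D .fn) : ∃ k : M.N,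
    (|ap f 0| + 1) + (|ap g 0| + 1) ≤ toQ k ∧
      ∀ n, ap (mulR f g) n = ap f (n + k) * ap g (n + k) := by
  obtain ⟨k, hk, happ⟩ := exists_qv_mulR_app f g
  refine ⟨k, hk, ap_of_fast happ fun n => ?_⟩
  have shift : n + 1 + k = n + k + 1 := by ring
  have small := toQ_mul_ε_add_lt k (n + 1)
  rw [shift] at small ⊢
  refine (abs_mul_sub_mul_le (abs_ap_le f _) (abs_ap_le g _) (abs_ap_sub_lt f _).le
    (abs_ap_sub_lt g _).le).trans_lt (lt_of_le_of_lt ?_ small)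
  exact mul_le_mul_of_nonneg_right hk (ε_pos _).le

@[simp] theorem val_mulR (f g : M.D .fn) : val (mulR f g) = val f * val g := by
  obtain ⟨k, hk, hap⟩ := exists_ap_mulR f g
  have abs_ofQ_ap_le (n : M.N) : |ofQ (ap g n)| ≤ ofQ (|ap g 0| + 1) := by
    rw [← ofQ_abs]
    exact ofQ_strictMono.monotone (abs_ap_le g n)
  refine val_eq_of_approx 1 fun n => ?_
  rw [hap, map_mul]
  refine (abs_mul_sub_mul_le (abs_val_le f) (abs_ofQ_ap_le _) (abs_val_sub_le f _)
    (abs_val_sub_le g _)).trans ?_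
  rw [← map_add, ← map_mul, one_mul]
  refine ofQ_strictMono.monotone (le_trans ?_ (toQ_mul_ε_add_lt k n).le)
  exact mul_le_mul_of_nonneg_right hk (ε_pos _).le

@[simp] theorem sat_leR {Γ : Ctx} (e : M.Env Γ) (f g : Tm Γ .fn) :
    Sat e (leR f g) ↔ val (eval e f) ≤ val (eval e g) := by
  have h : Sat e (leR f g) ↔
      ∀ n, ap (eval e f) (n + 1) - ap (eval e g) (n + 1) < ε n := by
    simp [leR, Sat, succ_eq_add_one, ap, sub_eq_add_neg]
  rw [h]
  generalize eval e f = f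
  generalize eval e g = g
  constructor
  · intro h
    refine le_of_forall_ε 2 fun n => ?_
    have h₁ := ofQ_strictMono (h n)
    have h₃ := abs_le.1 (abs_val_sub_le f (n + 1))
    have h₄ := abs_le.1 (abs_val_sub_le g (n + 1))
    rw [map_sub] at h₁
    rw [two_mul, map_add]
    linarith [ofQ_ε_add_one_add_self n, h₃.2, h₄.1]
  · intro h n
    have h₃ := abs_lt.1 (abs_val_sub_lt f (n + 1))
    have h₄ := abs_lt.1 (abs_val_sub_lt g (n + 1))
    rw [← ofQ_strictMono.lt_iff_lt, map_sub]
    linarith [ofQ_ε_add_one_add_self n, h₃.1, h₄.2]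

theorem sat_eqR_iff {Γ : Ctx} (e : M.Env Γ) (f g : Tm Γ .fn) :
    Sat e (eqR f g) ↔ Sat e (leR f g) ∧ Sat e (leR g f) := by
  simp only [leR, eqR, Sat, eval_ltQ, eval_absQ, eval_subQ, eval_hat, eval_suc, eval_v0, eval_wk,
    eval_invPow2, eval_zero, ltQ_eq_zero, qv_absQ, qv_addQ, qv_negQ, qv_invPow2, ← forall_and]
  refine forall_congr' fun n => ?_
  rw [abs_lt]
  constructor <;> rintro ⟨h₁, h₂⟩ <;> constructor <;> linarith

@[simp] theorem sat_eqR {Γ : Ctx} (e : M.Env Γ) (f g : Tm Γ .fn) :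
    Sat e (eqR f g) ↔ val (eval e f) = val (eval e g) := by
  rw [sat_eqR_iff, sat_leR, sat_leR, le_antisymm_iff]

end Model

/-! ## Choice and induction in a model -/

namespace Model

open Interp

variable {M : Model PAwX}

theorem choice {Γ : Ctx} {ρ τ : Ty} (e : M.Env Γ) (A : Fm (τ :: ρ :: Γ)) (hA : A.QF)
    (h : ∀ x, ∃ y, Sat (cons y (cons x e)) A) :
    ∃ Y : M.D (ρ ⇒ τ), ∀ x, Sat (cons (Y ⋆ x) (cons x e)) A := by
  have h₁ := M.sound (.ax (PAwX.qf_ac A hA)) e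
  simp only [Sat, sat_ex, sat_subst] at h₁
  obtain ⟨Y, hY⟩ := h₁ h
  refine ⟨Y, fun x => ?_⟩
  convert hY x using 1
  funext δ v
  rcases v with _ | v
  · rfl
  rcases v with _ | v <;> rfl

/-- Choice yields a step function between witnesses, which primitive recursion iterates. -/
theorem sigma_induction (f : M.D (.nat ⇒ .nat ⇒ .nat)) (h0 : ∃ y, f ⋆ 0 ⋆ y = 0)
    (hs : ∀ n, (∃ y, f ⋆ n ⋆ y = 0) → ∃ y, f ⋆ (n + 1) ⋆ y = 0) (n : M.N) :
    ∃ y, f ⋆ n ⋆ y = 0 := by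
  obtain ⟨y₀, hy₀⟩ := h0
  obtain ⟨Y, hY⟩ := M.choice (ρ := .nat) (τ := .nat) (cons f nil)
    (.eq (v2 ⬝ FinTypeArith.fst v1 ⬝ FinTypeArith.snd v1) zero ⇛
      .eq (v2 ⬝ suc (FinTypeArith.fst v1) ⬝ v0) zero) (by simp [Fm.QF]) (by
        intro x
        by_cases hx : f ⋆ fst x ⋆ snd x = 0
        · obtain ⟨y, hy⟩ := hs _ ⟨_, hx⟩
          exact ⟨y, fun _ => by simpa [Sat] using hy⟩
        · exact ⟨0, fun h => (hx (by simpa [Sat] using h)).elim⟩)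
  simp only [Sat, eval_app, eval_v2, eval_v1, eval_v0, eval_fst, eval_snd, eval_suc, eval_zero,
    succ_eq_add_one] at hY
  have hz := rec_lam (M := M) (cons Y (cons y₀ nil)) (z := v2)
    (s := .var (.vs (.vs (.vs .vz))) ⬝ FinTypeArith.pair v0 v1) y₀ (fun x n => Y ⋆ pair n x)
    (fun _ => rfl) (fun n x y => by simp only [eval_app, eval_pair]; rfl)
  generalize eval (cons Y (cons y₀ nil)) (lam (prim v0 v2 _)) = z at hz
  refine ⟨z ⋆ n, ?_⟩
  refine M.induction_add_one (P := fun n => f ⋆ n ⋆ (z ⋆ n) = 0) (cons f (cons z nil))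
    (.eq (v1 ⬝ v0 ⬝ (v2 ⬝ v0)) zero) (by rw [hz.1, hy₀])
    (fun n ih => ?_) n
  rw [hz.2]
  simpa using hY (pair n (z ⋆ n)) (by simpa using ih)

theorem pred_lt {a : M.N} (h : a ≠ 0) : pred a < a := by
  rw [← add_one_le_iff, pred_add_cancel h]

theorem monus_le (a b : M.N) : monus a b ≤ a := by
  rcases le_total a b with h | h
  · rw [le_iff_monus.1 h]
    exact zero_le
  · rw [(monus_eq_iff h).1 rfl, add_comm, add_monus]
    exact le_self_add

/-- Counting down from `B` turns a failure of the conclusion into a `Σ₁` induction. -/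
theorem pi_induction (f : M.D (.nat ⇒ .nat ⇒ .nat)) (h0 : ∀ y, f ⋆ 0 ⋆ y = 0) (B : M.N)
    (hs : ∀ n < B, (∀ y, f ⋆ n ⋆ y = 0) → ∀ y, f ⋆ (n + 1) ⋆ y = 0) :
    ∀ y, f ⋆ B ⋆ y = 0 := by
  by_contra! hB
  let g := eval (cons B (cons f nil))
    (lam (lam (FinTypeArith.cond (v3 ⬝ FinTypeArith.monus v2 v1 ⬝ v0) (num 1) zero)))
  have hg : ∀ i y, g ⋆ i ⋆ y = 0 ↔ f ⋆ monus B i ⋆ y ≠ 0 := by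
    intro i y
    simp only [g, eval_lam, eval_cond, eval_app, eval_monus, eval_v0, eval_v1, eval_v2, eval_v3,
      eval_one, eval_zero]
    by_cases h : f ⋆ monus B i ⋆ y = 0
    · simp [h]
    · simp [cond_of_ne_zero h, h]
  have hgs (n : M.N) : (∃ y, g ⋆ n ⋆ y = 0) → ∃ y, g ⋆ (n + 1) ⋆ y = 0 := by
    simp only [hg, ← succ_eq_add_one, monus_succ]
    by_cases hn : monus B n = 0
    · rw [hn, pred_zero]
      exact id
    · contrapose!
      intro h
      have := hs _ ((pred_lt hn).trans_le (monus_le B n)) h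
      rwa [pred_add_cancel hn] at this
  obtain ⟨y, hy⟩ := M.sigma_induction g (by simpa [hg] using hB) hgs B
  rw [hg, monus_self] at hy
  exact hy (h0 y)

/-- A sequence of reals that is given by an object of the model. -/
def Internal (a : M.N → M.R) : Prop := ∃ F : M.D (.nat ⇒ .fn), ∀ n, val (F ⋆ n) = a n

theorem Internal.of_tm {Γ : Ctx} (e : M.Env Γ) (t : Tm (.nat :: Γ) .fn) {a : M.N → M.R}
    (h : ∀ n, val (eval (cons n e) t) = a n) : Internal a :=
  ⟨eval e (lam t), fun n => by rw [eval_lam, h]⟩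

theorem Internal.const (f : M.D .fn) : Internal fun _ => val f :=
  .of_tm (cons f nil) v1 fun _ => rfl

theorem Internal.rat (q : M.N) : Internal (M := M) fun _ => ofQ (qv q) :=
  .of_tm (cons q nil) (FinTypeArith.constR v1) fun _ => by simp

theorem Internal.zero : Internal (M := M) fun _ => 0 := by
  simpa using Internal.rat (eval (nil : M.Env []) zeroQ)

theorem Internal.eps : Internal (M := M) fun n => ofQ (ε n) :=
  .of_tm nil (FinTypeArith.constR (FinTypeArith.invPow2 v0)) fun _ => by simp

theorem Internal.add {a b : M.N → M.R} (ha : Internal a) (hb : Internal b) :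
    Internal fun n => a n + b n := by
  obtain ⟨F, hF⟩ := ha
  obtain ⟨G, hG⟩ := hb
  exact .of_tm (cons F (cons G nil)) (FinTypeArith.addR (v1 ⬝ v0) (v2 ⬝ v0))
    fun n => by simp [hF, hG]

theorem Internal.comp {a : M.N → M.R} (ha : Internal a) (h : M.D .fn) :
    Internal fun n => a (h ⋆ n) := by
  obtain ⟨F, hF⟩ := ha
  exact .of_tm (cons F (cons h nil)) (v1 ⬝ (v2 ⬝ v0)) fun n => by simp [hF]

theorem Internal.shift {a : M.N → M.R} (ha : Internal a) (k : M.N) :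
    Internal fun n => a (k + n) := by
  simpa using ha.comp (eval (cons k nil) (lam (FinTypeArith.add v1 v0)))

theorem real_induction {a b : M.N → M.R} (ha : Internal a) (hb : Internal b) (B : M.N)
    (h0 : a 0 ≤ b 0) (hs : ∀ n < B, a n ≤ b n → a (n + 1) ≤ b (n + 1)) : a B ≤ b B := by
  obtain ⟨F, hF⟩ := ha
  obtain ⟨G, hG⟩ := hb
  let f := eval (cons F (cons G nil)) (lam (lam (FinTypeArith.ltQ
    (subQ (FinTypeArith.hat (v2 ⬝ v1) (suc v0)) (FinTypeArith.hat (v3 ⬝ v1) (suc v0)))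
    (FinTypeArith.invPow2 v0))))
  have hf : ∀ n, (∀ y, f ⋆ n ⋆ y = 0) ↔ a n ≤ b n := fun n => by
    rw [← hF, ← hG]
    have := sat_leR (cons n (cons F (cons G nil))) (v1 ⬝ v0) (v2 ⬝ v0)
    simp only [eval_app, eval_v1, eval_v2, eval_v0] at this
    rw [← this]
    simp only [f, leR, Sat, eval_lam, eval_ltQ, eval_subQ, eval_hat, eval_app, eval_wk, eval_suc,
      eval_v0, eval_v1, eval_v2, eval_v3, eval_invPow2, eval_zero]
  rw [← hf] at h0 ⊢
  refine M.pi_induction f h0 B fun n hn => ?_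
  rw [hf, hf]
  exact hs n hn

theorem real_induction_eq {a b : M.N → M.R} (ha : Internal a) (hb : Internal b) (B : M.N)
    (h0 : a 0 = b 0) (hs : ∀ n < B, a n = b n → a (n + 1) = b (n + 1)) : a B = b B := by
  obtain ⟨F, hF⟩ := ha
  obtain ⟨G, hG⟩ := hb
  have internal_abs_sub : Internal fun n => |a n - b n| :=
    .of_tm (cons F (cons G nil)) (FinTypeArith.absR (subR (v1 ⬝ v0) (v2 ⬝ v0)))
      fun n => by simp [hF, hG, sub_eq_add_neg]
  have abs_sub_le_zero_iff : ∀ n, |a n - b n| ≤ 0 ↔ a n = b n := fun n => by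
    rw [abs_nonpos_iff, sub_eq_zero]
  rw [← abs_sub_le_zero_iff] at h0 ⊢
  refine real_induction internal_abs_sub .zero B h0 fun n hn => ?_
  rw [abs_sub_le_zero_iff, abs_sub_le_zero_iff]
  exact hs n hn

theorem exists_selection_lt (F : M.D (.nat ⇒ .nat ⇒ .fn)) (k : M.D .fn)
    (h : ∀ n, ∃ p, val (F ⋆ n ⋆ p) ≤ ofQ (ε (k ⋆ n + 1 + 1))) :
    ∃ Y : M.D .fn, ∀ n, val (F ⋆ n ⋆ (Y ⋆ n)) < ofQ (ε (k ⋆ n)) := by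
  obtain ⟨Y, hY⟩ := M.choice (ρ := .nat) (τ := .nat) (cons F (cons k nil))
    (.eq (FinTypeArith.ltQ (FinTypeArith.hat (v2 ⬝ v1 ⬝ v0) (suc (suc (v3 ⬝ v1))))
      (FinTypeArith.invPow2 (suc (v3 ⬝ v1)))) zero) trivial fun n => by
        obtain ⟨p, hp⟩ := h n
        refine ⟨p, ?_⟩
        suffices ap (F ⋆ n ⋆ p) (k ⋆ n + 1 + 1) < ε (k ⋆ n + 1) by simpa [Sat, ap] using this
        have approx := (abs_lt.1 (abs_val_sub_lt (F ⋆ n ⋆ p) (k ⋆ n + 1 + 1))).1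
        rw [← ofQ_strictMono.lt_iff_lt]
        linarith [ofQ_ε_add_one_add_self (k ⋆ n + 1)]
  refine ⟨Y, fun n => ?_⟩
  have ap_lt : ap (F ⋆ n ⋆ (Y ⋆ n)) (k ⋆ n + 1 + 1) < ε (k ⋆ n + 1) := by
    simpa [Sat, ap] using hY n
  have approx := (abs_lt.1 (abs_val_sub_lt (F ⋆ n ⋆ (Y ⋆ n)) (k ⋆ n + 1 + 1))).2
  rw [← ofQ_strictMono.lt_iff_lt] at ap_lt
  linarith [ofQ_ε_add_one_add_self (k ⋆ n), ofQ_ε_add_one_add_self (k ⋆ n + 1),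
    ofQ_ε_pos (k ⋆ n + 1 + 1)]

theorem Internal.exists_eq_zero_iff {a : M.N → M.R} (ha : Internal a)
    (h : ∀ n, a n = 0 ∨ ofQ (ε n) ≤ a n) : ∃ g : M.D .fn, ∀ n, g ⋆ n = 0 ↔ a n = 0 := by
  obtain ⟨F, hF⟩ := ha
  let g := eval (cons F nil) (lam (FinTypeArith.monus (num 1) (FinTypeArith.ltQ
    (FinTypeArith.invPow2 (suc v0)) (FinTypeArith.hat (v1 ⬝ v0) (suc (suc v0))))))
  have g_eq_zero_iff (n : M.N) : g ⋆ n = 0 ↔ ¬ ε (n + 1) < ap (F ⋆ n) (n + 1 + 1) := by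
    simp only [g, eval_lam, eval_monus, eval_one, eval_ltQ, eval_invPow2, eval_suc, eval_v0,
      eval_v1, eval_app, eval_hat, succ_eq_add_one]
    rw [ap, ← qv_invPow2, ← ltQ_eq_zero, ← le_iff_monus, ← ne_eq, ← pos_iff_ne_zero,
      ← add_one_le_iff, zero_add]
  refine ⟨g, fun n => ?_⟩
  have approx := abs_lt.1 (abs_val_sub_lt (F ⋆ n) (n + 1 + 1))
  rw [hF] at approx
  rw [g_eq_zero_iff, ← ofQ_strictMono.lt_iff_lt]
  have double := ofQ_ε_add_one_add_self n
  have double_add_one := ofQ_ε_add_one_add_self (n + 1)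
  rcases h n with hn | hn
  · exact iff_of_true (by linarith [approx.1]) hn
  · exact iff_of_false (not_not_intro (by linarith [approx.2])) (by linarith)

end Model

/-! ## The sequence -/

/-- The counter: `(t, n, p)` is sent to the number of arguments `x = 0, 1, …` for which a witness
`y` with `t x y n = 0` has been found, one after the other, in `p` steps. -/
def countC : Tm [] ((.nat ⇒ .nat ⇒ .nat ⇒ .nat) ⇒ .nat ⇒ .nat ⇒ .nat) :=
  lam (lam (lam (prim v0 zero
    (cond (.var (.vs (.vs (.vs (.vs .vz)))) ⬝ v1 ⬝ snd v0 ⬝ v3) (suc v1) v1))))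

/-- The summation step: `(t, e, p, x, m)` is sent to `x + 2⁻ᵐ e_{j(m, count t m p)}`. -/
def stepC : Tm [] ((.nat ⇒ .nat ⇒ .nat ⇒ .nat) ⇒ (.nat ⇒ .X) ⇒ .nat ⇒ .X ⇒ .nat ⇒ .X) :=
  lam (lam (lam (lam (lam (addX v1 (smulX (constR (invPow2 v0))
    (v3 ⬝ pair v0 (countC.cl ⬝ .var (.vs (.vs (.vs (.vs .vz)))) ⬝ v0 ⬝ v2))))))))

/-- The `p`-th member of the sequence is `∑_{m ≤ p} 2⁻ᵐ e_{j(m, count t m p)}`. -/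
def seqC : Tm [] ((.nat ⇒ .nat ⇒ .nat ⇒ .nat) ⇒ (.nat ⇒ .X) ⇒ .nat ⇒ .X) :=
  lam (lam (lam (.con .recX ⬝ suc v0 ⬝ zeroX ⬝ (stepC.cl ⬝ v2 ⬝ v1 ⬝ v0))))

namespace Model

open Interp

variable {M : Model PAwX}

/-- The inner product, as a real of the model. -/
noncomputable def ip (x y : M.D .X) : M.R := val (M.con .innerX ⋆ x ⋆ y)

/-- The norm, as a real of the model. -/
noncomputable def nrm (x : M.D .X) : M.R := val (M.con .normX ⋆ x)

@[simp] theorem val_innerX {Γ : Ctx} (e : M.Env Γ) (x y : Tm Γ .X) :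
    val (eval e (innerX x y)) = ip (eval e x) (eval e y) := rfl
@[simp] theorem val_normX {Γ : Ctx} (e : M.Env Γ) (x : Tm Γ .X) :
    val (eval e (normX x)) = nrm (eval e x) := rfl

instance : Zero (M.D .X) := ⟨M.con .zeroX⟩
instance : Add (M.D .X) := ⟨fun x y => M.con .addX ⋆ x ⋆ y⟩

/-- The product of a real and a vector. -/
def smul (a : M.D .fn) (x : M.D .X) : M.D .X := M.con .smulX ⋆ a ⋆ x

@[simp] theorem eval_addX {Γ : Ctx} (e : M.Env Γ) (x y : Tm Γ .X) :
    eval e (addX x y) = eval e x + eval e y := rfl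
@[simp] theorem eval_smulX {Γ : Ctx} (e : M.Env Γ) (a : Tm Γ .fn) (x : Tm Γ .X) :
    eval e (smulX a x) = smul (eval e a) (eval e x) := rfl

theorem ip_comm (x y : M.D .X) : ip x y = ip y x := by
  simpa using M.sound (.ax (PAwX.inner_symm v0 v1)) (cons x (cons y nil))

theorem ip_add_left (x y z : M.D .X) : ip (x + y) z = ip x z + ip y z := by
  simpa using M.sound (.ax (PAwX.inner_add v0 v1 v2)) (cons x (cons y (cons z nil)))

theorem ip_smul_left (a : M.D .fn) (x y : M.D .X) : ip (smul a x) y = val a * ip x y := by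
  simpa using M.sound (.ax (PAwX.inner_smul v0 v1 v2)) (cons a (cons x (cons y nil)))

theorem ip_self (x : M.D .X) : ip x x = nrm x * nrm x := by
  simpa using M.sound (.ax (PAwX.inner_self v0)) (cons x nil)

theorem ip_zero_left (y : M.D .X) : ip 0 y = 0 := by
  have h : (0 : M.D .X) + 0 = 0 :=
    eq_of_ax (ρ := .X) (PAwX.addX_zero (Γ := []) zeroX) nil
  have h' := ip_add_left 0 0 y
  rw [h] at h'
  linarith

/-- The value after `p` steps of the counter for `n`. -/
def count (t : M.D (.nat ⇒ .nat ⇒ .nat ⇒ .nat)) (n p : M.N) : M.N := eval nil countC ⋆ t ⋆ n ⋆ p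

theorem count_eq (t : M.D (.nat ⇒ .nat ⇒ .nat ⇒ .nat)) (n p : M.N) :
    count t n p = eval (cons n (cons t nil)) (lam (prim v0 zero
      (FinTypeArith.cond (.var (.vs (.vs (.vs (.vs .vz)))) ⬝ v1 ⬝ FinTypeArith.snd v0 ⬝ v3)
        (suc v1) v1))) ⋆ p := by simp only [count, countC, eval_lam]

variable {t : M.D (.nat ⇒ .nat ⇒ .nat ⇒ .nat)}

theorem count_zero (n : M.N) : count t n 0 = 0 := by simp [count_eq]

theorem count_add_one (n p : M.N) : count t n (p + 1) =
    cond (t ⋆ count t n p ⋆ snd p ⋆ n) (count t n p + 1) (count t n p) := by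
  simp only [count_eq]
  refine (rec_lam (cons n (cons t nil)) 0 (fun x p => cond (t ⋆ x ⋆ snd p ⋆ n) (x + 1) x)
    (by simp) fun a x p => ?_).2 p
  simp only [eval_cond, eval_suc, eval_app, eval_snd, eval_v0, eval_v1, eval_v3, succ_eq_add_one]
  rfl

theorem count_add_one_of_eq {n p : M.N} (h : t ⋆ count t n p ⋆ snd p ⋆ n = 0) :
    count t n (p + 1) = count t n p + 1 := by rw [count_add_one, h, cond_zero]

theorem count_add_one_of_ne {n p : M.N} (h : t ⋆ count t n p ⋆ snd p ⋆ n ≠ 0) :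
    count t n (p + 1) = count t n p := by rw [count_add_one, cond_of_ne_zero h]

theorem eval_count {Γ : Ctx} (e : M.Env Γ) (t : Tm Γ (.nat ⇒ .nat ⇒ .nat ⇒ .nat))
    (n p : Tm Γ .nat) :
    eval e (countC.cl ⬝ t ⬝ n ⬝ p) = count (eval e t) (eval e n) (eval e p) := by
  simp only [eval_app, eval_cl]; rfl

theorem count_mono (n : M.N) {p q : M.N} (h : p ≤ q) : count t n p ≤ count t n q := by
  obtain ⟨i, rfl⟩ := h
  rw [le_iff_monus]
  refine M.induction_add_one (P := fun i => monus (count t n p) (count t n (p + i)) = 0)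
    (cons t (cons n (cons p nil))) (.eq (FinTypeArith.monus (countC.cl ⬝ v1 ⬝ v2 ⬝ v3)
      (countC.cl ⬝ v1 ⬝ v2 ⬝ add v3 v0)) zero)
    (by rw [← le_iff_monus, add_zero]) (fun i ih => ?_) i
    (hP := fun i => by simp only [Sat, eval_monus, eval_count, eval_add, eval_v0, eval_v1, eval_v2,
      eval_v3, eval_zero])
  rw [← le_iff_monus] at ih ⊢
  rw [← add_assoc]
  by_cases h : t ⋆ count t n (p + i) ⋆ snd (p + i) ⋆ n = 0
  · rw [count_add_one_of_eq h]
    exact ih.trans le_self_add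
  · rw [count_add_one_of_ne h]
    exact ih

/-- The counter for `n` finally takes the value `j`. -/
def CountLim (t : M.D (.nat ⇒ .nat ⇒ .nat ⇒ .nat)) (n j : M.N) : Prop :=
  ∃ p₀, ∀ p, p₀ ≤ p → count t n p = j

theorem countLim_or (n j : M.N) : CountLim t n j ∨ ∃ p₀, ∀ p, p₀ ≤ p → count t n p ≠ j := by
  by_cases h : ∃ p₀, j < count t n p₀
  · obtain ⟨p₀, h⟩ := h
    exact .inr ⟨p₀, fun p hp => (h.trans_le (count_mono n hp)).ne'⟩
  · push Not at h
    by_cases h' : ∃ p₀, count t n p₀ = j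
    · obtain ⟨p₀, h'⟩ := h'
      exact .inl ⟨p₀, fun p hp => le_antisymm (h p) (h'.ge.trans (count_mono n hp))⟩
    · push Not at h'
      exact .inr ⟨0, fun p _ => h' p⟩

theorem CountLim.unique {n i j : M.N} (hi : CountLim t n i) (hj : CountLim t n j) : i = j := by
  obtain ⟨p, hp⟩ := hi
  obtain ⟨q, hq⟩ := hj
  rw [← hp _ (le_max_left p q), hq _ (le_max_right p q)]

theorem CountLim.count_eq {n p q : M.N} (h : CountLim t n (count t n p)) (hpq : p ≤ q) :
    count t n q = count t n p := by
  obtain ⟨p₀, hp⟩ := h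
  refine le_antisymm ?_ (count_mono n hpq)
  rw [← hp _ (le_max_right q p₀)]
  exact count_mono n (le_max_left _ _)

theorem count_le_of_forall_ne {n x : M.N} (h : ∀ y, t ⋆ x ⋆ y ⋆ n ≠ 0) (p : M.N) :
    count t n p ≤ x := by
  rw [le_iff_monus]
  refine M.induction_add_one (P := fun p => monus (count t n p) x = 0)
    (cons t (cons n (cons x nil))) (.eq (FinTypeArith.monus (countC.cl ⬝ v1 ⬝ v2 ⬝ v0) v3) zero)
    (by rw [← le_iff_monus, count_zero]; exact zero_le) (fun p ih => ?_) p
    (hP := fun i => by simp only [Sat, eval_monus, eval_count, eval_v0, eval_v1, eval_v2, eval_v3,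
      eval_zero])
  rw [← le_iff_monus] at ih ⊢
  by_cases ht : t ⋆ count t n p ⋆ snd p ⋆ n = 0
  · rw [count_add_one_of_eq ht, add_one_le_iff]
    refine lt_of_le_of_ne ih fun heq => h (snd p) ?_
    rwa [heq] at ht
  · rw [count_add_one_of_ne ht]
    exact ih

theorem countLim_of_forall_ne {n p : M.N} (h : ∀ q, count t n q ≠ count t n p + 1) :
    CountLim t n (count t n p) := by
  refine ⟨p, ?_⟩
  rintro _ ⟨i, rfl⟩
  refine M.induction_add_one (P := fun i => count t n (p + i) = count t n p)
    (cons t (cons n (cons p nil)))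
    (.eq (countC.cl ⬝ v1 ⬝ v2 ⬝ add v3 v0) (countC.cl ⬝ v1 ⬝ v2 ⬝ v3))
    (by rw [add_zero]) (fun i ih => ?_) i
    (hP := fun i => by simp only [Sat, eval_count, eval_add, eval_v0, eval_v1, eval_v2, eval_v3])
  rw [← add_assoc]
  by_cases ht : t ⋆ count t n (p + i) ⋆ snd (p + i) ⋆ n = 0
  · exact (h _ (by rw [count_add_one_of_eq ht, ih])).elim
  · rw [count_add_one_of_ne ht, ih]

theorem exists_count_eq {n : M.N} (h : ¬ ∃ j, CountLim t n j) (v : M.N) :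
    ∃ p, count t n p = v := by
  let f := eval (cons n (cons t nil)) (lam (lam (FinTypeArith.add
    (FinTypeArith.monus v1 (countC.cl ⬝ v3 ⬝ v2 ⬝ v0))
    (FinTypeArith.monus (countC.cl ⬝ v3 ⬝ v2 ⬝ v0) v1))))
  have hf : ∀ v p, f ⋆ v ⋆ p = 0 ↔ count t n p = v := fun v p => by
    simp only [f, eval_lam, eval_add, eval_monus, eval_count, eval_v0, eval_v1, eval_v2,
      eval_v3, add_eq_zero, ← le_iff_monus, le_antisymm_iff (a := count t n p)]
    exact and_comm
  simp only [← hf]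
  refine M.sigma_induction f ⟨0, by rw [hf, count_zero]⟩ (fun v => ?_) v
  simp only [hf]
  rintro ⟨p, rfl⟩
  by_contra! hne
  exact h ⟨_, countLim_of_forall_ne hne⟩

theorem exists_countLim_iff (n : M.N) :
    (∃ j, CountLim t n j) ↔ ¬ ∀ x, ∃ y, t ⋆ x ⋆ y ⋆ n = 0 := by
  constructor
  · rintro ⟨j, p₀, hp⟩ h
    obtain ⟨y, hy⟩ := h j
    have count_p : count t n (pair p₀ y) = j := hp _ (le_pair p₀ y)
    have count_p_add_one := count_add_one_of_eq (t := t) (n := n) (p := pair p₀ y)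
      (by rw [count_p, snd_pair, hy])
    rw [count_p, hp _ ((le_pair p₀ y).trans le_self_add)] at count_p_add_one
    exact absurd count_p_add_one.symm (by simp)
  · contrapose!
    intro diverges x
    by_contra! hx
    obtain ⟨p, hp⟩ := exists_count_eq (not_exists.2 diverges) (x + 1)
    exact absurd (hp ▸ count_le_of_forall_ne hx p) (add_one_le_iff.not.2 (lt_irrefl x))

end Model

namespace Model

open Interp

variable {M : Model PAwX}

/-- The `m`-th vector occurring in the `p`-th member of the sequence. -/
def vec (t : M.D (.nat ⇒ .nat ⇒ .nat ⇒ .nat)) (e : M.D (.nat ⇒ .X)) (p m : M.N) : M.D .X :=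
  e ⋆ pair m (count t m p)

/-- The sum of the first `q` summands of the `p`-th member of the sequence. -/
def part (t : M.D (.nat ⇒ .nat ⇒ .nat ⇒ .nat)) (e : M.D (.nat ⇒ .X)) (p q : M.N) : M.D .X :=
  M.con .recX ⋆ q ⋆ 0 ⋆ (eval nil stepC ⋆ t ⋆ e ⋆ p)

variable {t : M.D (.nat ⇒ .nat ⇒ .nat ⇒ .nat)} {e : M.D (.nat ⇒ .X)}

/-- The sequence of the theorem, for the parameters `t` and `e`. -/
def seq (t : M.D (.nat ⇒ .nat ⇒ .nat ⇒ .nat)) (e : M.D (.nat ⇒ .X)) : M.D (.nat ⇒ .X) :=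
  eval nil seqC ⋆ t ⋆ e

theorem seq_app (p : M.N) : seq t e ⋆ p = part t e p (p + 1) := by
  simp only [seq, seqC, eval_lam, eval_app, eval_con, eval_suc, eval_cl, eval_v0, eval_v1, eval_v2,
    succ_eq_add_one]
  rfl

theorem part_zero (p : M.N) : part t e p 0 = 0 :=
  eq_of_ax (ρ := .X) (PAwX.recX_zero v0 v1)
    (cons (0 : M.D .X) (cons (eval nil stepC ⋆ t ⋆ e ⋆ p) nil))

theorem part_add_one (p q : M.N) :
    part t e p (q + 1) = part t e p q + smul (constR (invPow2 q)) (vec t e p q) := by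
  have h : part t e p (succ q) = eval nil stepC ⋆ t ⋆ e ⋆ p ⋆ part t e p q ⋆ q :=
    eq_of_ax (ρ := .X) (PAwX.recX_succ v0 v1 v2)
      (cons q (cons (0 : M.D .X) (cons (eval nil stepC ⋆ t ⋆ e ⋆ p) nil)))
  rw [← succ_eq_add_one, h]
  simp only [stepC, eval_lam, eval_addX, eval_smulX, eval_constR, eval_invPow2, eval_app, eval_pair,
    eval_cl, eval_v0, eval_v1, eval_v2, eval_v3]
  rfl

theorem ip_part_zero (p : M.N) (y : M.D .X) : ip (part t e p 0) y = 0 := by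
  rw [part_zero, ip_zero_left]

theorem ip_part_add_one (p q : M.N) (y : M.D .X) :
    ip (part t e p (q + 1)) y = ip (part t e p q) y + ofQ (ε q) * ip (vec t e p q) y := by
  rw [part_add_one, ip_add_left, ip_smul_left, val_constR, qv_invPow2]

theorem internal_ip_part (p : M.N) (y : M.D .X) : Internal fun q => ip (part t e p q) y :=
  .of_tm (cons (eval nil stepC ⋆ t ⋆ e ⋆ p) (cons y nil))
    (innerX (.con .recX ⬝ v0 ⬝ zeroX ⬝ v1) v2) fun _ => rfl

theorem internal_ip_part_self (p : M.N) :
    Internal fun q => ip (part t e p q) (part t e p q) :=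
  .of_tm (cons (eval nil stepC ⋆ t ⋆ e ⋆ p) nil)
    (innerX (.con .recX ⬝ v0 ⬝ zeroX ⬝ v1) (.con .recX ⬝ v0 ⬝ zeroX ⬝ v1)) fun _ => rfl

theorem pair_inj {a b c d : M.N} (h : pair a b = pair c d) : a = c ∧ b = d :=
  ⟨by simpa using congrArg fst h, by simpa using congrArg snd h⟩

/-- Orthonormality of a sequence of vectors of the model. -/
def Orthonormal (e : M.D (.nat ⇒ .X)) : Prop :=
  (∀ i, ip (e ⋆ i) (e ⋆ i) = 1) ∧ ∀ i j, i ≠ j → ip (e ⋆ i) (e ⋆ j) = 0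

theorem ip_part_of_ne (he : Orthonormal e) {n j p : M.N} (h : count t n p ≠ j) (q : M.N) :
    ip (part t e p q) (e ⋆ pair n j) = 0 := by
  refine real_induction_eq (internal_ip_part p _) .zero q (ip_part_zero _ _)
    fun q _ ih => ?_
  rw [ip_part_add_one, ih, vec, he.2, mul_zero, add_zero]
  intro h'
  obtain ⟨rfl, h''⟩ := pair_inj h'
  exact h h''

theorem ip_part_of_le (he : Orthonormal e) {n j p q : M.N} (h : q ≤ n) :
    ip (part t e p q) (e ⋆ pair n j) = 0 := by
  refine real_induction_eq (internal_ip_part p _) .zero q (ip_part_zero _ _)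
    fun m hm ih => ?_
  rw [ip_part_add_one, ih, vec, he.2, mul_zero, add_zero]
  intro h'
  exact (hm.trans_le h).ne (pair_inj h').1

theorem ip_part_of_eq (he : Orthonormal e) {n p q : M.N} (h : n < q) :
    ip (part t e p q) (e ⋆ pair n (count t n p)) = ofQ (ε n) := by
  obtain ⟨i, rfl⟩ := add_one_le_iff.2 h
  refine real_induction_eq ((internal_ip_part p _).shift (n + 1))
    (b := fun _ => ofQ (ε n)) (by simpa using Internal.rat (invPow2 n)) i ?_ fun m _ ih => ?_
  · rw [add_zero, ip_part_add_one, ip_part_of_le he le_rfl, vec, he.1]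
    ring
  · rw [← add_assoc, ip_part_add_one, ih, vec, he.2, mul_zero, add_zero]
    intro h'
    have h₁ := (pair_inj h').1
    have h₂ : n < n + 1 + m := add_one_le_iff.1 le_self_add
    exact h₂.ne' h₁

theorem ip_part_add_one_self (he : Orthonormal e) (p q : M.N) :
    ip (part t e p (q + 1)) (part t e p (q + 1)) =
      ip (part t e p q) (part t e p q) + ofQ (ε (q + q)) := by
  rw [ip_part_add_one, ip_comm _ (part t e p (q + 1)), ip_comm (vec t e p q), ip_part_add_one,
    ip_part_add_one, ip_comm (vec t e p q) (part t e p q), vec, ip_part_of_le he le_rfl, he.1,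
    ε_add, map_mul]
  ring

theorem internal_const_two : Internal (M := M) fun _ => 2 := by
  convert Internal.rat (addQ (eval (nil : M.Env []) oneQ) (eval nil oneQ)) using 2
  rw [qv_addQ, qv_oneQ, one_add_one_eq_two, map_ofNat]

theorem internal_ε_add_self : Internal (M := M) fun q => ofQ (ε (q + q)) := by
  simpa using Internal.eps.comp (eval (nil : M.Env []) (lam (add v0 v0)))

theorem ip_part_self_le (he : Orthonormal e) (p q : M.N) :
    ip (part t e p q) (part t e p q) ≤ 2 := by
  have add_two_ε_le : ip (part t e p q) (part t e p q) +
      (ofQ (ε (q + q)) + ofQ (ε (q + q))) ≤ 2 := by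
    refine real_induction (a := fun q => ip (part t e p q) (part t e p q) +
      (ofQ (ε (q + q)) + ofQ (ε (q + q)))) (b := fun _ => 2) ((internal_ip_part_self p).add
        (internal_ε_add_self.add internal_ε_add_self)) internal_const_two q ?_ fun m _ ih => ?_
    · simp [ip_part_zero, one_add_one_eq_two]
    · have double := ofQ_ε_add_one_add_self (m + m)
      have double_add_one := ofQ_ε_add_one_add_self (m + m + 1)
      have pos := ofQ_ε_pos (m + m + 1 + 1)
      rw [ip_part_add_one_self he, show m + 1 + (m + 1) = m + m + 1 + 1 by ring]
      linarith
  linarith [ofQ_ε_pos (q + q)]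

theorem nrm_part_le (he : Orthonormal e) (p q : M.N) : nrm (part t e p q) ≤ 2 := by
  have sq_le := ip_part_self_le he (t := t) p q
  rw [ip_self] at sq_le
  by_contra! hlt
  nlinarith

/-- `x` is a weak cluster point of `φ`: arbitrarily late members of `φ` come close to `x` when
tested against `y`, for each vector `y` separately. -/
def WeakClusterPt (φ : M.D (.nat ⇒ .X)) (x : M.D .X) : Prop :=
  ∀ y k p₀, ∃ p, p₀ ≤ p ∧ |ip y (φ ⋆ p) - ip y x| ≤ ofQ (ε k)

variable {φ : M.D (.nat ⇒ .X)} {x : M.D .X}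

theorem WeakClusterPt.le_of_eventually (hx : WeakClusterPt φ x) {y : M.D .X} {r : M.R} {p₀ : M.N}
    (hr : ∀ p, p₀ ≤ p → r ≤ ip y (φ ⋆ p)) : r ≤ ip y x := by
  refine le_of_forall_ε 1 fun n => ?_
  obtain ⟨p, hp, close⟩ := hx y n p₀
  rw [one_mul]
  linarith [hr p hp, (abs_le.1 close).2]

theorem WeakClusterPt.eq_of_eventually (hx : WeakClusterPt φ x) {y : M.D .X} {r : M.R} {p₀ : M.N}
    (hr : ∀ p, p₀ ≤ p → ip y (φ ⋆ p) = r) : ip y x = r := by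
  refine le_antisymm (le_of_forall_ε 1 fun n => ?_) (hx.le_of_eventually fun p hp => (hr p hp).ge)
  obtain ⟨p, hp, close⟩ := hx y n p₀
  rw [one_mul]
  linarith [hr p hp, (abs_le.1 close).1]

theorem coeff_of_countLim (he : Orthonormal e) (hx : WeakClusterPt (seq t e) x) {n j : M.N}
    (hj : CountLim t n j) : ip (e ⋆ pair n j) x = ofQ (ε n) := by
  obtain ⟨p₀, count_eq_j⟩ := hj
  refine hx.eq_of_eventually (p₀ := max p₀ n) fun p hp => ?_
  rw [seq_app, ip_comm, ← count_eq_j p ((le_max_left _ _).trans hp)]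
  exact ip_part_of_eq he (lt_add_one_iff.2 ((le_max_right _ _).trans hp))

theorem coeff_of_not_countLim (he : Orthonormal e) (hx : WeakClusterPt (seq t e) x) {n j : M.N}
    (hj : ¬ CountLim t n j) : ip (e ⋆ pair n j) x = 0 := by
  obtain ⟨p₀, count_ne_j⟩ := (countLim_or n j).resolve_left hj
  refine hx.eq_of_eventually (p₀ := p₀) fun p hp => ?_
  rw [seq_app, ip_comm]
  exact ip_part_of_ne he (count_ne_j p hp) _

theorem coeff_nonneg (he : Orthonormal e) (hx : WeakClusterPt (seq t e) x) (n j : M.N) :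
    0 ≤ ip (e ⋆ pair n j) x := by
  by_cases hj : CountLim t n j
  · rw [coeff_of_countLim he hx hj]
    exact (ofQ_ε_pos n).le
  · rw [coeff_of_not_countLim he hx hj]

theorem ip_vec_mono (he : Orthonormal e) (hx : WeakClusterPt (seq t e) x) {p p' : M.N}
    (hp : p ≤ p') (m : M.N) : ip (vec t e p m) x ≤ ip (vec t e p' m) x := by
  by_cases hj : CountLim t m (count t m p)
  · rw [vec, vec, hj.count_eq hp]
  · rw [vec, coeff_of_not_countLim he hx hj]
    exact coeff_nonneg he hx _ _

theorem ip_part_mono_right (he : Orthonormal e) (hx : WeakClusterPt (seq t e) x) (p : M.N)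
    {q q' : M.N} (hq : q ≤ q') : ip (part t e p q) x ≤ ip (part t e p q') x := by
  obtain ⟨i, rfl⟩ := hq
  refine real_induction (a := fun _ => ip (part t e p q) x)
    (Internal.const (M.con .innerX ⋆ part t e p q ⋆ x))
    ((internal_ip_part p x).shift q) i (by rw [add_zero]) fun m _ ih => ?_
  have summand_nonneg := mul_nonneg (ofQ_ε_pos (q + m)).le
    (coeff_nonneg he hx (q + m) (count t (q + m) p))
  rw [← add_assoc, ip_part_add_one, vec]
  linarith

theorem ip_part_mono_left (he : Orthonormal e) (hx : WeakClusterPt (seq t e) x) {p p' : M.N}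
    (hp : p ≤ p') (q : M.N) : ip (part t e p q) x ≤ ip (part t e p' q) x := by
  refine real_induction (internal_ip_part p x) (internal_ip_part p' x) q
    (by rw [ip_part_zero, ip_part_zero]) fun m _ ih => ?_
  have summand_le := mul_le_mul_of_nonneg_left (ip_vec_mono he hx hp m) (ofQ_ε_pos m).le
  rw [ip_part_add_one, ip_part_add_one]
  linarith

theorem ip_part_add_ε_le (he : Orthonormal e) (hx : WeakClusterPt (seq t e) x) {n p p' q : M.N}
    (hpp' : p ≤ p') (hnq : n < q) (hp : ¬ CountLim t n (count t n p))
    (hp' : CountLim t n (count t n p')) :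
    ip (part t e p q) x + ofQ (ε (n + n)) ≤ ip (part t e p' q) x := by
  obtain ⟨i, rfl⟩ := add_one_le_iff.2 hnq
  refine real_induction (a := fun i => ip (part t e p (n + 1 + i)) x + ofQ (ε (n + n)))
    (((internal_ip_part p x).shift (n + 1)).add (by simpa using Internal.rat (invPow2 (n + n))))
    ((internal_ip_part p' x).shift (n + 1)) i ?_ fun m _ ih => ?_
  · have ip_vec : ip (vec t e p n) x = 0 := coeff_of_not_countLim he hx hp
    have ip_vec' : ip (vec t e p' n) x = ofQ (ε n) := coeff_of_countLim he hx hp'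
    simp only [add_zero, ip_part_add_one]
    rw [ip_vec, ip_vec', ε_add, map_mul]
    linarith [ip_part_mono_left he hx hpp' n]
  · have summand_le := mul_le_mul_of_nonneg_left (ip_vec_mono he hx hpp' (n + 1 + m))
      (ofQ_ε_pos (n + 1 + m)).le
    simp only [← add_assoc, ip_part_add_one]
    linarith

theorem ip_seq_add_le (he : Orthonormal e) (hx : WeakClusterPt (seq t e) x) {n j p : M.N}
    (hj : CountLim t n j) (hp : count t n p ≠ j) :
    ip x (seq t e ⋆ p) + ofQ (ε (n + n)) ≤ ip x x := by
  have ⟨p₀, count_eq_j⟩ := hj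
  refine hx.le_of_eventually (p₀ := max p₀ (max n p)) fun p' hp' => ?_
  obtain ⟨hp₀, hnp⟩ := max_le_iff.1 hp'
  rw [ip_comm x, ip_comm x, seq_app, seq_app]
  calc ip (part t e p (p + 1)) x + ofQ (ε (n + n))
      ≤ ip (part t e p (max n p + 1)) x + ofQ (ε (n + n)) := by
        gcongr
        exact ip_part_mono_right he hx p (add_le_add_left (le_max_right n p) 1)
    _ ≤ ip (part t e p' (max n p + 1)) x :=
        ip_part_add_ε_le he hx ((le_max_right n p).trans hnp)
          (lt_add_one_iff.2 (le_max_left n p)) (fun h => hp (h.unique hj))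
          (by rwa [count_eq_j p' hp₀])
    _ ≤ ip (part t e p' (p' + 1)) x :=
        ip_part_mono_right he hx p' (add_le_add_left hnp 1)

theorem exists_ip_self_sub_lt (hx : WeakClusterPt φ x) :
    ∃ Y : M.D .fn, ∀ n, ip x x - ip x (φ ⋆ (Y ⋆ n)) < ofQ (ε (n + n)) := by
  let F : M.D (.nat ⇒ .nat ⇒ .fn) := eval (cons x (cons φ nil))
    (lam (lam (subR (innerX v2 v2) (innerX v2 (v3 ⬝ v0)))))
  let k : M.D .fn := eval nil (lam (add v0 v0))
  have val_F (n p : M.N) : val (F ⋆ n ⋆ p) = ip x x - ip x (φ ⋆ p) := by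
    simp [F, sub_eq_add_neg]
  have k_app (n : M.N) : k ⋆ n = n + n := by simp [k]
  obtain ⟨Y, hY⟩ := exists_selection_lt F k fun n => by
    obtain ⟨p, -, close⟩ := hx x (k ⋆ n + 1 + 1) 0
    exact ⟨p, by linarith [val_F n p, (abs_le.1 close).1]⟩
  exact ⟨Y, fun n => by simpa only [val_F, k_app] using hY n⟩

theorem exists_characteristic (he : Orthonormal e) (hx : WeakClusterPt (seq t e) x) :
    ∃ g : M.D .fn, ∀ n, g ⋆ n = 0 ↔ ∀ x, ∃ y, t ⋆ x ⋆ y ⋆ n = 0 := by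
  obtain ⟨Y, hY⟩ := exists_ip_self_sub_lt hx
  have countLim_iff (n : M.N) : (∃ j, CountLim t n j) ↔ CountLim t n (count t n (Y ⋆ n)) := by
    refine ⟨fun ⟨j, hj⟩ => ?_, fun h => ⟨_, h⟩⟩
    by_cases hne : count t n (Y ⋆ n) = j
    · rwa [hne]
    · linarith [ip_seq_add_le he hx hj hne, hY n]
  have internal_coeff :
      Internal fun n => ip (e ⋆ pair n (count t n (Y ⋆ n))) x :=
    .of_tm (cons Y (cons t (cons e (cons x nil))))
      (innerX (v3 ⬝ FinTypeArith.pair v0 (countC.cl ⬝ v2 ⬝ v0 ⬝ (v1 ⬝ v0)))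
        (.var (.vs (.vs (.vs (.vs .vz)))))) fun n => by
        rw [val_innerX, eval_app, eval_pair, eval_count, eval_app]
        simp only [eval_v0, eval_v1, eval_v2, eval_v3]
        rfl
  obtain ⟨g, hg⟩ := internal_coeff.exists_eq_zero_iff fun n => by
    by_cases hj : CountLim t n (count t n (Y ⋆ n))
    · exact .inr (coeff_of_countLim he hx hj).ge
    · exact .inl (coeff_of_not_countLim he hx hj)
  refine ⟨g, fun n => ?_⟩
  rw [hg, ← not_iff_not, ← exists_countLim_iff, countLim_iff]
  by_cases hj : CountLim t n (count t n (Y ⋆ n))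
  · simp [hj, coeff_of_countLim he hx hj, (ofQ_ε_pos n).ne']
  · simp [hj, coeff_of_not_countLim he hx hj]

end Model

namespace Model

open Interp

variable {M : Model PAwX} {Γ : Ctx} (e : M.Env Γ)

@[simp] theorem sat_le (s t : Tm Γ .nat) : Sat e (le s t) ↔ eval e s ≤ eval e t := by
  rw [le_iff_monus, le, Sat, eval_monus, eval_zero]

theorem Orthonormal.of_sat {s : Tm Γ (.nat ⇒ .X)} (h : Sat e (OrthonormalSeq s)) :
    Orthonormal (eval e s) := by
  have ip_eq_delta (i j : M.N) : ip (eval e s ⋆ i) (eval e s ⋆ j) =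
      ofQ (qv (cond (monus i j + monus j i) (eval (cons j (cons i e)) oneQ)
        (eval (cons j (cons i e)) zeroQ))) := by
    simpa [delta] using (sat_eqR _ _ _).1 (h i j)
  refine ⟨fun i => ?_, fun i j hij => ?_⟩
  · rw [ip_eq_delta, monus_self, add_zero, cond_zero, qv_oneQ, map_one]
  · have dist_ne_zero : monus i j + monus j i ≠ 0 := by
      rw [ne_eq, add_eq_zero, ← le_iff_monus, ← le_iff_monus, ← le_antisymm_iff]
      exact hij
    rw [ip_eq_delta, cond_of_ne_zero dist_ne_zero, qv_zeroQ, map_zero]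

theorem sat_boundedSeq {s : Tm Γ (.nat ⇒ .X)} (h : ∀ i, nrm (eval e s ⋆ i) ≤ 2) :
    Sat e (BoundedSeq s) := by
  refine (sat_ex _ _).2 ⟨constR (addQ (eval e oneQ) (eval e oneQ)), fun i => (sat_leR _ _ _).2 ?_⟩
  simpa [one_add_one_eq_two, map_ofNat ofQ 2] using h i

theorem sat_strictIncr (s : Tm Γ .fn) :
    Sat e (StrictIncr s) ↔ ∀ i, eval e s ⋆ i + 1 ≤ eval e s ⋆ (i + 1) := by
  refine forall_congr' fun i => (sat_le _ _ _).trans ?_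
  simp [succ_eq_add_one]

theorem subseqC_app (x : M.D (.nat ⇒ .X)) (h : M.D .fn) (i : M.N) :
    eval nil subseqC ⋆ x ⋆ h ⋆ i = x ⋆ (h ⋆ i) := by
  simp [subseqC]

theorem sat_weakLim (s : Tm Γ (.nat ⇒ .X)) (f : Tm Γ .fn) (z : Tm Γ .X) :
    Sat e (WeakLim (subseq s f) z) ↔ ∀ y k, ∃ m, ∀ i, m ≤ i →
      |ip y (eval e s ⋆ (eval e f ⋆ i)) - ip y (eval e z)| ≤ ofQ (ε k) := by
  refine forall_congr' fun y => forall_congr' fun k => (sat_ex _ _).trans <|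
    exists_congr fun m => forall_congr' fun i => imp_congr (sat_le _ _ _) <|
      (sat_leR _ _ _).trans ?_
  simp [subseq, eval_cl, subseqC_app, sub_eq_add_neg]

theorem sat_pi02CA (t : Tm Γ (.nat ⇒ .nat ⇒ .nat ⇒ .nat)) :
    Sat e (Pi02CA t) ↔
      ∃ g : M.D .fn, ∀ n, g ⋆ n = 0 ↔ ∀ x, ∃ y, eval e t ⋆ x ⋆ y ⋆ n = 0 := by
  refine (sat_ex _ _).trans <| exists_congr fun g => forall_congr' fun n =>
    (sat_iff _ _ _).trans <| iff_congr (by simp [Sat]) <| forall_congr' fun x =>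
      (sat_ex _ _).trans <| exists_congr fun y => ?_
  simp [Sat]

theorem le_app_of_strictIncr {f : M.D .fn} (hf : ∀ i, f ⋆ i + 1 ≤ f ⋆ (i + 1)) (i : M.N) :
    i ≤ f ⋆ i := by
  rw [le_iff_monus]
  refine M.induction_add_one (P := fun i => monus i (f ⋆ i) = 0) (cons f nil)
    (.eq (FinTypeArith.monus v0 (v1 ⬝ v0)) zero) (le_iff_monus.1 zero_le) (fun i ih => ?_) i
  rw [← le_iff_monus] at ih ⊢
  exact (add_le_add_left ih 1).trans (hf i)

theorem exists_weakClusterPt_of_sat {s : Tm Γ (.nat ⇒ .X)} (hbounded : Sat e (BoundedSeq s))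
    (hBW : Sat e (BWweak s)) : ∃ x, WeakClusterPt (eval e s) x := by
  obtain ⟨x, exists_subseq⟩ := (sat_ex _ _).1 (hBW hbounded)
  obtain ⟨f, hf⟩ := (sat_ex _ _).1 exists_subseq
  obtain ⟨incr, lim⟩ := (sat_and _ _ _).1 hf
  rw [sat_strictIncr] at incr
  rw [sat_weakLim] at lim
  simp only [eval_wk, eval_v0, eval_v1] at incr lim
  refine ⟨x, fun y k p₀ => ?_⟩
  obtain ⟨m, close⟩ := lim y k
  exact ⟨f ⋆ max m p₀, (le_max_right m p₀).trans (le_app_of_strictIncr incr _),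
    close _ (le_max_left m p₀)⟩

theorem sat_boundedSeq_and_bwweak_imp {t : Tm Γ (.nat ⇒ .nat ⇒ .nat ⇒ .nat)}
    {a : M.D (.nat ⇒ .X)} {s : Tm Γ (.nat ⇒ .X)} (hs : eval e s = seq (eval e t) a)
    (ha : Orthonormal a) : Sat e (.and (BoundedSeq s) (BWweak s ⇛ Pi02CA t)) := by
  have bounded : Sat e (BoundedSeq s) := sat_boundedSeq e fun i => by
    rw [hs, seq_app]
    exact nrm_part_le ha _ _
  refine (sat_and _ _ _).2 ⟨bounded, fun hBW => (sat_pi02CA _ _).2 ?_⟩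
  obtain ⟨x, hx⟩ := exists_weakClusterPt_of_sat e bounded hBW
  exact exists_characteristic ha (hs ▸ hx)

end Model

end FinTypeArith

theorem mainTheorem5_general :
    (∀ (Γ : Ctx) (t : Tm Γ (.nat ⇒ .nat ⇒ .nat ⇒ .nat)),
      Der PAwX [] (.ex (.nat ⇒ .X) (OrthonormalSeq v0) ⇛
        .ex (.nat ⇒ .X) (.and (BoundedSeq v0) (BWweak v0 ⇛ Pi02CA t.wk)))) ∧
    (∃ F : Tm [] ((.nat ⇒ .nat ⇒ .nat ⇒ .nat) ⇒ (.nat ⇒ .X) ⇒ .nat ⇒ .X),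
      ∀ (Γ : Ctx) (t : Tm Γ (.nat ⇒ .nat ⇒ .nat ⇒ .nat)) (e : Tm Γ (.nat ⇒ .X)),
        Der PAwX [] (OrthonormalSeq e ⇛
          .and (BoundedSeq (F.cl ⬝ t ⬝ e)) (BWweak (F.cl ⬝ t ⬝ e) ⇛ Pi02CA t))) := by
  refine ⟨fun Γ t => der_of_forall_model PAwX.isEqTheory fun M ν h => ?_, seqC, fun Γ t e =>
    der_of_forall_model PAwX.isEqTheory fun M ν h => ?_⟩
  · obtain ⟨a, ha⟩ := (Interp.sat_ex _ _).1 h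
    exact (Interp.sat_ex _ _).2 ⟨_, Model.sat_boundedSeq_and_bwweak_imp _
      (by rw [Interp.eval_wk]; rfl) (Model.Orthonormal.of_sat _ ha)⟩
  · exact Model.sat_boundedSeq_and_bwweak_imp ν
      (by rw [Model.eval_app, Model.eval_app, Interp.eval_cl]; rfl) (Model.Orthonormal.of_sat ν h)

theorem mainTheorem5 :
    (∀ (Γ : Ctx) (t : Tm Γ (.nat ⇒ .nat ⇒ .nat ⇒ .nat)),
      Provable (.ex (.nat ⇒ .X) (OrthonormalSeq v0) ⇛
        .ex (.nat ⇒ .X) (.and (BoundedSeq v0) (BWweak v0 ⇛ Pi02CA t.wk)))) ∧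
    (∃ F : Tm [] ((.nat ⇒ .nat ⇒ .nat ⇒ .nat) ⇒ (.nat ⇒ .X) ⇒ .nat ⇒ .X),
      ∀ (Γ : Ctx) (t : Tm Γ (.nat ⇒ .nat ⇒ .nat ⇒ .nat)) (e : Tm Γ (.nat ⇒ .X)),
        Provable (OrthonormalSeq e ⇛
          .and (BoundedSeq (F.cl ⬝ t ⬝ e)) (BWweak (F.cl ⬝ t ⬝ e) ⇛ Pi02CA t))) := by
  obtain ⟨exists_seq, F, hF⟩ := mainTheorem5_general
  exact ⟨fun Γ t => .mono (fun _ _ => .inl) (exists_seq Γ t), F,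
    fun Γ t e => .mono (fun _ _ => .inl) (hF Γ t e)⟩
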